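/- Let $F$ be a number field and $\ell$ a prime number; let $v$ run over the finite places of $F$. For a rational prime $p$ let $\widehat{\mathbb Q}_p^c$ be the compositum, over all primes $q$, of the cyclotomic $\mathbb Z_q$-extensions of $\mathbb Q_p$, and for $v\mid p$ put $\tilde f_v=[F_v\cap\widehat{\mathbb Q}_p^c:\mathbb Q_p]$ and $\deg v=\tilde f_v\deg_\ell p$, where $\deg_\ell p=\operatorname{Log}_\ell p$ if $p\ne\ell$, $\deg_\ell \ell=\ell$ if $\ell\neq 2$, and $\deg_2 2=4$ ($\operatorname{Log}_\ell$ is the Iwasawa logarithm on $\mathbb Q_\ell^\times$, normalized by $\operatorname{Log}_\ell\ell=0$). For $x\in F_v^\times$ let $|x|_v=N_{F_v/\mathbb Q_\ell}(x)$ if $v\mid\ell$ and $|x|_v=(Nv)^{-v(x)}$ if $v\nmid\ell$ (with $Nv$ the absolute norm of $v$), and let $\tilde v_v(x)=-\operatorname{Log}_\ell(|x|_v)/\deg v$ be the logarithmic valuation. Let $\mathcal{D}\ell$ be the free $\mathbb Z_\ell$-module on the finite places, $\deg(\sum_v n_v v)=\sum_v n_v\deg v$, let $\widetilde{\mathcal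 D\ell}$ be the kernel of $\deg$, and let $\widetilde{\mathcal P\ell}$ be the submodule of principal logarithmic divisors $\operatorname{div}(\beta)=\sum_v\tilde v_v(\beta)\,v$, $\beta\in\mathbb Z_\ell\otimes_{\mathbb Z}F^\times$ (the $\tilde v_v$ being extended $\mathbb Z_\ell$-linearly). Let $\widetilde{\mathcal C\ell}=\widetilde{\mathcal D\ell}/\widetilde{\mathcal P\ell}$, and let $\widetilde{\mathcal C\ell}(\ell)\subseteq\widetilde{\mathcal C\ell}$ be the subgroup of classes of degree-zero logarithmic divisors supported at the places above $\ell$. Suppose that there are $s>1$ places $\mathfrak p_1,\dots,\mathfrak p_s$ of $F$ above $\ell$, ordered so that $v_\ell(\deg\mathfrak p_1)=\min_{1\le i\le s}v_\ell(\deg\mathfrak p_i)$. Let $\gamma_1,\dots,\gamma_r$ generate the group $\{\alpha\in F^\times: v(\alpha)=0\text{ for all finite }v\nmid\ell\}$ of $\ell$-units of $F$ modulo its torsion subgroup (in particular, they may be any basis of the $\ell$-units). Put $[\mathfrak g_i]=\bigl[\mathfrak p_i-\frac{\deg\mathfrak p_i}{\deg\mathfrak p_1}\mathfrak p_1\bigr]$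 for $i=2,\dots,s$. Then: 1. $\widetilde{\mathcal C\ell}(\ell)$ is generated, as a $\mathbb Z_\ell$-module, by $[\mathfrak g_2],\dots,[\mathfrak g_s]$. 2. All $\tilde v_{\mathfrak p_i}(\gamma_j)$ with $2\le i\le s$, $1\le j\le r$ lie in $\mathbb Z_\ell$, and $\sum_{i=2}^s\tilde v_{\mathfrak p_i}(\gamma_j)[\mathfrak g_i]=0$ for every $j$. 3. These relations generate all relations: for $b=(b_2,\dots,b_s)\in\mathbb Z_\ell^{s-1}$ one has $\sum_{i=2}^s b_i[\mathfrak g_i]=0$ if and only if $b$ is a $\mathbb Z_\ell$-linear combination of the vectors $(\tilde v_{\mathfrak p_2}(\gamma_j),\dots,\tilde v_{\mathfrak p_s}(\gamma_j))$, $1\le j\le r$. -/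

import Mathlib

open NumberField IsDedekindDomain
open scoped TensorProduct

noncomputable section

namespace LogClass

section IwasawaLogarithm

variable (p : ℕ) [Fact p.Prime]

/-- The logarithm series `log (1 + x) = ∑_{n ≥ 1} (-1) ^ (n - 1) x ^ n / n` on `ℚ_[p]`;
it converges for `‖x‖ < 1`. -/
def logOneAdd (x : ℚ_[p]) : ℚ_[p] :=
  ∑' n : ℕ, (-1) ^ n * x ^ (n + 1) / ((n : ℚ_[p]) + 1)

/-- The unit part `a / p ^ v_p(a)` of a `p`-adic number. -/
def unitPart (a : ℚ_[p]) : ℚ_[p] := a * (p : ℚ_[p]) ^ (-a.valuation)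

/-- The Iwasawa logarithm `Log_p : ℚ_pˣ → ℚ_p`, i.e. the extension of the logarithm series with
`Log_p p = 0`. If `u` is the unit part of `a`, then `u ^ (p - 1)` is a principal unit and
`Log_p a = log (u ^ (p - 1)) / (p - 1)`. -/
def iwasawaLog (a : ℚ_[p]) : ℚ_[p] :=
  logOneAdd p (unitPart p a ^ (p - 1) - 1) / ((p : ℚ_[p]) - 1)

theorem choose_tendsto (k : ℕ) :
    Filter.Tendsto (fun n : ℕ => (((p ^ n - 1).choose k : ℕ) : ℚ_[p])) Filter.atTop
      (nhds ((-1) ^ k)) := by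
  have hp0 : (p : ℚ_[p]) ≠ 0 := by exact_mod_cast (Fact.out : p.Prime).ne_zero
  have hpn : Filter.Tendsto (fun n : ℕ => (p : ℚ_[p]) ^ n) Filter.atTop (nhds 0) :=
    tendsto_pow_atTop_nhds_zero_of_norm_lt_one (by
      rw [Padic.norm_p]; exact inv_lt_one_of_one_lt₀ (by exact_mod_cast (Fact.out : p.Prime).one_lt))
  induction k with
  | zero => simp
  | succ k ih =>
    have key : ∀ n : ℕ, (((p ^ n - 1).choose (k + 1) : ℕ) : ℚ_[p]) =
        (p : ℚ_[p]) ^ n * (((p ^ n - 1).choose k : ℕ) : ℚ_[p]) / ((k : ℚ_[p]) + 1)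
          - (((p ^ n - 1).choose k : ℕ) : ℚ_[p]) := by
      intro n
      obtain ⟨m, hm⟩ : ∃ m, p ^ n = m + 1 :=
        Nat.exists_eq_succ_of_ne_zero (pow_ne_zero _ (Fact.out : p.Prime).ne_zero)
      have hk : ((k : ℚ_[p]) + 1) ≠ 0 := by exact_mod_cast Nat.succ_ne_zero k
      have h1 : (((m + 1) * m.choose k : ℕ) : ℚ_[p]) = (((m + 1).choose (k + 1) * (k + 1) : ℕ)) := by
        rw [Nat.add_one_mul_choose_eq]
      have h2 : (((m + 1).choose (k + 1) : ℕ) : ℚ_[p]) = ((m.choose k + m.choose (k + 1) : ℕ)) := by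
        rw [Nat.choose_succ_succ]
      have h3 : (p : ℚ_[p]) ^ n = (m : ℚ_[p]) + 1 := by exact_mod_cast congrArg (Nat.cast (R := ℚ_[p])) hm
      rw [h3, hm, Nat.add_sub_cancel]
      push_cast at h1 h2
      rw [h2] at h1
      field_simp
      linear_combination -h1
    simp_rw [key]
    have := ((hpn.mul ih).div_const ((k : ℚ_[p]) + 1)).sub ih
    simpa [pow_succ] using this

theorem logOneAdd_tendsto {x : ℚ_[p]} (hx : ‖x‖ < 1) :
    Filter.Tendsto (fun n : ℕ => ((1 + x) ^ (p ^ n) - 1) / (p : ℚ_[p]) ^ n) Filter.atTop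
      (nhds (logOneAdd p x)) := by
  have hsum : Summable fun k : ℕ => ((k + 1 : ℕ) : ℝ) ^ 1 * ‖x‖ ^ (k + 1) :=
    (summable_nat_add_iff (f := fun k : ℕ => (k : ℝ) ^ 1 * ‖x‖ ^ k) 1).2
      (summable_pow_mul_geometric_of_norm_lt_one (R := ℝ) 1 (by rwa [norm_norm]))
  have hk0 : ∀ k : ℕ, ((k : ℚ_[p]) + 1) ≠ 0 := fun k => by exact_mod_cast Nat.succ_ne_zero k
  have hinv : ∀ k : ℕ, ‖(k : ℚ_[p]) + 1‖⁻¹ ≤ ((k + 1 : ℕ) : ℝ) := by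
    intro k
    have h1 := Padic.norm_eq_zpow_neg_valuation (hk0 k)
    have h2 : ((k : ℚ_[p]) + 1).valuation = (padicValNat p (k + 1) : ℤ) := by
      rw [← Padic.valuation_natCast]; push_cast; rfl
    rw [h1, h2, zpow_neg, inv_inv, zpow_natCast]
    exact_mod_cast Nat.le_of_dvd (Nat.succ_pos k) pow_padicValNat_dvd
  have main := tendsto_tsum_of_dominated_convergence
    (f := fun n k : ℕ => (((p ^ n - 1).choose k : ℕ) : ℚ_[p]) * x ^ (k + 1) / ((k : ℚ_[p]) + 1))
    (𝓕 := Filter.atTop) hsum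
    (fun k => ((choose_tendsto p k).mul_const (x ^ (k + 1))).div_const ((k : ℚ_[p]) + 1))
    (Filter.Eventually.of_forall fun n k => by
      rw [norm_div, norm_mul, norm_pow, div_eq_mul_inv, mul_comm (_ * _), pow_one]
      have h3 : ‖(((p ^ n - 1).choose k : ℕ) : ℚ_[p])‖ ≤ 1 := by
        simpa using Padic.norm_int_le_one (p := p) ((p ^ n - 1).choose k : ℤ)
      refine mul_le_mul (hinv k) ?_ (by positivity) (by positivity)
      exact mul_le_of_le_one_left (by positivity) h3)
  refine main.congr fun n => ?_
  obtain ⟨m, hm⟩ : ∃ m, p ^ n = m + 1 :=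
    Nat.exists_eq_succ_of_ne_zero (pow_ne_zero _ (Fact.out : p.Prime).ne_zero)
  have h3 : (p : ℚ_[p]) ^ n = (m : ℚ_[p]) + 1 := by exact_mod_cast congrArg (Nat.cast (R := ℚ_[p])) hm
  rw [h3, hm, Nat.add_sub_cancel, tsum_eq_sum (s := Finset.range (m + 1))]
  · rw [add_comm 1 x, add_pow, Finset.sum_range_succ' _ (m + 1), eq_div_iff (hk0 m), Finset.sum_mul]
    simp only [one_pow, mul_one, pow_zero, Nat.choose_zero_right, Nat.cast_one, add_sub_cancel_right]
    refine Finset.sum_congr rfl fun k _ => ?_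
    have h1 : (((m + 1) * m.choose k : ℕ) : ℚ_[p]) = (((m + 1).choose (k + 1) * (k + 1) : ℕ)) := by
      rw [Nat.add_one_mul_choose_eq]
    push_cast at h1
    have := hk0 k
    field_simp
    linear_combination x ^ (k + 1) * h1
  · intro k hk
    rw [Nat.choose_eq_zero_of_lt (by simpa using hk)]
    simp

theorem logOneAdd_mul {x y : ℚ_[p]} (hx : ‖x - 1‖ < 1) (hy : ‖y - 1‖ < 1) :
    logOneAdd p (x * y - 1) = logOneAdd p (x - 1) + logOneAdd p (y - 1) := by
  have hp0 : (p : ℚ_[p]) ≠ 0 := by exact_mod_cast (Fact.out : p.Prime).ne_zero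
  have hpn : Filter.Tendsto (fun n : ℕ => (p : ℚ_[p]) ^ n) Filter.atTop (nhds 0) :=
    tendsto_pow_atTop_nhds_zero_of_norm_lt_one (by
      rw [Padic.norm_p]; exact inv_lt_one_of_one_lt₀ (by exact_mod_cast (Fact.out : p.Prime).one_lt))
  have hxy : ‖x * y - 1‖ < 1 := by
    have : x * y - 1 = (x - 1) * (y - 1) + ((x - 1) + (y - 1)) := by ring
    rw [this]
    refine (IsUltrametricDist.norm_add_le_max _ _).trans_lt (max_lt ?_ ?_)
    · rw [norm_mul]; exact mul_lt_one_of_nonneg_of_lt_one_left (norm_nonneg _) hx hy.le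
    · exact (IsUltrametricDist.norm_add_le_max _ _).trans_lt (max_lt hx hy)
  have tx := logOneAdd_tendsto p hx
  have ty := logOneAdd_tendsto p hy
  have txy := logOneAdd_tendsto p hxy
  have := ((hpn.mul (tx.mul ty)).add (tx.add ty))
  rw [zero_mul, zero_add] at this
  refine tendsto_nhds_unique txy (this.congr fun n => ?_)
  simp only [add_sub_cancel]
  have := pow_ne_zero n hp0
  field_simp
  ring

theorem norm_unitPart {a : ℚ_[p]} (ha : a ≠ 0) : ‖unitPart p a‖ = 1 := by
  have hp0 : (p : ℝ) ≠ 0 := by exact_mod_cast (Fact.out : p.Prime).ne_zero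
  rw [unitPart, norm_mul, norm_zpow, Padic.norm_p, Padic.norm_eq_zpow_neg_valuation ha, inv_zpow,
    ← zpow_neg, neg_neg, ← zpow_add₀ hp0, neg_add_cancel, zpow_zero]

theorem norm_unit_pow_sub_one {u : ℚ_[p]} (hu : ‖u‖ = 1) : ‖u ^ (p - 1) - 1‖ < 1 := by
  obtain ⟨z, rfl⟩ : ∃ z : ℤ_[p], (z : ℚ_[p]) = u := ⟨⟨u, hu.le⟩, rfl⟩
  have h : PadicInt.toZMod (z ^ (p - 1) - 1) = 0 := by
    rw [map_sub, map_pow, map_one, ZMod.pow_card_sub_one_eq_one, sub_self]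
    intro h0
    rw [← RingHom.mem_ker, PadicInt.ker_toZMod, IsLocalRing.mem_maximalIdeal,
      PadicInt.mem_nonunits] at h0
    exact h0.ne (by rw [PadicInt.norm_def]; exact hu)
  rw [← RingHom.mem_ker, PadicInt.ker_toZMod, IsLocalRing.mem_maximalIdeal,
    PadicInt.mem_nonunits, PadicInt.norm_def] at h
  exact_mod_cast h

theorem iwasawaLog_mul {a b : ℚ_[p]} (ha : a ≠ 0) (hb : b ≠ 0) :
    iwasawaLog p (a * b) = iwasawaLog p a + iwasawaLog p b := by
  have hp0 : (p : ℚ_[p]) ≠ 0 := by exact_mod_cast (Fact.out : p.Prime).ne_zero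
  have hu : unitPart p (a * b) = unitPart p a * unitPart p b := by
    rw [unitPart, unitPart, unitPart, Padic.valuation_mul ha hb, neg_add, zpow_add₀ hp0]
    ring
  rw [iwasawaLog, hu, mul_pow, logOneAdd_mul p (norm_unit_pow_sub_one p (norm_unitPart p ha))
    (norm_unit_pow_sub_one p (norm_unitPart p hb)), add_div]
  rfl

/-- The Iwasawa logarithm as a homomorphism `ℚ_pˣ → ℚ_p`. -/
def iwasawaLogHom : Additive ℚ_[p]ˣ →+ ℚ_[p] :=
  AddMonoidHom.mk' (fun a => iwasawaLog p (a.toMul : ℚ_[p])) fun a b => by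
    simpa using iwasawaLog_mul p a.toMul.ne_zero b.toMul.ne_zero

end IwasawaLogarithm

section Completions

variable {F : Type*} [Field F]

/-- The rational prime below the finite place `v`. -/
def residueChar (v : HeightOneSpectrum (𝓞 F)) : ℕ := ringChar (𝓞 F ⧸ v.asIdeal)

theorem residueChar_mem (v : HeightOneSpectrum (𝓞 F)) :
    ((residueChar v : ℕ) : 𝓞 F) ∈ v.asIdeal := by
  rw [← Ideal.Quotient.eq_zero_iff_mem, map_natCast]
  exact CharP.cast_eq_zero (𝓞 F ⧸ v.asIdeal) _

variable [NumberField F]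

instance (v : HeightOneSpectrum (𝓞 F)) : Fact (residueChar v).Prime := by
  have : v.asIdeal.IsMaximal := v.isMaximal
  let _ := Ideal.Quotient.field v.asIdeal
  have : Finite (𝓞 F ⧸ v.asIdeal) := v.asIdeal.finiteQuotientOfFreeOfNeBot v.ne_bot
  exact ⟨CharP.char_is_prime (𝓞 F ⧸ v.asIdeal) _⟩

variable (p : ℕ) [Fact p.Prime] (v : HeightOneSpectrum (𝓞 F))

/-- The inclusion `ℚ → F_v`, with the `p`-adic topology on `ℚ`. -/
def ratToCompletion : WithVal (Rat.padicValuation p) →+* v.adicCompletion F :=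
  (algebraMap ℚ (v.adicCompletion F)).comp (WithVal.equiv (Rat.padicValuation p)).toRingHom

theorem valuation_ratCast_le_one (hv : (p : 𝓞 F) ∈ v.asIdeal) {q : ℚ}
    (hq : Rat.padicValuation p q ≤ 1) : v.valuation F (q : F) ≤ 1 := by
  have hd : ((q.den : ℕ) : 𝓞 F) ∉ v.asIdeal := by
    intro h
    have hc : Nat.Coprime p q.den :=
      ((Fact.out : p.Prime).coprime_iff_not_dvd).2 (Rat.padicValuation_le_one_iff.1 hq)
    obtain ⟨a, b, hab⟩ := Nat.isCoprime_iff_coprime.2 hc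
    refine v.isPrime.ne_top ((Ideal.eq_top_iff_one _).2 ?_)
    have h1 : (a : 𝓞 F) * (p : 𝓞 F) + (b : 𝓞 F) * (q.den : 𝓞 F) = 1 := by
      exact_mod_cast congrArg (Int.cast (R := 𝓞 F)) hab
    rw [← h1]
    exact Ideal.add_mem _ (Ideal.mul_mem_left _ _ hv) (Ideal.mul_mem_left _ _ h)
  have h2 : v.valuation F (q.den : F) = 1 := by
    have := (v.valuation_eq_one_iff_notMem (K := F)).2 hd
    simpa using this
  have h3 : v.valuation F (q.num : F) ≤ 1 := by
    have := v.valuation_le_one (K := F) ((q.num : ℤ) : 𝓞 F)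
    simpa using this
  rw [Rat.cast_def, map_div₀, h2, div_one]
  exact h3

theorem ratToCompletion_uniformContinuous (hv : (p : 𝓞 F) ∈ v.asIdeal) :
    UniformContinuous (ratToCompletion p v) := by
  refine uniformContinuous_addMonoidHom_of_continuous
    (f := (ratToCompletion p v).toAddMonoidHom) ?_
  refine continuous_of_continuousAt_zero _ ?_
  intro s hs
  rw [map_zero, Valued.mem_nhds_zero] at hs
  obtain ⟨γ, hγ⟩ := hs
  have hp : v.valuation F (p : F) < 1 := by
    have := (v.valuation_lt_one_iff_mem (K := F) (p : 𝓞 F)).2 hv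
    simpa using this
  obtain ⟨n, hn⟩ := exists_pow_lt₀ hp
    (Units.mk0 _ (MonoidWithZeroHom.ValueGroup₀.embedding_unit_ne_zero γ))
  have hpn : (p : ℚ) ^ n ≠ 0 := pow_ne_zero _ (by exact_mod_cast (Fact.out : p.Prime).ne_zero)
  rw [Filter.mem_map, Valued.mem_nhds_zero]
  refine ⟨Units.mk0 (Valued.v.restrict ((WithVal.equiv (Rat.padicValuation p)).symm ((p : ℚ) ^ n)))
    (by simpa using hpn), fun x hx => hγ ?_⟩
  obtain ⟨q, rfl⟩ := (WithVal.equiv (Rat.padicValuation p)).symm.surjective x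
  rw [Set.mem_ofPred_eq, Units.val_mk0, Valuation.restrict_lt_iff] at hx
  rw [Set.mem_ofPred_eq, Valuation.restrict_lt_iff_lt_embedding]
  change Rat.padicValuation p q < Rat.padicValuation p ((p : ℚ) ^ n) at hx
  have hq : Rat.padicValuation p (q / (p : ℚ) ^ n) ≤ 1 := by
    rw [map_div₀]
    exact div_le_one_of_le₀ hx.le zero_le
  have hval : Valued.v (ratToCompletion p v ((WithVal.equiv (Rat.padicValuation p)).symm q)) =
      v.valuation F (q : F) := by
    rw [← HeightOneSpectrum.adicCompletion.valued_coe]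
    congr 1
  change Valued.v (ratToCompletion p v ((WithVal.equiv (Rat.padicValuation p)).symm q)) < _
  rw [hval]
  refine lt_of_le_of_lt ?_ hn
  have hqe : (q : F) = ((q / (p : ℚ) ^ n : ℚ) : F) * (p : F) ^ n := by
    have : q = q / (p : ℚ) ^ n * (p : ℚ) ^ n := (div_mul_cancel₀ _ hpn).symm
    exact_mod_cast congrArg (Rat.cast (K := F)) this
  rw [hqe, map_mul, map_pow]
  exact mul_le_of_le_one_left' (valuation_ratCast_le_one p v hv hq)

/-- For `v ∣ p`, the continuous extension `ℚ_p → F_v` of the inclusion of `ℚ`. -/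
def padicToCompletion (hv : (p : 𝓞 F) ∈ v.asIdeal) : ℚ_[p] →+* v.adicCompletion F :=
  IsDenseInducing.extendRingHom Padic.isUniformInducing_cast_withVal
    Padic.isDenseInducing_cast_withVal.dense (ratToCompletion_uniformContinuous p v hv)

/-- The `ℚ_p`-algebra structure on the completion `F_v`, for `v ∣ p`. -/
abbrev completionAlgebra (hv : (p : 𝓞 F) ∈ v.asIdeal) : Algebra ℚ_[p] (v.adicCompletion F) :=
  (padicToCompletion p v hv).toAlgebra

/-- The norm `N_{F_v/ℚ_p}`, for `v ∣ p`. -/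
def localNorm (hv : (p : 𝓞 F) ∈ v.asIdeal) : v.adicCompletion F →* ℚ_[p] :=
  letI := completionAlgebra p v hv
  Algebra.norm ℚ_[p]

end Completions

section LogarithmicDegree

/-- The extension of `K` in `Ω` generated by the roots of unity of `q`-power order. -/
def adjoinRootsOfUnity (K Ω : Type*) [Field K] [Field Ω] [Algebra K Ω] (q : ℕ) :
    IntermediateField K Ω :=
  IntermediateField.adjoin K {ζ : Ω | ∃ n : ℕ, ζ ^ q ^ n = 1}

/-- The cyclotomic `ℤ_q`-extension of `K = ℚ_p` in `Ω`: the subfield of `K(μ_{q^∞})` fixed by the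
torsion of the (abelian) Galois group of `K(μ_{q^∞})` over `K`. -/
def cyclotomicZqExtension (K Ω : Type*) [Field K] [Field Ω] [Algebra K Ω] (q : ℕ) :
    IntermediateField K Ω :=
  IntermediateField.lift (F := adjoinRootsOfUnity K Ω q)
    (IntermediateField.fixedField
      (Subgroup.closure {σ : Gal(adjoinRootsOfUnity K Ω q/K) | IsOfFinOrder σ}))

/-- The compositum in `Ω` of the cyclotomic `ℤ_q`-extensions of `K = ℚ_p`, for all primes `q`. -/
def cyclotomicZHatExtension (K Ω : Type*) [Field K] [Field Ω] [Algebra K Ω] :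
    IntermediateField K Ω :=
  ⨆ q : Nat.Primes, cyclotomicZqExtension K Ω q

variable {F : Type*} [Field F] [NumberField F]

/-- The absolute logarithmic inertia degree `[F_v ∩ ℚ̂_p^c : ℚ_p]` of a place `v ∣ p`, where
`ℚ̂_p^c` is the cyclotomic `ℤ̂`-extension of `ℚ_p`. The intersection is taken in an algebraic
closure of `F_v`. -/
def logInertiaDeg (p : ℕ) [Fact p.Prime] (v : HeightOneSpectrum (𝓞 F))
    (hv : (p : 𝓞 F) ∈ v.asIdeal) : ℕ :=
  letI := completionAlgebra p v hv
  letI Ω := AlgebraicClosure (v.adicCompletion F)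
  Module.finrank ℚ_[p] ↥((IsScalarTower.toAlgHom ℚ_[p] (v.adicCompletion F) Ω).fieldRange ⊓
    cyclotomicZHatExtension ℚ_[p] Ω)

variable (ℓ : ℕ) [Fact ℓ.Prime]

open Classical in
/-- The `ℓ`-adic degree `deg v = f̃_v · deg_ℓ p` of a place `v ∣ p`, where `deg_ℓ p` is `Log_ℓ p`
if `p ≠ ℓ`, and `deg_ℓ ℓ` is `ℓ` if `ℓ ≠ 2`, and `4` if `ℓ = 2`. -/
def placeDeg (v : HeightOneSpectrum (𝓞 F)) : ℚ_[ℓ] :=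
  if h : (ℓ : 𝓞 F) ∈ v.asIdeal then
    logInertiaDeg ℓ v h * (if ℓ = 2 then 4 else (ℓ : ℚ_[ℓ]))
  else
    logInertiaDeg (residueChar v) v (residueChar_mem v) * iwasawaLog ℓ (residueChar v : ℚ_[ℓ])

end LogarithmicDegree

section RelativeQuotient

variable {R M : Type*} [CommRing R] [AddCommGroup M] [Module R M]

/-- The quotient `N / (N ∩ P)` for submodules `N` and `P` of a module. -/
abbrev RelQuotient (N P : Submodule R M) : Type _ := N ⧸ P.comap N.subtype

/-- The projection `N → N / (N ∩ P)`. -/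
abbrev relMkQ (N P : Submodule R M) : N →ₗ[R] RelQuotient N P := (P.comap N.subtype).mkQ

end RelativeQuotient

section LogarithmicDivisors

variable {F : Type*} [Field F] [NumberField F] (ℓ : ℕ) [Fact ℓ.Prime]

/-- The homomorphism `x ↦ (N v) ^ (-v(x))` from `F_vˣ` to `ℚ_ℓˣ`, for `v ∤ ℓ`. -/
def tameAbs (v : HeightOneSpectrum (𝓞 F)) : (v.adicCompletion F)ˣ →* ℚ_[ℓ]ˣ where
  toFun x := (Units.mk0 (Ideal.absNorm v.asIdeal : ℚ_[ℓ]) (by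
    simpa [Ideal.absNorm_eq_zero_iff] using v.ne_bot)) ^
      WithZero.log (Valued.v (x : v.adicCompletion F))
  map_one' := by simp
  map_mul' x y := by
    rw [Units.val_mul, map_mul, WithZero.log_mul (by simp) (by simp), zpow_add]

open Classical in
/-- The `ℓ`-adic absolute value `|·|_v : F_vˣ → ℚ_ℓˣ` whose logarithm gives the logarithmic
valuation: the local norm `N_{F_v/ℚ_ℓ}(x)` if `v ∣ ℓ`, and `(N v) ^ (-v(x))` if `v ∤ ℓ`. -/
def padicAbs (v : HeightOneSpectrum (𝓞 F)) : (v.adicCompletion F)ˣ →* ℚ_[ℓ]ˣ :=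
  if h : (ℓ : 𝓞 F) ∈ v.asIdeal then Units.map (localNorm ℓ v h) else tameAbs ℓ v

/-- The logarithmic valuation `ṽ(x) = - Log_ℓ |x|_v / deg v` on `F_vˣ`. If `v ∣ ℓ`, this is
`- Log_ℓ (N_{F_v/ℚ_ℓ} x) / deg v`; if `v ∤ ℓ`, it is `(f_v / f̃_v) · v(x)`. -/
def logVal (v : HeightOneSpectrum (𝓞 F)) : Additive (v.adicCompletion F)ˣ →+ ℚ_[ℓ] :=
  (AddMonoidHom.mulRight (-(placeDeg ℓ v)⁻¹)).comp
    ((iwasawaLogHom ℓ).comp (MonoidHom.toAdditive (padicAbs ℓ v)))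

variable (F) in
/-- The logarithmic valuations `(ṽ_v(x))_v` of an element `x` of `Fˣ`. -/
def logValGlobal : Additive Fˣ →+ (HeightOneSpectrum (𝓞 F) → ℚ_[ℓ]) :=
  AddMonoidHom.pi fun v => (logVal ℓ v).comp
    (MonoidHom.toAdditive (Units.map (algebraMap F (v.adicCompletion F)).toMonoidHom))

variable (F) in
/-- The principal idele subgroup `R_F = ℤ_ℓ ⊗ Fˣ`. -/
abbrev PrincipalIdeles : Type _ := ℤ_[ℓ] ⊗[ℤ] Additive Fˣ

variable (F) in
/-- The `ℤ_ℓ`-linear map on `R_F = ℤ_ℓ ⊗ Fˣ` given by all the logarithmic valuations. -/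
def logDiv : PrincipalIdeles F ℓ →ₗ[ℤ_[ℓ]] (HeightOneSpectrum (𝓞 F) → ℚ_[ℓ]) :=
  LinearMap.liftBaseChange ℤ_[ℓ] (logValGlobal F ℓ).toIntLinearMap

variable (F) in
/-- Logarithmic divisors: the free `ℤ_ℓ`-module on the finite places of `F`. -/
abbrev LogDivisor : Type _ := HeightOneSpectrum (𝓞 F) →₀ ℤ_[ℓ]

variable (F) in
/-- The degree of a logarithmic divisor. -/
def logDivisorDeg : LogDivisor F ℓ →ₗ[ℤ_[ℓ]] ℚ_[ℓ] :=
  Finsupp.linearCombination ℤ_[ℓ] (placeDeg ℓ)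

variable (F) in
/-- Logarithmic divisors of degree zero. -/
abbrev LogDivisorZero : Submodule ℤ_[ℓ] (LogDivisor F ℓ) := LinearMap.ker (logDivisorDeg F ℓ)

variable (F) in
/-- The coefficients of a logarithmic divisor, as elements of `ℚ_ℓ`. -/
def logDivisorCoeffs : LogDivisor F ℓ →ₗ[ℤ_[ℓ]] (HeightOneSpectrum (𝓞 F) → ℚ_[ℓ]) :=
  LinearMap.pi fun v => (Algebra.linearMap ℤ_[ℓ] ℚ_[ℓ]).comp (Finsupp.lapply v)

variable (F) in
/-- Principal logarithmic divisors: the divisors `∑_v ṽ_v(β) v` with `β ∈ R_F`. -/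
def principalLogDivisors : Submodule ℤ_[ℓ] (LogDivisor F ℓ) :=
  (LinearMap.range (logDiv F ℓ)).comap (logDivisorCoeffs F ℓ)

variable (F) in
/-- The group of logarithmic classes: degree zero divisors modulo principal divisors. -/
abbrev LogClassGroup : Type _ := RelQuotient (LogDivisorZero F ℓ) (principalLogDivisors F ℓ)

variable {ℓ} in
/-- The logarithmic class of a degree zero divisor. -/
def logClass : LogDivisorZero F ℓ →ₗ[ℤ_[ℓ]] LogClassGroup F ℓ :=
  relMkQ (LogDivisorZero F ℓ) (principalLogDivisors F ℓ)

variable (F) in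
/-- The places of `F` above `ℓ`. -/
def placesAbove : Set (HeightOneSpectrum (𝓞 F)) := {v | (ℓ : 𝓞 F) ∈ v.asIdeal}

variable (F) in
/-- The subgroup of the logarithmic classes represented by degree zero divisors
`∑_{v ∣ ℓ} a_v v`. -/
def logClassGroupAbove : Submodule ℤ_[ℓ] (LogClassGroup F ℓ) :=
  ((Finsupp.supported ℤ_[ℓ] ℤ_[ℓ] (placesAbove F ℓ)).comap (LogDivisorZero F ℓ).subtype).map
    logClass

variable {ℓ}

theorem norm_degRatio_le {v w : HeightOneSpectrum (𝓞 F)}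
    (h : Padic.addValuation (placeDeg ℓ w) ≤ Padic.addValuation (placeDeg ℓ v)) :
    ‖placeDeg ℓ v / placeDeg ℓ w‖ ≤ 1 := by
  by_cases hv : placeDeg ℓ v = 0
  · simp [hv]
  by_cases hw : placeDeg ℓ w = 0
  · simp [hw]
  rw [Padic.addValuation.apply hv, Padic.addValuation.apply hw, WithTop.coe_le_coe] at h
  rw [norm_div, div_le_one (norm_pos_iff.2 hw), Padic.norm_eq_zpow_neg_valuation hv,
    Padic.norm_eq_zpow_neg_valuation hw]
  exact zpow_le_zpow_right₀ (by exact_mod_cast (Fact.out : ℓ.Prime).one_le) (by omega)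

/-- The ratio `deg v / deg w` as an `ℓ`-adic integer, where `w` has at most the valuation of
degree of `v`. -/
def degRatio {v w : HeightOneSpectrum (𝓞 F)}
    (h : Padic.addValuation (placeDeg ℓ w) ≤ Padic.addValuation (placeDeg ℓ v)) : ℤ_[ℓ] :=
  ⟨placeDeg ℓ v / placeDeg ℓ w, norm_degRatio_le h⟩

/-- The degree zero divisor `v - (deg v / deg w) w`. -/
def degZeroDivisor {v w : HeightOneSpectrum (𝓞 F)}
    (h : Padic.addValuation (placeDeg ℓ w) ≤ Padic.addValuation (placeDeg ℓ v)) :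
    LogDivisorZero F ℓ :=
  ⟨Finsupp.single v 1 - degRatio h • Finsupp.single w 1, by
    have hc : ((degRatio h : ℤ_[ℓ]) : ℚ_[ℓ]) = placeDeg ℓ v / placeDeg ℓ w := rfl
    have hvw : placeDeg ℓ v = placeDeg ℓ v / placeDeg ℓ w * placeDeg ℓ w := by
      by_cases hw : placeDeg ℓ w = 0
      · have : placeDeg ℓ v = 0 := by
          rw [hw, AddValuation.map_zero, top_le_iff, AddValuation.top_iff] at h
          exact h
        simp [this]
      · rw [div_mul_cancel₀ _ hw]
    rw [LinearMap.mem_ker, map_sub, map_smul, logDivisorDeg, Finsupp.linearCombination_single,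
      Finsupp.linearCombination_single, one_smul, one_smul, Algebra.smul_def, sub_eq_zero]
    exact hvw⟩

variable (F ℓ) in
/-- The group of `ℓ`-units of `F`: the `α ∈ Fˣ` with `v(α) = 0` for all finite places `v ∤ ℓ`. -/
abbrev ellUnits : Subgroup Fˣ := (placesAbove F ℓ).unit F

end LogarithmicDivisors

end LogClass

end

/-! The hard point is integrality at the places above `ℓ`; the rest is formal once the degrees are
known to be nonzero. Call a finite extension `L` of `ℚ_ℓ` bounded (`LogNormBounded`) if `Log N(x)`
is divisible by `deg_ℓ ℓ · [L : ℚ_ℓ]` for all `x ≠ 0`. By transitivity of norms, `norm_log_norm_le`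
only needs that `M`, the intersection of `F_v` with the cyclotomic `Ẑ`-extension, is bounded.
Boundedness descends to subextensions and ascends along extensions of degree prime to `ℓ`, and `M`
sits in an extension of degree prime to `ℓ` of a member of an explicit tower
(`exists_bounded_tower`): `ℚ_ℓ(ζ)` for odd `ℓ`, `ℚ_2(ζ + ζ⁻¹)` for `ℓ = 2`, with `ζ` of `ℓ`-power
order. There a generator `π` is a root of an Eisenstein polynomial with constant term `± ℓ`, so its
norm has logarithm zero; scalars are easy, and what remains are the values `f(π)` with `f(0)` a
unit. Their norms are controlled by `prod_primitive_pow_congr` (Frobenius and Newton's identities)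
for odd `ℓ`, and by `iterate_doublingNorm_eval_zero_sq` (iterating the quadratic norm attached to `X
^ 2 - 2`) for `ℓ = 2`. No class field theory is used.

The relations hold because the local norms of an `ℓ`-unit multiply to its global norm
(`norm_eq_prod_localNorm`), which is `±` a power of `ℓ` and is killed by `Log`. So its logarithmic
divisor lives above `ℓ` and has degree zero. As `deg 𝔭₁ ≠ 0`, such a divisor is determined by its
coefficients away from `𝔭₁` (`logDivisorZero_eq_of_eq_succ`), hence is the combination of the `𝔤ᵢ`
with these coefficients. The same remark gives generation.

There are no other relations: away from `ℓ` the logarithmic valuation is a nonzero constant times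
the usual one. If the divisor of `β ∈ ℤ_ℓ ⊗ Fˣ` lives above `ℓ`, flatness of `ℤ_ℓ` over `ℤ` puts `β`
in the image of `ℤ_ℓ ⊗ (ℓ-units)` (`logDiv_mem_span`), and torsion has zero divisor. -/

namespace LogClass

/-! ### Size and kernel of the Iwasawa logarithm -/

section PadicLogarithm

theorem zmod_two_mul_add_one : ∀ y : ZMod 2, y * (y + 1) = 0 := by decide

variable {p : ℕ} [Fact p.Prime]

theorem padic_norm_le_inv_of_lt_one {x : ℚ_[p]} (hx : ‖x‖ < 1) : ‖x‖ ≤ (p : ℝ)⁻¹ := by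
  have := (Padic.norm_le_pow_iff_norm_lt_pow_add_one x (-1)).2 (by simpa using hx)
  simpa using this

theorem exists_one_add_pow_prime_sub_one {y : ℚ_[p]} (hy : ‖y‖ ≤ 1) :
    ∃ k : ℚ_[p], ‖k‖ ≤ 1 ∧ (1 + y) ^ p - 1 = p * y + k * y ^ 2 := by
  obtain ⟨z, rfl⟩ : ∃ z : ℤ_[p], (z : ℚ_[p]) = y := ⟨⟨y, hy⟩, rfl⟩
  obtain ⟨k, hk⟩ := Polynomial.powAddExpansion (1 : ℤ_[p]) z p
  refine ⟨k, k.2, ?_⟩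
  have : (((1 + z) ^ p : ℤ_[p]) : ℚ_[p]) = ((1 + p * z + k * z ^ 2 : ℤ_[p]) : ℚ_[p]) := by
    rw [hk]; simp
  push_cast at this
  rw [this]
  ring

/-- The value group is discrete, so `‖y‖ < 1` forces `‖y‖ ≤ 1 / p`, and the term in `y ^ 2` is no
larger than `p * y`. Under the stronger hypothesis of the next lemma it is strictly smaller, which
gives equality. -/
theorem norm_one_add_pow_prime_sub_one_le {y : ℚ_[p]} (hy : ‖y‖ < 1) :
    ‖(1 + y) ^ p - 1‖ ≤ (p : ℝ)⁻¹ * ‖y‖ := by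
  obtain ⟨k, hk, h⟩ := exists_one_add_pow_prime_sub_one hy.le
  rw [h]
  refine (IsUltrametricDist.norm_add_le_max _ _).trans (max_le ?_ ?_)
  · rw [norm_mul, Padic.norm_p]
  · rw [norm_mul, norm_pow, sq, ← mul_assoc]
    refine mul_le_mul_of_nonneg_right ?_ (norm_nonneg _)
    exact (mul_le_of_le_one_left (norm_nonneg _) hk).trans (padic_norm_le_inv_of_lt_one hy)

theorem norm_one_add_pow_prime_sub_one_eq {y : ℚ_[p]} (hy : ‖y‖ < (p : ℝ)⁻¹) :
    ‖(1 + y) ^ p - 1‖ = (p : ℝ)⁻¹ * ‖y‖ := by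
  rcases eq_or_ne y 0 with rfl | hy0
  · simp
  have h1 : (p : ℝ)⁻¹ < 1 := inv_lt_one_of_one_lt₀ (by exact_mod_cast (Fact.out : p.Prime).one_lt)
  obtain ⟨k, hk, h⟩ := exists_one_add_pow_prime_sub_one (hy.le.trans h1.le)
  have h2 : ‖k * y ^ 2‖ < ‖(p : ℚ_[p]) * y‖ := by
    rw [norm_mul, norm_mul, norm_pow, sq, ← mul_assoc, Padic.norm_p]
    refine mul_lt_mul_of_pos_right ?_ (norm_pos_iff.2 hy0)
    exact (mul_le_of_le_one_left (norm_nonneg _) hk).trans_lt hy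
  rw [h, IsUltrametricDist.norm_add_eq_max_of_norm_ne_norm h2.ne', max_eq_left h2.le, norm_mul,
    Padic.norm_p]

/-- The logarithm is the limit of `((1 + x) ^ p ^ n - 1) / p ^ n`. Each `p`-th power gains a factor
`1 / p`, which the denominator cancels. -/
theorem norm_logOneAdd_le {x : ℚ_[p]} (hx : ‖x‖ < 1) : ‖logOneAdd p x‖ ≤ ‖x‖ := by
  have hp : (0 : ℝ) < p := by exact_mod_cast (Fact.out : p.Prime).pos
  have h1 : (p : ℝ)⁻¹ ≤ 1 := inv_le_one_of_one_le₀ (by exact_mod_cast (Fact.out : p.Prime).one_le)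
  have key : ∀ n : ℕ, ‖(1 + x) ^ p ^ n - 1‖ ≤ ((p : ℝ)⁻¹) ^ n * ‖x‖ := by
    intro n
    induction n with
    | zero => simp
    | succ n ih =>
      have h2 : ‖(1 + x) ^ p ^ n - 1‖ < 1 :=
        (ih.trans (mul_le_of_le_one_left (norm_nonneg _) (pow_le_one₀ (by positivity) h1))).trans_lt
          hx
      have := norm_one_add_pow_prime_sub_one_le h2
      rw [add_sub_cancel, ← pow_mul, ← pow_succ] at this
      refine this.trans ?_
      rw [pow_succ', mul_assoc]
      exact mul_le_mul_of_nonneg_left ih (by positivity)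
  refine le_of_tendsto (logOneAdd_tendsto p hx).norm (Filter.Eventually.of_forall fun n => ?_)
  rw [norm_div, norm_pow, Padic.norm_p, div_le_iff₀ (by positivity), mul_comm]
  exact key n

theorem norm_logOneAdd_eq {x : ℚ_[p]} (hx : ‖x‖ < (p : ℝ)⁻¹) : ‖logOneAdd p x‖ = ‖x‖ := by
  have hp : (0 : ℝ) < p := by exact_mod_cast (Fact.out : p.Prime).pos
  have h1 : (p : ℝ)⁻¹ ≤ 1 := inv_le_one_of_one_le₀ (by exact_mod_cast (Fact.out : p.Prime).one_le)
  have key : ∀ n : ℕ, ‖(1 + x) ^ p ^ n - 1‖ = ((p : ℝ)⁻¹) ^ n * ‖x‖ := by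
    intro n
    induction n with
    | zero => simp
    | succ n ih =>
      have h2 : ‖(1 + x) ^ p ^ n - 1‖ < (p : ℝ)⁻¹ :=
        (ih.le.trans (mul_le_of_le_one_left (norm_nonneg _)
          (pow_le_one₀ (by positivity) h1))).trans_lt hx
      have := norm_one_add_pow_prime_sub_one_eq h2
      rw [add_sub_cancel, ← pow_mul, ← pow_succ] at this
      rw [this, pow_succ', mul_assoc, ih]
  refine tendsto_nhds_unique (logOneAdd_tendsto p (hx.trans_le h1)).norm ?_
  refine tendsto_const_nhds.congr fun n => ?_
  rw [norm_div, norm_pow, Padic.norm_p, key]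
  field_simp

variable (p) in
/-- The constant `deg_p p`: `p` for odd `p` and `4` for `p = 2`. -/
noncomputable def degSelf : ℚ_[p] := if p = 2 then 4 else p

theorem iwasawaLog_one : iwasawaLog p 1 = 0 := by
  simpa using iwasawaLog_mul p (a := 1) (b := 1) one_ne_zero one_ne_zero

theorem iwasawaLog_pow {a : ℚ_[p]} (ha : a ≠ 0) (n : ℕ) :
    iwasawaLog p (a ^ n) = n * iwasawaLog p a := by
  induction n with
  | zero => simp [iwasawaLog_one]
  | succ n ih => rw [pow_succ, iwasawaLog_mul p (pow_ne_zero _ ha) ha, ih]; push_cast; ring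

theorem iwasawaLog_neg {a : ℚ_[p]} (ha : a ≠ 0) : iwasawaLog p (-a) = iwasawaLog p a := by
  have h1 := iwasawaLog_pow (neg_ne_zero.2 ha) 2
  rw [neg_sq, iwasawaLog_pow ha] at h1
  exact (mul_left_cancel₀ (by norm_num) h1).symm

theorem valuation_eq_zero_of_norm_eq_one {a : ℚ_[p]} (ha : ‖a‖ = 1) : a.valuation = 0 := by
  have h0 : a ≠ 0 := norm_pos_iff.1 (ha ▸ one_pos)
  rw [Padic.norm_eq_zpow_neg_valuation h0] at ha
  have h1 : (1 : ℝ) < p := by exact_mod_cast (Fact.out : p.Prime).one_lt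
  have := (zpow_eq_one_iff_right₀ (by positivity) h1.ne').1 ha
  omega

theorem unitPart_of_norm_eq_one {a : ℚ_[p]} (ha : ‖a‖ = 1) : unitPart p a = a := by
  simp [unitPart, valuation_eq_zero_of_norm_eq_one ha]

theorem iwasawaLog_self : iwasawaLog p (p : ℚ_[p]) = 0 := by
  have hp0 : (p : ℚ_[p]) ≠ 0 := by exact_mod_cast (Fact.out : p.Prime).ne_zero
  have : unitPart p (p : ℚ_[p]) = 1 := by simp [unitPart, hp0]
  have h1 : unitPart p (1 : ℚ_[p]) = 1 := unitPart_of_norm_eq_one (by simp)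
  rw [← iwasawaLog_one, iwasawaLog, iwasawaLog, this, h1]

theorem norm_prime_sub_one : ‖((p : ℚ_[p]) - 1)‖ = 1 := by
  have := Padic.norm_natCast_p_sub_one (p := p)
  rwa [Nat.cast_sub (Fact.out : p.Prime).one_le, Nat.cast_one] at this

theorem iwasawaLog_eq_logOneAdd {a : ℚ_[p]} (ha : ‖a - 1‖ < 1) :
    iwasawaLog p a = logOneAdd p (a - 1) := by
  have h1 : ‖a‖ = 1 := by
    have := IsUltrametricDist.norm_add_eq_max_of_norm_ne_norm (x := a - 1) (y := 1)
      (by simp [ha.ne])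
    simpa [ha.le] using this
  have key : ∀ n : ℕ, ‖a ^ n - 1‖ < 1 ∧ logOneAdd p (a ^ n - 1) = n * logOneAdd p (a - 1) := by
    intro n
    induction n with
    | zero => simp [logOneAdd]
    | succ n ih =>
      constructor
      · have : a ^ (n + 1) - 1 = a * (a ^ n - 1) + (a - 1) := by ring
        rw [this]
        refine (IsUltrametricDist.norm_add_le_max _ _).trans_lt (max_lt ?_ ha)
        rw [norm_mul, h1, one_mul]
        exact ih.1
      · rw [pow_succ, logOneAdd_mul p ih.1 ha, ih.2]; push_cast; ring
  rw [iwasawaLog, unitPart_of_norm_eq_one h1, (key _).2,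
    Nat.cast_sub (Fact.out : p.Prime).one_le, Nat.cast_one, mul_div_cancel_left₀]
  exact norm_pos_iff.1 (by rw [norm_prime_sub_one]; exact one_pos)

theorem norm_iwasawaLog_le_of_norm_sub_one_lt {a : ℚ_[p]} (ha : ‖a - 1‖ < 1) :
    ‖iwasawaLog p a‖ ≤ ‖a - 1‖ := by
  rw [iwasawaLog_eq_logOneAdd ha]
  exact norm_logOneAdd_le ha

theorem iwasawaLog_unitPart {a : ℚ_[p]} (ha : a ≠ 0) :
    iwasawaLog p (unitPart p a) = iwasawaLog p a := by
  rw [iwasawaLog, iwasawaLog, unitPart_of_norm_eq_one (norm_unitPart p ha)]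

/-- For odd `p` this is `u ^ (p - 1) ≡ 1` modulo `p` for the unit part `u`. For `p = 2` the square
of an odd unit is `1` modulo `8`, and halving `Log (u ^ 2)` leaves a factor `4`. -/
theorem norm_iwasawaLog_le {a : ℚ_[p]} (ha : a ≠ 0) : ‖iwasawaLog p a‖ ≤ ‖degSelf p‖ := by
  unfold degSelf
  split_ifs with h2
  · subst h2
    set u := unitPart 2 a with hu
    have hu1 : ‖u‖ = 1 := norm_unitPart 2 ha
    have hu0 : u ≠ 0 := norm_pos_iff.1 (hu1 ▸ one_pos)
    have hlt : ‖u - 1‖ < 1 := by simpa using norm_unit_pow_sub_one 2 hu1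
    have hle : ‖u - 1‖ ≤ ‖(2 : ℚ_[2])‖ := by
      have := padic_norm_le_inv_of_lt_one hlt
      rwa [← Padic.norm_p] at this
    obtain ⟨w, hw⟩ : ∃ w, u - 1 = 2 * w := ⟨(u - 1) / 2, by ring⟩
    have hw1 : ‖w‖ ≤ 1 := by
      rw [hw, norm_mul] at hle
      exact le_of_mul_le_mul_left (by simpa using hle) (norm_pos_iff.2 (by norm_num : (2 : ℚ_[2]) ≠ 0))
    have hww : ‖w * (w + 1)‖ ≤ ‖(2 : ℚ_[2])‖ := by
      obtain ⟨z, rfl⟩ : ∃ z : ℤ_[2], (z : ℚ_[2]) = w := ⟨⟨w, hw1⟩, rfl⟩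
      have h : PadicInt.toZMod (z * (z + 1)) = 0 := by
        rw [map_mul, map_add, map_one]
        exact zmod_two_mul_add_one _
      rw [← RingHom.mem_ker, PadicInt.ker_toZMod, IsLocalRing.mem_maximalIdeal,
        PadicInt.mem_nonunits, PadicInt.norm_def] at h
      have := padic_norm_le_inv_of_lt_one h
      rw [← Padic.norm_p] at this
      exact_mod_cast this
    have hsq : u ^ 2 - 1 = 4 * (w * (w + 1)) := by
      have : u = 1 + 2 * w := by rw [← hw]; ring
      rw [this]; ring
    have h4 : ‖(4 : ℚ_[2])‖ = ‖(2 : ℚ_[2])‖ * ‖(2 : ℚ_[2])‖ := by rw [← norm_mul]; norm_num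
    have h2' : ‖(2 : ℚ_[2])‖ < 1 := by simpa using Padic.norm_p_lt_one (p := 2)
    have h20 : 0 < ‖(2 : ℚ_[2])‖ := norm_pos_iff.2 (by norm_num)
    have hb : ‖u ^ 2 - 1‖ ≤ ‖(4 : ℚ_[2])‖ * ‖(2 : ℚ_[2])‖ := by
      rw [hsq, norm_mul]; exact mul_le_mul_of_nonneg_left hww (norm_nonneg _)
    have hl := norm_iwasawaLog_le_of_norm_sub_one_lt (p := 2) (a := u ^ 2) (hb.trans_lt (by
      rw [h4]; nlinarith))
    rw [iwasawaLog_pow hu0, norm_mul, hu, iwasawaLog_unitPart ha] at hl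
    refine le_of_mul_le_mul_left ?_ h20
    calc _ ≤ _ := by simpa using hl
      _ ≤ _ := hb
      _ = _ := mul_comm _ _
  · have h := norm_unit_pow_sub_one p (norm_unitPart p ha)
    rw [iwasawaLog, norm_div, norm_prime_sub_one, div_one, Padic.norm_p]
    exact (norm_logOneAdd_le h).trans (padic_norm_le_inv_of_lt_one h)

/-- Raising to the power `p` moves `a` into the region where the logarithm preserves the norm and so
has no kernel. -/
theorem pow_eq_one_of_logOneAdd_eq_zero {a : ℚ_[p]} (ha : ‖a - 1‖ < 1)
    (h : logOneAdd p (a - 1) = 0) : a ^ p = 1 := by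
  have hp : (0 : ℝ) < p := by exact_mod_cast (Fact.out : p.Prime).pos
  have ha0 : a ≠ 0 := by rintro rfl; simp at ha
  have h1 : ‖a ^ p - 1‖ < (p : ℝ)⁻¹ := by
    have := norm_one_add_pow_prime_sub_one_le ha
    rw [add_sub_cancel] at this
    exact this.trans_lt (mul_lt_of_lt_one_right (by positivity) ha)
  have h2 : ‖a ^ p - 1‖ < 1 := h1.trans (inv_lt_one_of_one_lt₀ (by
    exact_mod_cast (Fact.out : p.Prime).one_lt))
  have h3 := norm_logOneAdd_eq h1
  rw [← iwasawaLog_eq_logOneAdd h2, iwasawaLog_pow ha0, iwasawaLog_eq_logOneAdd ha, h, mul_zero,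
    norm_zero] at h3
  exact sub_eq_zero.1 (norm_eq_zero.1 h3.symm)

theorem iwasawaLog_natCast_ne_zero {n : ℕ} (hn : 1 < n) (hnp : ¬ p ∣ n) :
    iwasawaLog p (n : ℚ_[p]) ≠ 0 := by
  intro h
  have hn1 : ‖(n : ℚ_[p])‖ = 1 := Padic.norm_natCast_eq_one_iff.2
    ((Fact.out : p.Prime).coprime_iff_not_dvd.2 hnp)
  have hp1 : ((p : ℚ_[p]) - 1) ≠ 0 := norm_pos_iff.1 (by rw [norm_prime_sub_one]; exact one_pos)
  rw [iwasawaLog, unitPart_of_norm_eq_one hn1, div_eq_zero_iff, or_iff_left hp1] at h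
  have h2 := pow_eq_one_of_logOneAdd_eq_zero (norm_unit_pow_sub_one p hn1) h
  rw [← pow_mul] at h2
  have h3 : n ^ ((p - 1) * p) = 1 := by exact_mod_cast h2
  have hp2 := (Fact.out : p.Prime).two_le
  exact (Nat.one_lt_pow (Nat.mul_ne_zero (by omega) (by omega)) hn).ne' h3

end PadicLogarithm

end LogClass

namespace LogClass

/-! ### From divisible power sums to a congruence for a product -/

section NewtonCongruence

theorem prod_one_add_mul_eq_sum_esymm {Ω : Type*} [Field Ω] {ι : Type*} [Fintype ι] (c : Ω) (y : ι → Ω) :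
    ∏ i, (1 + c * y i) = ∑ k ∈ Finset.range (Fintype.card ι + 1),
      c ^ k * MvPolynomial.aeval y (MvPolynomial.esymm ι ℤ k) := by
  classical
  rw [Finset.prod_one_add, Finset.sum_powerset, Finset.card_univ]
  refine Finset.sum_congr rfl fun k _ => ?_
  rw [MvPolynomial.esymm, map_sum, Finset.mul_sum]
  refine Finset.sum_congr rfl fun t ht => ?_
  rw [Finset.prod_mul_distrib, Finset.prod_const, (Finset.mem_powersetCard.1 ht).2]
  simp

variable {Ω : Type*} [Field Ω] [CharZero Ω] {ℓ : ℕ} [Fact ℓ.Prime]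

/-- The exponent of `ℓ` in `k` is at most `k - 1`. -/
theorem prime_pow_div_mem (O : Subring Ω) (hO : ∀ k : ℕ, ¬ ℓ ∣ k → ((k : Ω)⁻¹ ∈ O))
    {k : ℕ} (hk : k ≠ 0) : ((ℓ : Ω) ^ (k - 1) / k) ∈ O := by
  have hℓ := (Fact.out : ℓ.Prime)
  obtain ⟨a, k', hk', rfl⟩ := Nat.exists_eq_pow_mul_and_not_dvd hk ℓ hℓ.ne_one
  have hk'0 : k' ≠ 0 := by rintro rfl; simp at hk'
  have ha : a ≤ ℓ ^ a * k' - 1 := by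
    have h1 : a < ℓ ^ a := Nat.lt_pow_self hℓ.one_lt
    have h2 : ℓ ^ a * 1 ≤ ℓ ^ a * k' := Nat.mul_le_mul_left _ (Nat.pos_of_ne_zero hk'0)
    omega
  obtain ⟨b, hb⟩ := Nat.exists_eq_add_of_le ha
  have hℓ0 : (ℓ : Ω) ≠ 0 := by exact_mod_cast hℓ.ne_zero
  have hk'0' : (k' : Ω) ≠ 0 := by exact_mod_cast hk'0
  have : (ℓ : Ω) ^ (ℓ ^ a * k' - 1) / ((ℓ ^ a * k' : ℕ) : Ω) = (ℓ : Ω) ^ b * (k' : Ω)⁻¹ := by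
    rw [hb, pow_add]; push_cast; field_simp
  rw [this]
  exact O.mul_mem (O.pow_mem (natCast_mem O ℓ) _) (hO k' hk')

/-- If all power sums of the `y i` are divisible by `ℓ ^ m`, then `∏ (1 + ℓ y i)` is congruent to
`1` modulo `ℓ ^ (m + 1)`. -/
theorem prod_one_add_mul_congr (O : Subring Ω) (hO : ∀ k : ℕ, ¬ ℓ ∣ k → ((k : Ω)⁻¹ ∈ O))
    {ι : Type*} [Fintype ι] (y : ι → Ω) (hy : ∀ i, y i ∈ O) (m : ℕ)
    (hp : ∀ j : ℕ, ∃ z ∈ O, ∑ i, y i ^ j = (ℓ : Ω) ^ m * z) :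
    ∃ z ∈ O, ∏ i, (1 + ℓ * y i) = 1 + (ℓ : Ω) ^ (m + 1) * z := by
  have hℓ0 : (ℓ : Ω) ≠ 0 := by exact_mod_cast (Fact.out : ℓ.Prime).ne_zero
  have hint : ∀ k, MvPolynomial.aeval y (MvPolynomial.esymm ι ℤ k) ∈ O := by
    intro k
    rw [MvPolynomial.esymm, map_sum]
    refine O.sum_mem fun t _ => ?_
    rw [map_prod]
    refine O.prod_mem fun i _ => ?_
    simpa using hy i
  -- Newton's identity writes `k e_k` as a signed sum of terms `e_i p_{k-i}` with `i < k`, each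
  -- divisible by `ℓ ^ m` through its power sum.
  have hnewton : ∀ k : ℕ, ∃ z ∈ O,
      (k : Ω) * MvPolynomial.aeval y (MvPolynomial.esymm ι ℤ k) = (ℓ : Ω) ^ m * z := by
    intro k
    have h := congrArg (MvPolynomial.aeval y) (MvPolynomial.mul_esymm_eq_sum ι ℤ k)
    rw [map_mul, map_natCast] at h
    choose z hz hz' using hp
    refine ⟨(-1) ^ (k + 1) * ∑ a ∈ Finset.HasAntidiagonal.antidiagonal k with a.1 < k,
      (-1) ^ a.1 * MvPolynomial.aeval y (MvPolynomial.esymm ι ℤ a.1) * z a.2, ?_, ?_⟩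
    · refine O.mul_mem (O.pow_mem (O.neg_mem O.one_mem) _) (O.sum_mem fun a _ => ?_)
      exact O.mul_mem (O.mul_mem (O.pow_mem (O.neg_mem O.one_mem) _) (hint _)) (hz _)
    · rw [h, map_mul, map_pow, map_neg, map_one, map_sum, mul_left_comm ((ℓ : Ω) ^ m),
        Finset.mul_sum _ _ ((ℓ : Ω) ^ m)]
      congr 1
      refine Finset.sum_congr rfl fun a _ => ?_
      rw [map_mul, map_mul, map_pow, map_neg, map_one, MvPolynomial.psum, map_sum]
      simp only [map_pow, MvPolynomial.aeval_X]
      rw [hz']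
      ring
  choose z hz hz' using hnewton
  -- The term `ℓ ^ k e_k` of the expanded product is `ℓ · (ℓ ^ (k - 1) / k) · (k e_k)`: the first
  -- factor gives the extra `ℓ`, the second is integral, the third is divisible by `ℓ ^ m`.
  refine ⟨∑ k ∈ Finset.range (Fintype.card ι),
    ((ℓ : Ω) ^ (k + 1 - 1) / ((k + 1 : ℕ) : Ω)) * z (k + 1),
    sum_mem fun k _ => O.mul_mem (prime_pow_div_mem O hO (Nat.succ_ne_zero k)) (hz _), ?_⟩
  rw [prod_one_add_mul_eq_sum_esymm, Finset.sum_range_succ', add_comm]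
  congr 1
  · simp
  · rw [Finset.mul_sum]
    refine Finset.sum_congr rfl fun k _ => ?_
    have hk : ((k + 1 : ℕ) : Ω) ≠ 0 := by exact_mod_cast Nat.succ_ne_zero k
    have := hz' (k + 1)
    rw [Nat.add_sub_cancel, div_mul_eq_mul_div, mul_div_assoc', eq_div_iff hk]
    linear_combination (ℓ : Ω) ^ (k + 1) * this

end NewtonCongruence

/-! ### Norms of units from `ℓ`-power cyclotomic fields -/

section CyclotomicCongruence

open Polynomial

variable {ℓ : ℕ} [Fact ℓ.Prime]

/-- Frobenius fixes the coefficients modulo `ℓ`, so `f ^ ℓ` reduces to `f(X ^ ℓ)`. -/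
theorem exists_pow_eq_expand_add (f : ℤ_[ℓ][X]) :
    ∃ g : ℤ_[ℓ][X], f ^ ℓ = expand ℤ_[ℓ] ℓ f + C (ℓ : ℤ_[ℓ]) * g := by
  have h : (f ^ ℓ - expand ℤ_[ℓ] ℓ f).map PadicInt.toZMod = 0 := by
    rw [Polynomial.map_sub, Polynomial.map_pow, Polynomial.map_expand, ZMod.expand_card, sub_self]
  have h2 : C (ℓ : ℤ_[ℓ]) ∣ f ^ ℓ - expand ℤ_[ℓ] ℓ f := by
    rw [C_dvd_iff_dvd_coeff]
    intro i
    have h3 : PadicInt.toZMod ((f ^ ℓ - expand ℤ_[ℓ] ℓ f).coeff i) = 0 := by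
      rw [← coeff_map, h, coeff_zero]
    rwa [← RingHom.mem_ker, PadicInt.ker_toZMod, PadicInt.maximalIdeal_eq_span_p,
      Ideal.mem_span_singleton] at h3
  obtain ⟨g, hg⟩ := h2
  exact ⟨g, by rw [← hg]; ring⟩

theorem exists_pow_prime_pow_eq_expand_add (f : ℤ_[ℓ][X]) (m : ℕ) :
    ∃ g : ℤ_[ℓ][X], f ^ ℓ ^ m = expand ℤ_[ℓ] (ℓ ^ m) f + C (ℓ : ℤ_[ℓ]) * g := by
  induction m with
  | zero => exact ⟨0, by simp⟩
  | succ m ih =>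
    obtain ⟨g, hg⟩ := ih
    obtain ⟨g', hg'⟩ := exists_pow_eq_expand_add (expand ℤ_[ℓ] (ℓ ^ m) f)
    obtain ⟨q, hq⟩ := sub_dvd_pow_sub_pow (f ^ ℓ ^ m) (expand ℤ_[ℓ] (ℓ ^ m) f) ℓ
    refine ⟨g' + g * q, ?_⟩
    rw [← expand_mul, mul_comm ℓ, ← pow_succ] at hg'
    rw [pow_succ, pow_mul, ← sub_add_cancel ((f ^ ℓ ^ m) ^ ℓ) ((expand ℤ_[ℓ] (ℓ ^ m) f) ^ ℓ), hq,
      hg', hg, pow_succ]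
    ring

/-- Modulo `X ^ ℓ ^ m - 1` the power `f ^ ℓ ^ m` is congruent modulo `ℓ` to the unit `f(1)`. Hence
`f` generates the quotient ring modulo `ℓ`, and by Nakayama it generates it. -/
theorem exists_inverse_mod_X_pow_sub_one (f : ℤ_[ℓ][X]) (hf : IsUnit (f.eval 1)) (m : ℕ) :
    ∃ F : ℤ_[ℓ][X], X ^ ℓ ^ m - 1 ∣ f * F - 1 := by
  have hmon : (X ^ ℓ ^ m - 1 : ℤ_[ℓ][X]).Monic :=
    monic_X_pow_sub_C 1 (pow_ne_zero _ (Fact.out : ℓ.Prime).ne_zero)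
  have hfin := hmon.finite_adjoinRoot
  set q : ℤ_[ℓ][X] := X ^ ℓ ^ m - 1 with hqdef
  obtain ⟨g, hg⟩ := exists_pow_prime_pow_eq_expand_add f m
  obtain ⟨u, hu⟩ := hf
  have hexp : AdjoinRoot.mk q (expand ℤ_[ℓ] (ℓ ^ m) f) = AdjoinRoot.mk q (C (f.eval 1)) := by
    rw [← AdjoinRoot.aeval_eq, expand_aeval]
    have h1 : AdjoinRoot.root q ^ ℓ ^ m = 1 := by
      have := AdjoinRoot.eval₂_root q
      rw [hqdef, eval₂_sub, eval₂_X_pow, eval₂_one] at this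
      exact sub_eq_zero.1 this
    rw [h1, ← map_one (algebraMap ℤ_[ℓ] (AdjoinRoot q)), aeval_algebraMap_apply]
    rfl
  have key : (⊤ : Submodule ℤ_[ℓ] (AdjoinRoot q)) ≤
      (Ideal.span {AdjoinRoot.mk q f}).restrictScalars ℤ_[ℓ] := by
    refine Submodule.le_of_le_smul_of_le_jacobson_bot (I := IsLocalRing.maximalIdeal ℤ_[ℓ])
      (Module.finite_def.1 hfin) (IsLocalRing.maximalIdeal_le_jacobson _) ?_
    intro x _
    have h1 : x = (AdjoinRoot.mk q (f ^ ℓ ^ m) * (AdjoinRoot.mk q (C ((u⁻¹ : ℤ_[ℓ]ˣ) : ℤ_[ℓ])) * x)) +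
        (ℓ : ℤ_[ℓ]) • (-(AdjoinRoot.mk q g * (AdjoinRoot.mk q (C ((u⁻¹ : ℤ_[ℓ]ˣ) : ℤ_[ℓ])) * x))) := by
      have h2 : AdjoinRoot.mk q (C (u : ℤ_[ℓ])) * AdjoinRoot.mk q (C ((u⁻¹ : ℤ_[ℓ]ˣ) : ℤ_[ℓ])) = 1 := by
        rw [← map_mul, ← C_mul, Units.mul_inv, C_1, map_one]
      rw [hg, map_add, hexp, ← hu, map_mul, Algebra.smul_def]
      have h3 : algebraMap ℤ_[ℓ] (AdjoinRoot q) (ℓ : ℤ_[ℓ]) = AdjoinRoot.mk q (C (ℓ : ℤ_[ℓ])) := rfl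
      rw [h3]
      linear_combination -x * h2
    rw [h1]
    refine Submodule.add_mem_sup ?_ (Submodule.smul_mem_smul ?_ trivial)
    · rw [Submodule.restrictScalars_mem, map_pow]
      refine Ideal.mul_mem_right _ _ ?_
      exact Ideal.pow_mem_of_mem _ (Ideal.mem_span_singleton_self _) _
        (pow_pos (Fact.out : ℓ.Prime).pos _)
    · rw [PadicInt.maximalIdeal_eq_span_p]
      exact Ideal.mem_span_singleton_self _
  have h1 : (1 : AdjoinRoot q) ∈ Ideal.span {AdjoinRoot.mk q f} := key trivial
  obtain ⟨b, hb⟩ := Ideal.mem_span_singleton'.1 h1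
  obtain ⟨F, rfl⟩ := AdjoinRoot.mk_surjective b
  refine ⟨F, ?_⟩
  rw [← AdjoinRoot.mk_eq_mk, map_mul, mul_comm, hb, map_one]

variable {Ω : Type*} [Field Ω] [Algebra ℤ_[ℓ] Ω]

/-- Summing a monomial `X ^ n` over all `N`-th roots of unity gives `N` or `0`. This supplies the
divisible power sums needed by `prod_one_add_mul_congr`. -/
theorem sum_aeval_pow_eq {N : ℕ} {ζ : Ω} (hζ : IsPrimitiveRoot ζ N) (f : ℤ_[ℓ][X]) :
    ∃ c : ℤ_[ℓ], ∑ i ∈ Finset.range N, aeval (ζ ^ i) f = N * algebraMap ℤ_[ℓ] Ω c := by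
  induction f using Polynomial.induction_on' with
  | add f g hf hg =>
    obtain ⟨c, hc⟩ := hf
    obtain ⟨d, hd⟩ := hg
    exact ⟨c + d, by simp only [map_add, Finset.sum_add_distrib, hc, hd]; ring⟩
  | monomial n a =>
    by_cases h : ζ ^ n = 1
    · refine ⟨a, ?_⟩
      simp [aeval_monomial, pow_right_comm, h]
    · refine ⟨0, ?_⟩
      simp only [aeval_monomial, ← Finset.mul_sum, pow_right_comm _ _ n, map_zero, mul_zero]
      have h1 := mul_neg_geom_sum (ζ ^ n) N
      rw [pow_right_comm, hζ.pow_eq_one, one_pow, sub_self] at h1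
      rw [(mul_eq_zero.1 h1).resolve_left (sub_ne_zero.2 (Ne.symm h)), mul_zero]

theorem prod_range_mul_periodic {M : Type*} [CommMonoid M] (G : ℕ → M) (n : ℕ)
    (hG : ∀ i, G (i + n) = G i) (k : ℕ) :
    ∏ i ∈ Finset.range (k * n), G i = (∏ i ∈ Finset.range n, G i) ^ k := by
  have hG' : ∀ k i, G (k * n + i) = G i := by
    intro k
    induction k with
    | zero => simp
    | succ k ih => intro i; rw [← ih i, ← hG (k * n + i)]; congr 1; ring
  induction k with
  | zero => simp
  | succ k ih =>
    rw [Nat.succ_mul, Finset.prod_range_add, ih, pow_succ]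
    simp only [hG']

theorem prod_range_prime_pow {M : Type*} [CommMonoid M] (G : ℕ → M) (m : ℕ) :
    ∏ i ∈ Finset.range (ℓ ^ (m + 1)), G i =
      (∏ i ∈ Finset.range (ℓ ^ (m + 1)) with i.Coprime (ℓ ^ (m + 1)), G i) *
        ∏ i ∈ Finset.range (ℓ ^ m), G (ℓ * i) := by
  have hℓ := (Fact.out : ℓ.Prime)
  rw [← Finset.prod_filter_mul_prod_filter_not _ (fun i => i.Coprime (ℓ ^ (m + 1)))]
  congr 1
  symm
  refine Finset.prod_nbij (fun i => ℓ * i) ?_ ?_ ?_ fun _ _ => rfl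
  · intro i hi
    rw [Finset.mem_filter, Finset.mem_range, Nat.coprime_pow_right_iff (Nat.succ_pos m),
      Nat.coprime_comm, hℓ.coprime_iff_not_dvd, not_not, pow_succ']
    exact ⟨Nat.mul_lt_mul_of_pos_left (Finset.mem_range.1 hi) hℓ.pos, dvd_mul_right _ _⟩
  · intro i _ j _ h
    exact Nat.eq_of_mul_eq_mul_left hℓ.pos h
  · intro i hi
    rw [Finset.mem_coe, Finset.mem_filter, Finset.mem_range, Nat.coprime_pow_right_iff (Nat.succ_pos m),
      Nat.coprime_comm, hℓ.coprime_iff_not_dvd, not_not, pow_succ'] at hi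
    obtain ⟨hi, j, rfl⟩ := hi
    exact ⟨j, by simpa using Nat.lt_of_mul_lt_mul_left hi, rfl⟩

/-- The product of the conjugates of a unit of `ℤ_ℓ[ζ]`, for `ζ` of order `ℓ ^ m`, has an `ℓ`-th
power congruent to `1` modulo `ℓ ^ (m + 1)`. -/
theorem prod_primitive_pow_congr [CharZero Ω] (m : ℕ) {ζ : Ω} (hζ : IsPrimitiveRoot ζ (ℓ ^ (m + 1)))
    (f : ℤ_[ℓ][X]) (hf : IsUnit (f.eval 1)) :
    ∃ z : Ω, IsIntegral ℤ_[ℓ] z ∧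
      (∏ i ∈ Finset.range (ℓ ^ (m + 1)) with i.Coprime (ℓ ^ (m + 1)), aeval (ζ ^ i) f) ^ ℓ =
        1 + (ℓ : Ω) ^ (m + 2) * z := by
  have hℓ := (Fact.out : ℓ.Prime)
  have hN0 : ℓ ^ (m + 1) ≠ 0 := pow_ne_zero _ hℓ.ne_zero
  obtain ⟨F, Q, hF⟩ := exists_inverse_mod_X_pow_sub_one f hf (m + 1)
  obtain ⟨g, hg⟩ := exists_pow_eq_expand_add f
  -- Chosen so that `f(x) ^ ℓ = f(x ^ ℓ) (1 + ℓ h(x))` at every `ℓ ^ (m + 1)`-th root of unity `x`,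
  -- with `F` inverting `f` there.
  set h : ℤ_[ℓ][X] := g * expand ℤ_[ℓ] ℓ F with hh
  have hroot : ∀ i, (ζ ^ i) ^ ℓ ^ (m + 1) = 1 := fun i => by
    rw [pow_right_comm, hζ.pow_eq_one, one_pow]
  have hinv : ∀ i, aeval (ζ ^ i) f * aeval (ζ ^ i) F = 1 := by
    intro i
    have := congrArg (aeval (ζ ^ i)) hF
    rw [map_sub, map_mul, map_mul, map_sub, map_pow, aeval_X, hroot, map_one, sub_self,
      zero_mul] at this
    exact sub_eq_zero.1 this
  have hne : ∀ i, aeval (ζ ^ i) f ≠ 0 := fun i h0 => by simpa [h0] using hinv i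
  have hval : ∀ i, aeval (ζ ^ i) f ^ ℓ = aeval (ζ ^ (ℓ * i)) f * (1 + ℓ * aeval (ζ ^ i) h) := by
    intro i
    have h1 := congrArg (aeval (ζ ^ i)) hg
    have h2 := hinv (ℓ * i)
    rw [map_pow, map_add, map_mul, expand_aeval, aeval_C, map_natCast, ← pow_mul, mul_comm i] at h1
    rw [hh, map_mul, expand_aeval, ← pow_mul, mul_comm i, h1]
    linear_combination -(ℓ * aeval (ζ ^ i) g) * h2
  set P := ∏ i ∈ Finset.range (ℓ ^ (m + 1)) with i.Coprime (ℓ ^ (m + 1)), aeval (ζ ^ i) f with hP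
  set R := ∏ i ∈ Finset.range (ℓ ^ m), aeval (ζ ^ (ℓ * i)) f with hR
  have hR0 : R ≠ 0 := Finset.prod_ne_zero_iff.2 fun i _ => hne _
  -- Multiply over all `i`. The left side is `(P R) ^ ℓ`, where `R` collects the non-primitive
  -- roots; on the right `f(ζ ^ (ℓ i))` runs `ℓ` times through the factors of `R`, so `R ^ ℓ`
  -- cancels.
  have hprod : P ^ ℓ = ∏ i ∈ Finset.range (ℓ ^ (m + 1)), (1 + ℓ * aeval (ζ ^ i) h) := by
    have h1 : (P * R) ^ ℓ = R ^ ℓ * ∏ i ∈ Finset.range (ℓ ^ (m + 1)), (1 + ℓ * aeval (ζ ^ i) h) := by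
      rw [hP, hR, ← prod_range_prime_pow (fun i => aeval (ζ ^ i) f) m, ← Finset.prod_pow,
        ← prod_range_mul_periodic (fun i => aeval (ζ ^ (ℓ * i)) f), ← pow_succ',
        ← Finset.prod_mul_distrib]
      · exact Finset.prod_congr rfl fun i _ => hval i
      · intro i
        rw [mul_add, pow_add, ← pow_succ', hζ.pow_eq_one, mul_one]
    rw [mul_pow, mul_comm] at h1
    exact mul_left_cancel₀ (pow_ne_zero _ hR0) h1
  have hinteg : ∀ i : ℕ, ∀ f : ℤ_[ℓ][X], aeval (ζ ^ i) f ∈ (integralClosure ℤ_[ℓ] Ω).toSubring := by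
    intro i f
    have h1 : IsIntegral ℤ_[ℓ] (ζ ^ i) := IsIntegral.of_pow (Nat.pos_of_ne_zero hN0)
      (by rw [hroot]; exact isIntegral_one)
    rw [aeval_eq_sum_range]
    exact (integralClosure ℤ_[ℓ] Ω).sum_mem fun n _ =>
      (integralClosure ℤ_[ℓ] Ω).smul_mem ((integralClosure ℤ_[ℓ] Ω).pow_mem h1 n) _
  obtain ⟨z, hz, hz'⟩ := prod_one_add_mul_congr (ℓ := ℓ) (integralClosure ℤ_[ℓ] Ω).toSubring
    (fun k hk => by
      have hu : IsUnit (k : ℤ_[ℓ]) := by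
        rw [PadicInt.isUnit_iff, PadicInt.norm_natCast_eq_one_iff]
        exact hℓ.coprime_iff_not_dvd.2 hk
      obtain ⟨u, hu⟩ := hu
      have h1 : (k : Ω)⁻¹ = algebraMap ℤ_[ℓ] Ω ((u⁻¹ : ℤ_[ℓ]ˣ) : ℤ_[ℓ]) := by
        refine inv_eq_of_mul_eq_one_right ?_
        rw [← map_natCast (algebraMap ℤ_[ℓ] Ω), ← hu, ← map_mul, Units.mul_inv, map_one]
      rw [h1]
      exact isIntegral_algebraMap)
    -- The product extends over all roots, not only the primitive ones, so the power sums are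
    -- divisible by the full `ℓ ^ (m + 1)`.
    (fun i : Fin (ℓ ^ (m + 1)) => aeval (ζ ^ (i : ℕ)) h) (fun i => hinteg i h) (m + 1) (fun j => by
      obtain ⟨c, hc⟩ := sum_aeval_pow_eq hζ (h ^ j)
      refine ⟨algebraMap ℤ_[ℓ] Ω c, isIntegral_algebraMap, ?_⟩
      rw [Finset.sum_range] at hc
      simpa using hc)
  refine ⟨z, hz, ?_⟩
  rw [hprod, Finset.prod_range, hz']

end CyclotomicCongruence

end LogClass

namespace LogClass

/-! ### The quadratic norm attached to `X ^ 2 - 2`, for `ℓ = 2` -/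

section DoublingNorm

open Polynomial

section Ring

variable {R : Type*} [CommRing R]

/-- The polynomial `a` in the decomposition `f = a (X ^ 2 - 2) + X * b (X ^ 2 - 2)`. -/
noncomputable def evenPart (f : R[X]) : R[X] := (contract 2 f).comp (X + C 2)

/-- The polynomial `b` in the decomposition `f = a (X ^ 2 - 2) + X * b (X ^ 2 - 2)`. -/
noncomputable def oddPart (f : R[X]) : R[X] := (contract 2 (divX f)).comp (X + C 2)

theorem evenPart_comp_add (f : R[X]) :
    (evenPart f).comp (X ^ 2 - C 2) + X * (oddPart f).comp (X ^ 2 - C 2) = f := by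
  have h : ∀ g : R[X], (g.comp (X + C 2)).comp (X ^ 2 - C 2) = expand R 2 g := by
    intro g
    rw [comp_assoc, expand_eq_comp_X_pow]
    congr 1
    simp
  rw [evenPart, oddPart, h, h]
  ext n
  rcases Nat.even_or_odd' n with ⟨k, rfl | rfl⟩
  · rw [coeff_add, mul_comm 2 k, coeff_expand_mul two_pos, coeff_contract two_ne_zero]
    rcases k with _ | k
    · simp
    · rw [show (k + 1) * 2 = (2 * k + 1) + 1 by ring, coeff_X_mul, coeff_expand two_pos,
        if_neg (by omega), add_zero]
  · rw [coeff_add, coeff_expand two_pos, if_neg (by omega), zero_add, coeff_X_mul, mul_comm 2 k,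
      coeff_expand_mul two_pos, coeff_contract two_ne_zero, coeff_divX]

theorem evenPart_add_C_mul (f h : R[X]) (c : R) :
    evenPart (f + C c * h) = evenPart f + C c * evenPart h := by
  have : contract 2 (f + C c * h) = contract 2 f + C c * contract 2 h := by
    ext n; simp [coeff_contract two_ne_zero]
  rw [evenPart, this, add_comp, mul_comp, C_comp]; rfl

theorem oddPart_add_C_mul (f h : R[X]) (c : R) :
    oddPart (f + C c * h) = oddPart f + C c * oddPart h := by
  have : contract 2 (divX (f + C c * h)) = contract 2 (divX f) + C c * contract 2 (divX h) := by
    ext n; simp [coeff_contract two_ne_zero]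
  rw [oddPart, this, add_comp, mul_comp, C_comp]; rfl

/-- The norm of `f` from `R[X]` to `R[X ^ 2 - 2]`, as a polynomial in `X ^ 2 - 2`. -/
noncomputable def doublingNorm (f : R[X]) : R[X] :=
  evenPart f ^ 2 - (X + C 2) * oddPart f ^ 2

/-- The bilinear form attached to `doublingNorm`. -/
noncomputable def doublingPolar (f h : R[X]) : R[X] :=
  evenPart f * evenPart h - (X + C 2) * (oddPart f * oddPart h)

theorem doublingNorm_add_C_mul (f h : R[X]) (c : R) :
    doublingNorm (f + C c * h) =
      doublingNorm f + C (2 * c) * doublingPolar f h + C (c ^ 2) * doublingNorm h := by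
  rw [doublingNorm, evenPart_add_C_mul, oddPart_add_C_mul, doublingNorm, doublingNorm,
    doublingPolar, C_mul, C_pow]
  simp only [map_ofNat]
  ring

variable {A : Type*} [CommRing A] [Algebra R A]

theorem aeval_eq_evenPart_add (f : R[X]) (x : A) :
    aeval x f = aeval (x ^ 2 - 2) (evenPart f) + x * aeval (x ^ 2 - 2) (oddPart f) := by
  conv_lhs => rw [← evenPart_comp_add f]
  simp only [map_add, map_mul, aeval_comp, map_sub, map_pow, aeval_X, map_ofNat]

/-- The map `x ↦ x ^ 2 - 2` doubles `ζ + ζ⁻¹`, and its fibres are the pairs `± x`. So iterating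
`doublingNorm` computes norms down the tower of fields `ℚ_2(ζ + ζ⁻¹)`. -/
theorem aeval_doublingNorm (f : R[X]) (x : A) :
    aeval (x ^ 2 - 2) (doublingNorm f) = aeval x f * aeval (-x) f := by
  rw [aeval_eq_evenPart_add f x, aeval_eq_evenPart_add f (-x), doublingNorm]
  simp only [map_sub, map_mul, map_pow, map_add, aeval_X, map_ofNat, neg_sq]
  ring

theorem eval_doublingNorm (f : R[X]) (x : R) :
    (doublingNorm f).eval (x ^ 2 - 2) = f.eval x * f.eval (-x) := by
  simpa [coe_aeval_eq_eval] using aeval_doublingNorm f x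

end Ring

/-- Modulo `2` the polynomial `X ^ 2 - 2` is `X ^ 2`, and composing with it is squaring. Thus `f = a
^ 2 + X b ^ 2` there, which is also the norm form up to a sign. -/
theorem doublingNorm_congr (f : ℤ_[2][X]) : ∃ h, doublingNorm f = f + C 2 * h := by
  have h2 : (C 2 : (ZMod 2)[X]) = 0 := by
    rw [← C_0]; congr 1
  have key : (doublingNorm f - f).map PadicInt.toZMod = 0 := by
    have hc : ∀ g : ℤ_[2][X], (g.comp (X ^ 2 - C 2)).map PadicInt.toZMod =
        (g.map PadicInt.toZMod) ^ 2 := by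
      intro g
      rw [← ZMod.expand_card, Polynomial.map_comp, expand_eq_comp_X_pow]
      congr 1
      simp only [Polynomial.map_sub, Polynomial.map_pow, map_X]
      rw [map_C, map_ofNat, h2, sub_zero]
    have h1 := congrArg (Polynomial.map PadicInt.toZMod) (evenPart_comp_add f)
    rw [Polynomial.map_add, Polynomial.map_mul, map_X, hc, hc] at h1
    rw [Polynomial.map_sub, ← h1, doublingNorm]
    simp only [Polynomial.map_sub, Polynomial.map_mul, Polynomial.map_add, Polynomial.map_pow,
      map_X]
    have h3 : (2 : (ZMod 2)[X]) = 0 := by rw [← h2]; rfl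
    rw [map_C, map_ofNat, h2]
    linear_combination -(X * (oddPart f).map PadicInt.toZMod ^ 2) * h3
  have h3 : C (2 : ℤ_[2]) ∣ doublingNorm f - f := by
    rw [C_dvd_iff_dvd_coeff]
    intro i
    have h3 : PadicInt.toZMod ((doublingNorm f - f).coeff i) = 0 := by
      rw [← coeff_map, key, coeff_zero]
    rw [← RingHom.mem_ker, PadicInt.ker_toZMod, PadicInt.maximalIdeal_eq_span_p,
      Ideal.mem_span_singleton] at h3
    exact_mod_cast h3
  obtain ⟨h, hh⟩ := h3
  exact ⟨h, by rw [← hh]; ring⟩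

/-- The point `2` is fixed by `x ↦ x ^ 2 - 2`, so `h(2) = a(2) + 2 b(2)`. -/
theorem two_dvd_evenPart_eval {h : ℤ_[2][X]} (hh : 2 ∣ h.eval 2) : 2 ∣ (evenPart h).eval 2 := by
  have h1 := aeval_eq_evenPart_add h (2 : ℤ_[2])
  norm_num [coe_aeval_eq_eval] at h1
  obtain ⟨c, hc⟩ := hh
  exact ⟨c - (oddPart h).eval 2, by linear_combination -h1 + hc⟩

theorem zmod_two_ne_zero_iff : ∀ y : ZMod 2, y ≠ 0 ↔ y - 1 = 0 := by decide

theorem isUnit_iff_exists_eq_one_add_two_mul {z : ℤ_[2]} : IsUnit z ↔ ∃ w, z = 1 + 2 * w := by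
  have hm : ∀ x : ℤ_[2], PadicInt.toZMod x = 0 ↔ 2 ∣ x := by
    intro x
    rw [← RingHom.mem_ker, PadicInt.ker_toZMod, PadicInt.maximalIdeal_eq_span_p,
      Ideal.mem_span_singleton]
    norm_num
  have hu : IsUnit z ↔ ¬ 2 ∣ z := by
    rw [← hm, ← RingHom.mem_ker, PadicInt.ker_toZMod, IsLocalRing.mem_maximalIdeal,
      mem_nonunits_iff, not_not]
  rw [hu, ← hm, ← ne_eq, zmod_two_ne_zero_iff, ← map_one PadicInt.toZMod, ← map_sub, hm]
  exact ⟨fun ⟨w, hw⟩ => ⟨w, by linear_combination hw⟩, fun ⟨w, hw⟩ => ⟨w, by linear_combination hw⟩⟩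

theorem eight_dvd_sq_sub_one {z : ℤ_[2]} (hz : IsUnit z) : 8 ∣ z ^ 2 - 1 := by
  obtain ⟨w, rfl⟩ := isUnit_iff_exists_eq_one_add_two_mul.1 hz
  have : (2 : ℤ_[2]) ∣ w * (w + 1) := by
    have h : PadicInt.toZMod (w * (w + 1)) = 0 := by
      rw [map_mul, map_add, map_one]; exact zmod_two_mul_add_one _
    rw [← RingHom.mem_ker, PadicInt.ker_toZMod, PadicInt.maximalIdeal_eq_span_p,
      Ideal.mem_span_singleton] at h
    exact_mod_cast h
  obtain ⟨c, hc⟩ := this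
  exact ⟨c, by linear_combination 4 * hc⟩

/-- Perturbing `f` by `c h` changes its norm by `2 c` times the polar form plus `c ^ 2` times the
norm of `h`, so each iteration gains a factor `2`. The parity of `h(2)` is carried along because it
provides one further factor `2`, which matches `deg_2 2 = 4`. -/
theorem iterate_doublingNorm_congr (f : ℤ_[2][X]) (hf : IsUnit (f.eval 0)) (k : ℕ) :
    ∃ h : ℤ_[2][X], doublingNorm^[k + 2] f = doublingNorm^[k + 1] f + C (2 ^ (k + 2)) * h ∧
      2 ∣ h.eval 2 := by
  induction k with
  | zero =>
    obtain ⟨h, hh⟩ := doublingNorm_congr f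
    refine ⟨doublingPolar f h + doublingNorm h, ?_, ?_⟩
    · simp only [Function.iterate_succ, Function.iterate_zero, Function.comp, id]
      conv_lhs => rw [hh, doublingNorm_add_C_mul]
      rw [show (2 * 2 : ℤ_[2]) = 2 ^ (0 + 2) by norm_num]
      ring
    -- The orbit `0 ↦ -2 ↦ 2 ↦ 2` gives the initial parity: the second norm at `2` is the first one
    -- times `f(0) ^ 2`, and `f(0) ^ 2 ≡ 1` modulo `8`.
    · have h1 : (doublingNorm (doublingNorm f)).eval 2 =
          (doublingNorm f).eval 2 * (f.eval 0) ^ 2 := by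
        have h2 := eval_doublingNorm (doublingNorm f) 2
        have h3 := eval_doublingNorm f 0
        norm_num at h2 h3
        rw [h2, h3]; ring
      have h4 : (doublingNorm (doublingNorm f)).eval 2 = (doublingNorm f).eval 2 +
          4 * (doublingPolar f h + doublingNorm h).eval 2 := by
        conv_lhs => rw [hh, doublingNorm_add_C_mul]
        simp only [eval_add, eval_mul, eval_C]
        ring
      obtain ⟨c, hc⟩ := eight_dvd_sq_sub_one hf
      have h40 : (4 : ℤ_[2]) ≠ 0 := by norm_num
      refine ⟨(doublingNorm f).eval 2 * c, mul_left_cancel₀ h40 ?_⟩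
      linear_combination h1 - h4 + (doublingNorm f).eval 2 * hc
  | succ k ih =>
    obtain ⟨h, hh, h2⟩ := ih
    refine ⟨doublingPolar (doublingNorm^[k + 1] f) h + C (2 ^ (k + 1)) * doublingNorm h, ?_, ?_⟩
    · rw [Function.iterate_succ_apply' _ (k + 2)]
      conv_lhs => rw [hh, doublingNorm_add_C_mul]
      rw [← Function.iterate_succ_apply' doublingNorm (k + 1),
        show (2 * 2 ^ (k + 2) : ℤ_[2]) = 2 ^ (k + 1 + 2) by ring,
        show ((2 ^ (k + 2)) ^ 2 : ℤ_[2]) = 2 ^ (k + 1 + 2) * 2 ^ (k + 1) by ring, C_mul]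
      ring
    · have h3 := two_dvd_evenPart_eval h2
      have h4 : 2 ∣ (doublingPolar (doublingNorm^[k + 1] f) h).eval 2 := by
        rw [doublingPolar, eval_sub, eval_mul, eval_mul, eval_add, eval_X, eval_C]
        refine dvd_sub (h3.mul_left _) (Dvd.dvd.mul_right ⟨2, by norm_num⟩ _)
      rw [eval_add, eval_mul, eval_C]
      exact dvd_add h4 (Dvd.dvd.mul_right (dvd_pow_self 2 (Nat.succ_ne_zero k)) _)

theorem isUnit_iterate_doublingNorm_eval (f : ℤ_[2][X]) {x : ℤ_[2]} (hf : IsUnit (f.eval x))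
    (k : ℕ) : IsUnit ((doublingNorm^[k] f).eval x) := by
  induction k with
  | zero => exact hf
  | succ k ih =>
    rw [Function.iterate_succ_apply']
    obtain ⟨h, hh⟩ := doublingNorm_congr (doublingNorm^[k] f)
    obtain ⟨w, hw⟩ := isUnit_iff_exists_eq_one_add_two_mul.1 ih
    rw [hh, eval_add, eval_mul, eval_C, hw]
    exact isUnit_iff_exists_eq_one_add_two_mul.2 ⟨w + h.eval x, by ring⟩

/-- The same orbit shows that the iterates `n + 2` and `n + 1` at `2` have ratio the square of the
`n`-th iterate at `0`. They differ by `2 ^ (n + 2) h(2)` with `h(2)` even, and the iterate `n + 1`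
is a unit at `2`. -/
theorem iterate_doublingNorm_eval_zero_sq (f : ℤ_[2][X]) (hf : IsUnit (f.eval 0)) (n : ℕ) :
    2 ^ (n + 3) ∣ ((doublingNorm^[n] f).eval 0) ^ 2 - 1 := by
  obtain ⟨h, hh, c, hc⟩ := iterate_doublingNorm_congr f hf n
  have hf2 : IsUnit (f.eval 2) := by
    obtain ⟨w, hw⟩ := isUnit_iff_exists_eq_one_add_two_mul.1 hf
    obtain ⟨q, hq⟩ := sub_dvd_eval_sub (2 : ℤ_[2]) 0 f
    exact isUnit_iff_exists_eq_one_add_two_mul.2 ⟨w + q, by linear_combination hq + hw⟩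
  have hu := isUnit_iterate_doublingNorm_eval f hf2 (n + 1)
  have h1 : (doublingNorm^[n + 2] f).eval 2 =
      (doublingNorm^[n + 1] f).eval 2 * ((doublingNorm^[n] f).eval 0) ^ 2 := by
    have h2 := eval_doublingNorm (doublingNorm^[n + 1] f) 2
    have h3 := eval_doublingNorm (doublingNorm^[n] f) 0
    rw [← Function.iterate_succ_apply' doublingNorm] at h2 h3
    rw [show (2 : ℤ_[2]) ^ 2 - 2 = 2 by norm_num] at h2
    rw [show (0 : ℤ_[2]) ^ 2 - 2 = -2 by norm_num, neg_zero] at h3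
    rw [h2, h3]; ring
  have h4 := congrArg (eval 2) hh
  rw [eval_add, eval_mul, eval_C, hc] at h4
  rw [← hu.dvd_mul_left (a := 2 ^ (n + 3))]
  exact ⟨c, by linear_combination h4 - h1⟩

section Roots

variable {Ω : Type*} [Field Ω] [IsAlgClosed Ω]

/-- Over a root `s` of `P` lie the two roots `± r` with `r ^ 2 - 2 = s`; working with multisets
keeps the multiplicities right. -/
theorem prod_roots_comp_doubling (F G : Ω → Ω) (hFG : ∀ r, F r * F (-r) = G (r ^ 2 - 2))
    {P : Polynomial Ω} (hP : P.Monic) :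
    ((P.comp (X ^ 2 - C 2)).roots.map F).prod = (P.roots.map G).prod := by
  have key : ∀ S : Multiset Ω, (((S.map fun s => X - C s).prod.comp (X ^ 2 - C 2)).roots.map F).prod =
      (S.map G).prod := by
    intro S
    have hne : ∀ S : Multiset Ω, (S.map fun s => X - C s).prod.comp (X ^ 2 - C 2) ≠ 0 := by
      intro S
      refine (Monic.comp (monic_multiset_prod_of_monic _ _ fun s _ => monic_X_sub_C s)
        (monic_X_pow_sub_C 2 two_ne_zero) ?_).ne_zero
      rw [natDegree_X_pow_sub_C]; exact two_ne_zero
    induction S using Multiset.induction_on with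
    | empty => simp
    | cons s S ih =>
      obtain ⟨r, hr⟩ := IsAlgClosed.exists_pow_nat_eq (s + 2) two_pos
      have hs : (X - C s).comp (X ^ 2 - C 2) = (X - C r) * (X - C (-r)) := by
        have : (C s : Polynomial Ω) = C r ^ 2 - C 2 := by rw [← C_pow, hr]; simp
        rw [sub_comp, X_comp, C_comp, this, C_neg]; ring
      have hrs : r ^ 2 - 2 = s := by rw [hr]; ring
      have h0 := hne (s ::ₘ S)
      rw [Multiset.map_cons, Multiset.prod_cons, mul_comp] at h0 ⊢
      rw [roots_mul h0, Multiset.map_add, Multiset.prod_add, ih, Multiset.map_cons,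
        Multiset.prod_cons, hs, roots_mul (hs ▸ (mul_ne_zero_iff.1 h0).1), roots_X_sub_C,
        roots_X_sub_C]
      simp [hFG, hrs]
  conv_lhs => rw [(IsAlgClosed.splits P).eq_prod_roots_of_monic hP]
  exact key _

/-- The iterates of `X ^ 2 - 2`. -/
noncomputable def doublingPoly (R : Type*) [CommRing R] : ℕ → R[X]
  | 0 => X
  | n + 1 => (doublingPoly R n).comp (X ^ 2 - C 2)

theorem doublingPoly_monic (R : Type*) [CommRing R] [Nontrivial R] (n : ℕ) :
    (doublingPoly R n).Monic := by
  induction n with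
  | zero => exact monic_X
  | succ n ih =>
    refine ih.comp (monic_X_pow_sub_C 2 two_ne_zero) ?_
    rw [natDegree_X_pow_sub_C]; exact two_ne_zero

theorem doublingPoly_natDegree (R : Type*) [CommRing R] [IsDomain R] (n : ℕ) :
    (doublingPoly R n).natDegree = 2 ^ n := by
  induction n with
  | zero => exact natDegree_X
  | succ n ih =>
    rw [doublingPoly, natDegree_comp, ih, natDegree_X_pow_sub_C, pow_succ]

theorem doublingPoly_map {R S : Type*} [CommRing R] [CommRing S] (φ : R →+* S) (n : ℕ) :
    (doublingPoly R n).map φ = doublingPoly S n := by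
  induction n with
  | zero => exact map_X φ
  | succ n ih => rw [doublingPoly, doublingPoly, Polynomial.map_comp, ih]; simp only [Polynomial.map_sub, Polynomial.map_pow, map_X, map_C, map_ofNat φ 2]

theorem doublingPoly_eval_of_sq {R : Type*} [CommRing R] (n : ℕ) {x : R} (hx : x ^ 2 - 2 = x) :
    (doublingPoly R n).eval x = x := by
  induction n with
  | zero => simp [doublingPoly]
  | succ n ih => simp [doublingPoly, hx, ih]

theorem doublingPoly_eval_zero {R : Type*} [CommRing R] (n : ℕ) :
    (doublingPoly R (n + 2)).eval 0 = 2 := by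
  have h2 : (2 : R) ^ 2 - 2 = 2 := by norm_num
  have := doublingPoly_eval_of_sq n h2
  simp only [doublingPoly, eval_comp, eval_sub, eval_pow, eval_X, eval_C]
  norm_num
  exact this

theorem prod_roots_doublingPoly {R : Type*} [CommRing R] [Algebra R Ω] (f : R[X]) (n : ℕ) :
    ((doublingPoly Ω n).roots.map fun x => aeval x f).prod =
      algebraMap R Ω ((doublingNorm^[n] f).eval 0) := by
  induction n generalizing f with
  | zero =>
    have := aeval_algebraMap_apply Ω (0 : R) f
    rw [map_zero, coe_aeval_eq_eval] at this
    simp [doublingPoly, this]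
  | succ n ih =>
    rw [doublingPoly, prod_roots_comp_doubling _ (fun x => aeval x (doublingNorm f))
      (fun r => (aeval_doublingNorm f r).symm) (doublingPoly_monic Ω n), ih,
      Function.iterate_succ_apply]

end Roots

end DoublingNorm

end LogClass

namespace LogClass

/-! ### Reduction to units in totally ramified extensions -/

section Eisenstein

open Polynomial

variable {ℓ : ℕ} [Fact ℓ.Prime]

/-- A monic polynomial over `ℤ_ℓ` whose lower coefficients are divisible by `ℓ`, with constant
coefficient `± ℓ`. -/
structure IsPrimeEisenstein (P : ℤ_[ℓ][X]) : Prop where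
  monic : P.Monic
  natDegree_pos : 0 < P.natDegree
  dvd_coeff : ∀ n < P.natDegree, (ℓ : ℤ_[ℓ]) ∣ P.coeff n
  coeff_zero : P.coeff 0 = ℓ ∨ P.coeff 0 = -ℓ

theorem prime_padicInt_natCast : Prime (ℓ : ℤ_[ℓ]) := PadicInt.prime_p

theorem IsPrimeEisenstein.irreducible_map {P : ℤ_[ℓ][X]} (hP : IsPrimeEisenstein P) :
    Irreducible (P.map (algebraMap ℤ_[ℓ] ℚ_[ℓ])) := by
  rw [← hP.monic.irreducible_iff_irreducible_map_fraction_map]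
  have hp := prime_padicInt_natCast (ℓ := ℓ)
  have hE : P.IsEisensteinAt (Ideal.span {(ℓ : ℤ_[ℓ])}) := by
    refine ⟨?_, fun {n} hn => Ideal.mem_span_singleton.2 (hP.dvd_coeff n hn), ?_⟩
    · rw [hP.monic.leadingCoeff, Ideal.mem_span_singleton]
      exact fun h => hp.not_isUnit (isUnit_of_dvd_one h)
    · rw [Ideal.span_singleton_pow, Ideal.mem_span_singleton]
      have h1 : ¬ (ℓ : ℤ_[ℓ]) ^ 2 ∣ ℓ := by
        intro ⟨c, hc⟩
        exact hp.not_isUnit (IsUnit.of_mul_eq_one c (mul_left_cancel₀ hp.ne_zero (by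
          linear_combination -hc)))
      rcases hP.coeff_zero with h | h <;> rw [h]
      · exact h1
      · rwa [dvd_neg]
  exact hE.irreducible ((Ideal.span_singleton_prime hp.ne_zero).2 hp) hP.monic.isPrimitive
    hP.natDegree_pos

/-- The polynomial `W` with `P = X ^ d + ℓ W` has unit constant coefficient. -/
theorem IsPrimeEisenstein.exists_eq_X_pow_add {P : ℤ_[ℓ][X]} (hP : IsPrimeEisenstein P) :
    ∃ W : ℤ_[ℓ][X], P = X ^ P.natDegree + C (ℓ : ℤ_[ℓ]) * W ∧ IsUnit (W.eval 0) := by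
  have hp := prime_padicInt_natCast (ℓ := ℓ)
  have h : C (ℓ : ℤ_[ℓ]) ∣ P - X ^ P.natDegree := by
    rw [C_dvd_iff_dvd_coeff]
    intro i
    rw [coeff_sub, coeff_X_pow]
    rcases lt_trichotomy i P.natDegree with hi | hi | hi
    · rw [if_neg hi.ne, sub_zero]; exact hP.dvd_coeff i hi
    · rw [if_pos hi, hi, hP.monic.coeff_natDegree, sub_self]; exact dvd_zero _
    · rw [if_neg hi.ne', coeff_eq_zero_of_natDegree_lt hi, sub_zero]; exact dvd_zero _
  obtain ⟨W, hW⟩ := h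
  have hPW : P = X ^ P.natDegree + C (ℓ : ℤ_[ℓ]) * W := by rw [← hW]; ring
  refine ⟨W, hPW, ?_⟩
  have h0 : P.coeff 0 = ℓ * W.eval 0 := by
    conv_lhs => rw [hPW]
    rw [coeff_add, coeff_X_pow, if_neg hP.natDegree_pos.ne, coeff_C_mul, zero_add,
      coeff_zero_eq_eval_zero]
  rcases hP.coeff_zero with h | h
  · have : W.eval 0 = 1 := mul_left_cancel₀ hp.ne_zero (by linear_combination h - h0)
    rw [this]; exact isUnit_one
  · have : W.eval 0 = -1 := mul_left_cancel₀ hp.ne_zero (by linear_combination h - h0)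
    rw [this]; exact isUnit_one.neg

/-- Take out the content `ℓ ^ s`, then cut at the first coefficient prime to `ℓ`, whose index is
`i`. -/
theorem exists_eq_pow_mul_add (f : ℤ_[ℓ][X]) (hf : f ≠ 0) :
    ∃ (s i : ℕ) (g h : ℤ_[ℓ][X]), i ≤ f.natDegree ∧ IsUnit (h.eval 0) ∧
      f = C ((ℓ : ℤ_[ℓ]) ^ s) * (C (ℓ : ℤ_[ℓ]) * g + X ^ i * h) := by
  have hp := prime_padicInt_natCast (ℓ := ℓ)
  have hunit : ∀ x : ℤ_[ℓ], ¬ (ℓ : ℤ_[ℓ]) ∣ x → IsUnit x := by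
    intro x hx
    rw [← Ideal.mem_span_singleton, ← PadicInt.maximalIdeal_eq_span_p,
      IsLocalRing.mem_maximalIdeal, mem_nonunits_iff, not_not] at hx
    exact hx
  have hfin : FiniteMultiplicity (C (ℓ : ℤ_[ℓ])) f := by
    obtain ⟨n, hn⟩ : ∃ n, f.coeff n ≠ 0 := by
      by_contra! h; exact hf (Polynomial.ext fun n => by simpa using h n)
    have h1 : FiniteMultiplicity (ℓ : ℤ_[ℓ]) (f.coeff n) :=
      FiniteMultiplicity.of_prime_left hp hn
    obtain ⟨k, hk⟩ := h1
    exact ⟨k, fun h => hk (by rw [← C_pow, C_dvd_iff_dvd_coeff] at h; exact h n)⟩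
  obtain ⟨f', hf', hnd⟩ := hfin.exists_eq_pow_mul_and_not_dvd
  set s := multiplicity (C (ℓ : ℤ_[ℓ])) f
  classical
  have hex : ∃ i, ¬ (ℓ : ℤ_[ℓ]) ∣ f'.coeff i := by
    rw [C_dvd_iff_dvd_coeff] at hnd; push Not at hnd; exact hnd
  set i := Nat.find hex with hi
  have hspec := Nat.find_spec hex
  have hmin : ∀ j < i, (ℓ : ℤ_[ℓ]) ∣ f'.coeff j := fun j hj => not_not.1 (Nat.find_min hex hj)
  set r : ℤ_[ℓ][X] := f' %ₘ X ^ i with hr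
  have hdiv : r + X ^ i * (f' /ₘ X ^ i) = f' := modByMonic_add_div _ _
  have hrc : ∀ j < i, r.coeff j = f'.coeff j := by
    intro j hj
    conv_rhs => rw [← hdiv]
    rw [coeff_add, coeff_X_pow_mul', if_neg (by omega), add_zero]
  have hrd : r.degree < i := by
    have := degree_modByMonic_lt f' (monic_X_pow (R := ℤ_[ℓ]) i)
    rwa [degree_X_pow] at this
  have hrdvd : C (ℓ : ℤ_[ℓ]) ∣ r := by
    rw [C_dvd_iff_dvd_coeff]
    intro j
    by_cases hj : j < i
    · rw [hrc j hj]; exact hmin j hj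
    · rw [coeff_eq_zero_of_degree_lt (hrd.trans_le (by exact_mod_cast not_lt.1 hj))]
      exact dvd_zero _
  obtain ⟨g, hg⟩ := hrdvd
  refine ⟨s, i, g, f' /ₘ X ^ i, ?_, ?_, ?_⟩
  · have h1 : f.coeff i ≠ 0 := by
      rw [hf', ← C_pow, coeff_C_mul]
      exact mul_ne_zero (pow_ne_zero _ hp.ne_zero) fun h => hspec (h ▸ dvd_zero _)
    exact le_natDegree_of_ne_zero h1
  · refine hunit _ ?_
    have : f'.coeff i = (f' /ₘ X ^ i).eval 0 := by
      conv_lhs => rw [← hdiv]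
      rw [coeff_add, coeff_X_pow_mul', if_pos le_rfl, Nat.sub_self, coeff_zero_eq_eval_zero,
        coeff_eq_zero_of_degree_lt hrd, zero_add]
    rw [← this]; exact hspec
  · rw [← hg, hdiv, C_pow, ← hf']

/-- A multiplicative property of the nonzero elements of `ℚ_ℓ(π)`, for `π` a root of an Eisenstein
polynomial, holds if it holds for `ℚ_ℓ`, for `π` and for the units in `ℤ_ℓ[π]`. -/
theorem IsPrimeEisenstein.induction {P : ℤ_[ℓ][X]} (hP : IsPrimeEisenstein P)
    {L : Type*} [Field L] [Algebra ℚ_[ℓ] L] {π : L}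
    (hπ : aeval π (P.map (algebraMap ℤ_[ℓ] ℚ_[ℓ])) = 0)
    (hgen : ∀ x : L, ∃ q : ℚ_[ℓ][X], aeval π q = x) (H : L → Prop)
    (hmul : ∀ x y, x ≠ 0 → y ≠ 0 → H x → H y → H (x * y))
    (hdiv : ∀ x y, x ≠ 0 → y ≠ 0 → H x → H y → H (x / y))
    (hK : ∀ c : ℚ_[ℓ], c ≠ 0 → H (algebraMap _ L c)) (h_root : H π)
    (hunit : ∀ f : ℤ_[ℓ][X], IsUnit (f.eval 0) → aeval π (f.map (algebraMap ℤ_[ℓ] ℚ_[ℓ])) ≠ 0 →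
      H (aeval π (f.map (algebraMap ℤ_[ℓ] ℚ_[ℓ])))) {x : L} (hx : x ≠ 0) : H x := by
  have hp := prime_padicInt_natCast (ℓ := ℓ)
  have hℓ0 : (ℓ : ℚ_[ℓ]) ≠ 0 := by exact_mod_cast (Fact.out : ℓ.Prime).ne_zero
  set ev : ℤ_[ℓ][X] →+* L :=
    (aeval π).toRingHom.comp (mapRingHom (algebraMap ℤ_[ℓ] ℚ_[ℓ])) with hev
  have hev' : ∀ f, aeval π (f.map (algebraMap ℤ_[ℓ] ℚ_[ℓ])) = ev f := fun _ => rfl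
  simp only [hev'] at hπ hunit
  have hevC : ∀ c, ev (C c) = algebraMap ℚ_[ℓ] L c := by
    intro c; rw [← hev', map_C, aeval_C]; rfl
  have hevX : ev X = π := by rw [← hev', map_X, aeval_X]
  obtain ⟨q, rfl⟩ := hgen x
  obtain ⟨b, hb, hbq⟩ := IsLocalization.integerNormalization_spec (nonZeroDivisors ℤ_[ℓ]) q
  set f := IsLocalization.integerNormalization (nonZeroDivisors ℤ_[ℓ]) q with hf
  have hb0 : (b : ℚ_[ℓ]) ≠ 0 := fun h => nonZeroDivisors.ne_zero hb (Subtype.coe_injective (h.trans PadicInt.coe_zero.symm))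
  have hbL : algebraMap ℚ_[ℓ] L b ≠ 0 := by
    rwa [ne_eq, FaithfulSMul.algebraMap_eq_zero_iff]
  have hxf : ev f = algebraMap ℚ_[ℓ] L b * aeval π q := by
    have : b • q = C (b : ℚ_[ℓ]) * q := by
      rw [← smul_eq_C_mul, ← algebraMap_smul ℚ_[ℓ] b q]; rfl
    rw [← hev', hbq, this, map_mul, aeval_C]
  have hxq : aeval π q = ev f / algebraMap ℚ_[ℓ] L b := by rw [hxf, mul_div_cancel_left₀ _ hbL]
  have hevf0 : ev f ≠ 0 := by rw [hxf]; exact mul_ne_zero hbL hx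
  rw [hxq]
  refine hdiv _ _ hevf0 hbL ?_ (hK _ hb0)
  -- Reducing modulo `P` ensures `i < deg P`, so that `d + 1 = deg P - i` is positive below.
  set f₁ := f %ₘ P with hf₁
  have hff₁ : ev f₁ = ev f := by
    conv_rhs => rw [← modByMonic_add_div f P]
    rw [map_add, map_mul, hπ, zero_mul, add_zero]
  rw [← hff₁] at hevf0 ⊢
  have hf₁0 : f₁ ≠ 0 := fun h => hevf0 (by rw [h, map_zero])
  have hP1 : P ≠ 1 := by
    intro h; have := hP.natDegree_pos; rw [h, natDegree_one] at this; exact this.false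
  have hdeg : f₁.natDegree < P.natDegree := natDegree_modByMonic_lt f hP.monic hP1
  obtain ⟨s, i, g, h, hi, hu, hfeq⟩ := exists_eq_pow_mul_add f₁ hf₁0
  obtain ⟨W, hPW, hW⟩ := hP.exists_eq_X_pow_add
  obtain ⟨d, hd⟩ := Nat.exists_eq_add_of_lt (hi.trans_lt hdeg)
  have hℓL : algebraMap ℚ_[ℓ] L ℓ ≠ 0 := by rwa [ne_eq, FaithfulSMul.algebraMap_eq_zero_iff]
  have hrel : π ^ P.natDegree + algebraMap ℚ_[ℓ] L ℓ * ev W = 0 := by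
    rw [← hπ]; conv_rhs => rw [hPW]
    rw [map_add, map_mul, map_pow, hevX, hevC]; rfl
  have hπ0 : π ≠ 0 := by
    rintro rfl
    have hc : ev P = algebraMap ℚ_[ℓ] L (P.coeff 0) := by
      rw [← hevC]
      conv_lhs => rw [← divX_mul_X_add P]
      rw [map_add, map_mul, hevX, mul_zero, zero_add]
    rw [hπ, eq_comm, FaithfulSMul.algebraMap_eq_zero_iff] at hc
    rcases hP.coeff_zero with h | h <;> rw [h] at hc <;> simp at hc <;>
      exact (Fact.out : ℓ.Prime).ne_zero hc
  have hW0 : ev W ≠ 0 := by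
    intro h
    rw [h, mul_zero, add_zero] at hrel
    exact hπ0 (pow_eq_zero_iff hP.natDegree_pos.ne' |>.1 hrel)
  -- From `ℓ W(π) = - π ^ deg P`, multiplying `ℓ g + X ^ i h` by `W` at `π` gives `π ^ i F(π)`.
  -- Hence `f₁(π)` is `ℓ ^ s π ^ i F(π) / W(π)`, with `F(0) = h(0) W(0)` a unit.
  set F : ℤ_[ℓ][X] := h * W - X ^ (d + 1) * g with hF
  have hFu : IsUnit (F.eval 0) := by
    simpa [hF] using hu.mul hW
  have hprod : ev f₁ * ev W = algebraMap ℚ_[ℓ] L (((ℓ : ℤ_[ℓ]) ^ s : ℤ_[ℓ]) : ℚ_[ℓ]) *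
      (π ^ i * ev F) := by
    rw [hfeq, hF]
    simp only [map_mul, map_add, map_sub, map_pow, hevX, hevC, PadicInt.coe_pow,
      PadicInt.coe_natCast]
    rw [hd] at hrel
    linear_combination (algebraMap ℚ_[ℓ] L ℓ ^ s * ev g) * hrel
  have hF0 : ev F ≠ 0 := by
    intro h0
    rw [h0, mul_zero, mul_zero] at hprod
    exact (mul_ne_zero hevf0 hW0) hprod
  have hfx : ev f₁ = algebraMap ℚ_[ℓ] L (((ℓ : ℤ_[ℓ]) ^ s : ℤ_[ℓ]) : ℚ_[ℓ]) *
      (π ^ i * ev F) / ev W := by rw [← hprod, mul_div_cancel_right₀ _ hW0]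
  have hs0 : (((ℓ : ℤ_[ℓ]) ^ s : ℤ_[ℓ]) : ℚ_[ℓ]) ≠ 0 := by
    rw [PadicInt.coe_pow, PadicInt.coe_natCast]; exact pow_ne_zero _ hℓ0
  have hs0L : algebraMap ℚ_[ℓ] L (((ℓ : ℤ_[ℓ]) ^ s : ℤ_[ℓ]) : ℚ_[ℓ]) ≠ 0 := by
    rwa [ne_eq, FaithfulSMul.algebraMap_eq_zero_iff]
  have hpow : ∀ n : ℕ, H (π ^ n) := by
    intro n
    induction n with
    | zero => rw [pow_zero, ← map_one (algebraMap ℚ_[ℓ] L)]; exact hK 1 one_ne_zero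
    | succ n ih => rw [pow_succ]; exact hmul _ _ (pow_ne_zero _ hπ0) hπ0 ih h_root
  have hπi := pow_ne_zero i hπ0
  rw [hfx]
  exact hdiv _ _ (mul_ne_zero hs0L (mul_ne_zero hπi hF0)) hW0
    (hmul _ _ hs0L (mul_ne_zero hπi hF0) (hK _ hs0) (hmul _ _ hπi hF0 (hpow i) (hunit F hFu hF0)))
    (hunit W hW hW0)

theorem norm_aeval_powerBasis_gen {K L : Type*} [Field K] [Field L] [Algebra K L] [CharZero K]
    (Ω : Type*) [Field Ω] [Algebra K Ω] [IsAlgClosed Ω] (pb : PowerBasis K L) (f : K[X]) :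
    algebraMap K Ω (Algebra.norm K (aeval pb.gen f)) =
      (((minpoly K pb.gen).aroots Ω).map fun y => aeval y f).prod := by
  classical
  have := pb.finite
  rw [Algebra.norm_eq_prod_embeddings K Ω,
    Fintype.prod_equiv pb.liftEquiv' (fun σ : L →ₐ[K] Ω => σ (aeval pb.gen f))
      (fun y => aeval (y : Ω) f) ?_]
  · rw [Finset.prod_mem_multiset _ _ (fun y => aeval y f) (fun _ => rfl),
      Finset.prod_eq_multiset_prod, Multiset.toFinset_val, Multiset.dedup_eq_self.mpr]
    exact nodup_roots (.map (Algebra.IsSeparable.isSeparable K pb.gen))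
  · intro σ
    rw [PowerBasis.liftEquiv'_apply_coe, ← aeval_algHom_apply]

/-- If `K` is an extension of `ℚ_ℓ`, `‖Log N x‖ ≤ ‖[K : ℚ_ℓ] deg ℓ‖` for all `x`. -/
def LogNormBounded (ℓ : ℕ) [Fact ℓ.Prime] (L : Type*) [Field L] [Algebra ℚ_[ℓ] L] : Prop :=
  ∀ x : L, x ≠ 0 → ‖iwasawaLog ℓ (Algebra.norm ℚ_[ℓ] x)‖ ≤
    ‖degSelf ℓ * (Module.finrank ℚ_[ℓ] L : ℚ_[ℓ])‖

/-- The bound is stable under products and quotients because the norm is ultrametric. A scalar `c`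
gives the degree times `Log c`, and the root has norm `± ℓ`, of logarithm zero. So only the unit
values remain, with their norms written as products over the conjugates. -/
theorem IsPrimeEisenstein.logNormBounded {P : ℤ_[ℓ][X]} (hP : IsPrimeEisenstein P)
    {Ω : Type*} [Field Ω] [Algebra ℚ_[ℓ] Ω] [IsAlgClosed Ω] {π : Ω}
    (hπ : aeval π (P.map (algebraMap ℤ_[ℓ] ℚ_[ℓ])) = 0)
    (hunit : ∀ f : ℤ_[ℓ][X], IsUnit (f.eval 0) → ∀ N : ℚ_[ℓ], N ≠ 0 →
      algebraMap ℚ_[ℓ] Ω N = (((P.map (algebraMap ℤ_[ℓ] ℚ_[ℓ])).aroots Ω).map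
        fun y => aeval y (f.map (algebraMap ℤ_[ℓ] ℚ_[ℓ]))).prod →
      ‖iwasawaLog ℓ N‖ ≤ ‖degSelf ℓ * (P.natDegree : ℚ_[ℓ])‖) :
    LogNormBounded ℓ (IntermediateField.adjoin ℚ_[ℓ] {π}) := by
  have hmin : minpoly ℚ_[ℓ] π = P.map (algebraMap ℤ_[ℓ] ℚ_[ℓ]) :=
    (minpoly.eq_of_irreducible_of_monic hP.irreducible_map hπ (hP.monic.map _)).symm
  have hint : IsIntegral ℚ_[ℓ] π := ⟨_, hP.monic.map _, hπ⟩
  set pb := IntermediateField.adjoin.powerBasis hint with hpb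
  have hfd := pb.finite
  have hgenπ : ((pb.gen : IntermediateField.adjoin ℚ_[ℓ] {π}) : Ω) = π := by
    rw [hpb, IntermediateField.adjoin.powerBasis_gen]; rfl
  have hminpb : minpoly ℚ_[ℓ] pb.gen = P.map (algebraMap ℤ_[ℓ] ℚ_[ℓ]) := by
    have h1 := minpoly.algebraMap_eq (A := ℚ_[ℓ]) (B := IntermediateField.adjoin ℚ_[ℓ] {π})
      (B' := Ω) Subtype.val_injective pb.gen
    exact h1.symm.trans ((congrArg (minpoly ℚ_[ℓ]) hgenπ).trans hmin)
  have hrank : Module.finrank ℚ_[ℓ] (IntermediateField.adjoin ℚ_[ℓ] {π}) = P.natDegree := by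
    rw [IntermediateField.adjoin.finrank hint, hmin, hP.monic.natDegree_map]
  have hN0 : ∀ {x : IntermediateField.adjoin ℚ_[ℓ] {π}}, x ≠ 0 → Algebra.norm ℚ_[ℓ] x ≠ 0 :=
    fun hx => Algebra.norm_ne_zero_iff.2 hx
  intro x hx
  refine hP.induction (π := pb.gen) ?_ ?_ (fun x => ‖iwasawaLog ℓ (Algebra.norm ℚ_[ℓ] x)‖ ≤
    ‖degSelf ℓ * (Module.finrank ℚ_[ℓ] (IntermediateField.adjoin ℚ_[ℓ] {π}) : ℚ_[ℓ])‖)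
    ?_ ?_ ?_ ?_ ?_ hx
  · rw [← hminpb, minpoly.aeval]
  · intro y
    obtain ⟨f, hf⟩ := pb.exists_eq_aeval' y
    exact ⟨f, hf.symm⟩
  · intro x y hx hy h1 h2
    rw [map_mul, iwasawaLog_mul ℓ (hN0 hx) (hN0 hy)]
    exact (IsUltrametricDist.norm_add_le_max _ _).trans (max_le h1 h2)
  · intro x y hx hy h1 h2
    have h3 := map_mul (Algebra.norm ℚ_[ℓ]) (x / y) y
    rw [div_mul_cancel₀ _ hy] at h3
    have h4 := iwasawaLog_mul ℓ (hN0 (div_ne_zero hx hy)) (hN0 hy)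
    rw [← h3] at h4
    rw [eq_sub_of_add_eq h4.symm, sub_eq_add_neg]
    refine (IsUltrametricDist.norm_add_le_max _ _).trans (max_le h1 ?_)
    rwa [norm_neg]
  · intro c hc
    rw [Algebra.norm_algebraMap, iwasawaLog_pow hc, norm_mul, norm_mul, mul_comm]
    exact mul_le_mul_of_nonneg_right (norm_iwasawaLog_le hc) (norm_nonneg _)
  · have hℓ0 : (ℓ : ℚ_[ℓ]) ≠ 0 := by exact_mod_cast (Fact.out : ℓ.Prime).ne_zero
    have h1 : iwasawaLog ℓ (Algebra.norm ℚ_[ℓ] pb.gen) = 0 := by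
      rw [Algebra.PowerBasis.norm_gen_eq_coeff_zero_minpoly, hminpb, coeff_map]
      have h2 : ∀ z : ℚ_[ℓ], z = ℓ ∨ z = -ℓ → iwasawaLog ℓ z = 0 := by
        rintro z (rfl | rfl)
        · exact iwasawaLog_self
        · rw [iwasawaLog_neg hℓ0, iwasawaLog_self]
      apply h2
      have h3 : algebraMap ℤ_[ℓ] ℚ_[ℓ] (P.coeff 0) = ℓ ∨ algebraMap ℤ_[ℓ] ℚ_[ℓ] (P.coeff 0) = -ℓ := by
        rcases hP.coeff_zero with h | h <;> rw [h]
        · exact Or.inl (map_natCast _ _)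
        · right; rw [map_neg, map_natCast]
      rcases neg_one_pow_eq_or ℚ_[ℓ] pb.dim with h | h <;> rw [h] <;>
        rcases h3 with h3 | h3 <;> rw [h3] <;> simp
    rw [h1, norm_zero]
    exact norm_nonneg _
  · intro f hf hf0
    rw [hrank]
    refine hunit f hf _ (hN0 hf0) ?_
    rw [norm_aeval_powerBasis_gen Ω pb, hminpb]

end Eisenstein

end LogClass

namespace LogClass

/-! ### Bounded members of the cyclotomic tower -/

section CyclotomicBounds

open Polynomial

variable {ℓ : ℕ} [Fact ℓ.Prime]

theorem isPrimeEisenstein_cyclotomic (m : ℕ) : IsPrimeEisenstein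
    (((cyclotomic (ℓ ^ (m + 1)) ℤ).comp (X + 1)).map (Int.castRingHom ℤ_[ℓ])) := by
  have hE := cyclotomic_prime_pow_comp_X_add_one_isEisensteinAt ℓ m
  have hmon : ((cyclotomic (ℓ ^ (m + 1)) ℤ).comp (X + 1)).Monic :=
    (cyclotomic.monic _ ℤ).comp_X_add_C 1
  have hdeg : ((cyclotomic (ℓ ^ (m + 1)) ℤ).comp (X + 1)).natDegree = (ℓ ^ (m + 1)).totient := by
    rw [natDegree_comp, natDegree_cyclotomic, ← C_1, natDegree_X_add_C, mul_one]
  refine ⟨hmon.map _, ?_, ?_, Or.inl ?_⟩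
  · rw [hmon.natDegree_map, hdeg]
    exact Nat.totient_pos.2 (pow_pos (Fact.out : ℓ.Prime).pos _)
  · intro n hn
    rw [hmon.natDegree_map] at hn
    obtain ⟨c, hc⟩ := Ideal.mem_span_singleton.1 (hE.mem hn)
    rw [coeff_map, hc]
    exact ⟨(c : ℤ_[ℓ]), by simp⟩
  · rw [coeff_map, coeff_zero_eq_eval_zero, eval_comp]
    simp [eval_one_cyclotomic_prime_pow]

theorem roots_comp_X_add_C {Ω : Type*} [Field Ω] [IsAlgClosed Ω] {P : Polynomial Ω} (hP : P.Monic)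
    (a : Ω) : (P.comp (X + C a)).roots = P.roots.map fun s => s - a := by
  conv_lhs => rw [(IsAlgClosed.splits P).eq_prod_roots_of_monic hP]
  rw [multiset_prod_comp, Multiset.map_map]
  have : (fun s => (X - C s : Polynomial Ω).comp (X + C a)) = fun s => X - C (s - a) := by
    funext s; simp; ring
  simp only [Function.comp_def, this]
  rw [← roots_multiset_prod_X_sub_C (P.roots.map fun s => s - a), Multiset.map_map]
  rfl

theorem map_prod_primitiveRoots {Ω M : Type*} [Field Ω] [CommMonoid M] {N : ℕ} [NeZero N] {ζ : Ω}
    (hζ : IsPrimitiveRoot ζ N) (F : Ω → M) :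
    ∏ s ∈ primitiveRoots N Ω, F s = ∏ i ∈ Finset.range N with i.Coprime N, F (ζ ^ i) := by
  symm
  refine Finset.prod_nbij (fun i => ζ ^ i) ?_ ?_ ?_ fun _ _ => rfl
  · intro i hi
    rw [Finset.mem_filter] at hi
    rw [mem_primitiveRoots (NeZero.pos N)]
    exact hζ.pow_of_coprime i hi.2
  · intro i hi j hj h
    simp only [Finset.coe_filter, Finset.mem_range, Set.mem_ofPred_eq] at hi hj
    exact hζ.pow_inj hi.1 hj.1 h
  · intro s hs
    rw [Finset.mem_coe, mem_primitiveRoots (NeZero.pos N)] at hs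
    obtain ⟨i, hi, hc, rfl⟩ := (hζ.isPrimitiveRoot_iff).1 hs
    exact ⟨i, by simpa using ⟨hi, hc⟩, rfl⟩

/-- Divide `Log (N ^ ℓ) = ℓ Log N` by `ℓ`; this costs exactly one power. -/
theorem norm_iwasawaLog_le_of_pow_prime {N : ℚ_[ℓ]} (hN : N ≠ 0) {k : ℕ}
    (h : ‖N ^ ℓ - 1‖ ≤ ‖(ℓ : ℚ_[ℓ]) ^ (k + 1)‖) : ‖iwasawaLog ℓ N‖ ≤ ‖(ℓ : ℚ_[ℓ]) ^ k‖ := by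
  have hp : ‖(ℓ : ℚ_[ℓ])‖ < 1 := Padic.norm_p_lt_one
  have hℓ0 : (ℓ : ℚ_[ℓ]) ≠ 0 := by exact_mod_cast (Fact.out : ℓ.Prime).ne_zero
  have h1 : ‖N ^ ℓ - 1‖ < 1 := h.trans_lt (by
    rw [norm_pow]; exact pow_lt_one₀ (norm_nonneg _) hp (Nat.succ_ne_zero k))
  have h2 := (norm_iwasawaLog_le_of_norm_sub_one_lt h1).trans h
  rw [iwasawaLog_pow hN, norm_mul, pow_succ', norm_mul] at h2
  exact le_of_mul_le_mul_left h2 (norm_pos_iff.2 hℓ0)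

variable {Ω : Type*} [Field Ω] [Algebra ℚ_[ℓ] Ω] [IsAlgClosed Ω]

theorem cyclotomic_aroots (m : ℕ) :
    ((((cyclotomic (ℓ ^ (m + 1)) ℤ).comp (X + 1)).map (Int.castRingHom ℤ_[ℓ])).map
      (algebraMap ℤ_[ℓ] ℚ_[ℓ])).aroots Ω =
      (primitiveRoots (ℓ ^ (m + 1)) Ω).val.map fun s => s - 1 := by
  have : CharZero Ω := charZero_of_injective_algebraMap (algebraMap ℚ_[ℓ] Ω).injective
  have : NeZero (ℓ ^ (m + 1)) := ⟨pow_ne_zero _ (Fact.out : ℓ.Prime).ne_zero⟩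
  have h0 : NeZero ((ℓ ^ (m + 1) : ℕ) : Ω) := NeZero.charZero
  rw [aroots_def, Polynomial.map_map, Polynomial.map_map, Polynomial.map_comp, map_cyclotomic,
    Polynomial.map_add, map_X, Polynomial.map_one, ← C_1,
    roots_comp_X_add_C (cyclotomic.monic _ _), cyclotomic.roots_eq_primitiveRoots_val]

theorem logNormBounded_cyclotomic (hℓ : ℓ ≠ 2) (m : ℕ) {ζ : Ω}
    (hζ : IsPrimitiveRoot ζ (ℓ ^ (m + 1))) :
    LogNormBounded ℓ (IntermediateField.adjoin ℚ_[ℓ] {ζ}) := by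
  have hchar : CharZero Ω := charZero_of_injective_algebraMap (algebraMap ℚ_[ℓ] Ω).injective
  have hne : NeZero (ℓ ^ (m + 1)) := ⟨pow_ne_zero _ (Fact.out : ℓ.Prime).ne_zero⟩
  have h0 : NeZero ((ℓ ^ (m + 1) : ℕ) : Ω) := NeZero.charZero
  have hadj : IntermediateField.adjoin ℚ_[ℓ] {ζ} = IntermediateField.adjoin ℚ_[ℓ] {ζ - 1} := by
    apply le_antisymm <;> rw [IntermediateField.adjoin_simple_le_iff]
    · have := add_mem (IntermediateField.mem_adjoin_simple_self ℚ_[ℓ] (ζ - 1)) (one_mem _)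
      rwa [sub_add_cancel] at this
    · exact sub_mem (IntermediateField.mem_adjoin_simple_self ℚ_[ℓ] ζ) (one_mem _)
  rw [hadj]
  refine (isPrimeEisenstein_cyclotomic (ℓ := ℓ) m).logNormBounded ?_ ?_
  · have h1 : aeval ζ (cyclotomic (ℓ ^ (m + 1)) ℤ) = 0 := by
      rw [aeval_def, ← eval_map, map_cyclotomic]
      exact (isRoot_cyclotomic_iff.2 hζ)
    rw [aeval_def, eval₂_map, eval₂_map, eval₂_comp]
    rw [aeval_def] at h1
    simpa [RingHom.ext_int (((algebraMap ℚ_[ℓ] Ω).comp (algebraMap ℤ_[ℓ] ℚ_[ℓ])).comp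
      (Int.castRingHom ℤ_[ℓ])) (Int.castRingHom Ω)] using h1
  · intro f hf N hN hprod
    let _ : Algebra ℤ_[ℓ] Ω := ((algebraMap ℚ_[ℓ] Ω).comp (algebraMap ℤ_[ℓ] ℚ_[ℓ])).toAlgebra
    have : IsScalarTower ℤ_[ℓ] ℚ_[ℓ] Ω := IsScalarTower.of_algebraMap_eq fun _ => rfl
    have hdeg : (((cyclotomic (ℓ ^ (m + 1)) ℤ).comp (X + 1)).map
        (Int.castRingHom ℤ_[ℓ])).natDegree = ℓ ^ m * (ℓ - 1) := by
      have hmon : ((cyclotomic (ℓ ^ (m + 1)) ℤ).comp (X + 1)).Monic :=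
        (cyclotomic.monic _ ℤ).comp_X_add_C 1
      rw [hmon.natDegree_map, natDegree_comp, natDegree_cyclotomic, ← C_1, natDegree_X_add_C,
        mul_one, Nat.totient_prime_pow_succ (Fact.out : ℓ.Prime)]
    -- The uniformizer is `ζ - 1`, while `prod_primitive_pow_congr` is stated in terms of `ζ`.
    have hf' : IsUnit ((f.comp (X - 1)).eval 1) := by simpa using hf
    obtain ⟨z, hz, hz'⟩ := prod_primitive_pow_congr m hζ (f.comp (X - 1)) hf'
    have hval : algebraMap ℚ_[ℓ] Ω N =
        ∏ i ∈ Finset.range (ℓ ^ (m + 1)) with i.Coprime (ℓ ^ (m + 1)),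
          aeval (ζ ^ i) (f.comp (X - 1)) := by
      rw [hprod, cyclotomic_aroots, Multiset.map_map,
        ← map_prod_primitiveRoots hζ (fun s => aeval s (f.comp (X - 1)))]
      refine congrArg Multiset.prod (Multiset.map_congr rfl fun s _ => ?_)
      simp [aeval_comp, aeval_map_algebraMap]
    rw [← hval] at hz'
    have hℓ0 : (ℓ : ℚ_[ℓ]) ≠ 0 := by exact_mod_cast (Fact.out : ℓ.Prime).ne_zero
    set w : ℚ_[ℓ] := (N ^ ℓ - 1) / (ℓ : ℚ_[ℓ]) ^ (m + 2) with hw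
    have hNw : N ^ ℓ - 1 = (ℓ : ℚ_[ℓ]) ^ (m + 2) * w := by
      rw [hw, mul_div_cancel₀ _ (pow_ne_zero _ hℓ0)]
    have hzw : algebraMap ℚ_[ℓ] Ω w = z := by
      have h1 := congrArg (algebraMap ℚ_[ℓ] Ω) hNw
      rw [map_sub, map_pow, hz', map_one, map_mul, map_pow, map_natCast, add_sub_cancel_left] at h1
      exact (mul_left_cancel₀ (pow_ne_zero _ (by exact_mod_cast (Fact.out : ℓ.Prime).ne_zero))
        h1).symm
    rw [← hzw] at hz
    have hwi : IsIntegral ℤ_[ℓ] w := (isIntegral_algebraMap_iff (algebraMap ℚ_[ℓ] Ω).injective).1 hz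
    obtain ⟨w', hw'⟩ := IsIntegrallyClosed.isIntegral_iff.1 hwi
    have hw1 : ‖w‖ ≤ 1 := by rw [← hw']; exact w'.2
    have hle : ‖N ^ ℓ - 1‖ ≤ ‖(ℓ : ℚ_[ℓ]) ^ (m + 1 + 1)‖ := by
      rw [hNw, norm_mul]; exact mul_le_of_le_one_right (norm_nonneg _) hw1
    -- The logarithm is divisible by `ℓ ^ (m + 1)`, which is `ℓ` times the degree `ℓ ^ m (ℓ - 1)` up
    -- to a unit.
    refine (norm_iwasawaLog_le_of_pow_prime hN hle).trans (le_of_eq ?_)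
    rw [hdeg, degSelf, if_neg hℓ]
    push_cast [Nat.cast_sub (Fact.out : ℓ.Prime).one_le]
    rw [norm_mul, norm_mul, norm_prime_sub_one, mul_one, ← norm_mul, pow_succ']

theorem isPrimeEisenstein_doublingPoly (n : ℕ) : IsPrimeEisenstein (doublingPoly ℤ_[2] (n + 1)) := by
  have hdeg := doublingPoly_natDegree ℤ_[2] (n + 1)
  refine ⟨doublingPoly_monic _ _, by rw [hdeg]; positivity, ?_, ?_⟩
  · intro i hi
    rw [hdeg] at hi
    have hX : ∀ n, doublingPoly (ZMod 2) n = X ^ 2 ^ n := by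
      intro n
      have h2 : (C 2 : (ZMod 2)[X]) = 0 := by rw [← C_0]; congr 1
      induction n with
      | zero => simp [doublingPoly]
      | succ n ih => rw [doublingPoly, ih, h2, sub_zero, X_pow_comp, ← pow_mul, pow_succ']
    have h3 : PadicInt.toZMod ((doublingPoly ℤ_[2] (n + 1)).coeff i) = 0 := by
      rw [← coeff_map, doublingPoly_map, hX, coeff_X_pow, if_neg hi.ne]
    rwa [← RingHom.mem_ker, PadicInt.ker_toZMod, PadicInt.maximalIdeal_eq_span_p,
      Ideal.mem_span_singleton] at h3
  · rw [coeff_zero_eq_eval_zero]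
    rcases n with _ | n
    · right; simp [doublingPoly]
    · left; rw [doublingPoly_eval_zero]; rfl

theorem logNormBounded_doublingPoly {Ω : Type*} [Field Ω] [Algebra ℚ_[2] Ω] [IsAlgClosed Ω] (n : ℕ)
    {t : Ω} (ht : (doublingPoly Ω (n + 1)).eval t = 0) :
    LogNormBounded 2 (IntermediateField.adjoin ℚ_[2] {t}) := by
  refine (isPrimeEisenstein_doublingPoly n).logNormBounded ?_ ?_
  · rw [doublingPoly_map, aeval_def, ← eval_map, doublingPoly_map, ht]
  · intro f hf N hN hprod
    let _ : Algebra ℤ_[2] Ω := ((algebraMap ℚ_[2] Ω).comp (algebraMap ℤ_[2] ℚ_[2])).toAlgebra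
    have : IsScalarTower ℤ_[2] ℚ_[2] Ω := IsScalarTower.of_algebraMap_eq fun _ => rfl
    have h1 := prod_roots_doublingPoly (Ω := Ω) f (n + 1)
    have hN' : N = algebraMap ℤ_[2] ℚ_[2] ((doublingNorm^[n + 1] f).eval 0) := by
      apply (algebraMap ℚ_[2] Ω).injective
      rw [hprod, ← IsScalarTower.algebraMap_apply, ← h1, aroots_def, doublingPoly_map,
        doublingPoly_map]
      simp only [aeval_map_algebraMap]
    obtain ⟨c, hc⟩ := iterate_doublingNorm_eval_zero_sq f hf (n + 1)
    have hNc : N ^ 2 - 1 = ((2 : ℕ) : ℚ_[2]) ^ (n + 3 + 1) * c := by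
      have := congrArg (algebraMap ℤ_[2] ℚ_[2]) hc
      rw [map_sub, map_pow, ← hN', map_one, map_mul, map_pow] at this
      rw [this]
      congr 1
    have hle : ‖N ^ 2 - 1‖ ≤ ‖((2 : ℕ) : ℚ_[2]) ^ (n + 3 + 1)‖ := by
      rw [hNc, norm_mul]; exact mul_le_of_le_one_right (norm_nonneg _) c.2
    -- Here `2 ^ (n + 3)` is exactly `4` times the degree `2 ^ (n + 1)`.
    refine (norm_iwasawaLog_le_of_pow_prime hN hle).trans (le_of_eq ?_)
    rw [doublingPoly_natDegree, degSelf, if_pos rfl]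
    congr 1
    push_cast
    ring

end CyclotomicBounds

end LogClass

namespace LogClass

/-! ### Boundedness in towers of fields -/

section Transfer

variable {ℓ : ℕ} [Fact ℓ.Prime] {L L' : Type*} [Field L] [Field L'] [Algebra ℚ_[ℓ] L]
  [Algebra ℚ_[ℓ] L'] [Algebra L L'] [IsScalarTower ℚ_[ℓ] L L'] [FiniteDimensional ℚ_[ℓ] L]
  [FiniteDimensional L L']

/-- For `x` in the smaller field, the logarithm of the norm from `L'` is multiplied by `[L' : L]`,
and so is the bound; divide. -/
theorem LogNormBounded.of_tower (h : LogNormBounded ℓ L') : LogNormBounded ℓ L := by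
  intro x hx
  have hd : (Module.finrank L L' : ℚ_[ℓ]) ≠ 0 := by
    exact_mod_cast (Module.finrank_pos (R := L) (M := L')).ne'
  have h1 := h (algebraMap L L' x) (by simpa using hx)
  rw [← Algebra.norm_norm (S := L), Algebra.norm_algebraMap, map_pow,
    iwasawaLog_pow (Algebra.norm_ne_zero_iff.2 hx), ← Module.finrank_mul_finrank ℚ_[ℓ] L L',
    Nat.cast_mul, ← mul_assoc, norm_mul, norm_mul _ (Module.finrank L L' : ℚ_[ℓ]), mul_comm] at h1
  exact le_of_mul_le_mul_right h1 (norm_pos_iff.2 hd)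

/-- Norms from `L'` are among the norms from `L`, and the bound does not change because `[L' : L]`
is an `ℓ`-adic unit. -/
theorem LogNormBounded.tower (h : LogNormBounded ℓ L) (hd : ¬ ℓ ∣ Module.finrank L L') :
    LogNormBounded ℓ L' := by
  intro x hx
  have h1 := h _ (Algebra.norm_ne_zero_iff.2 hx : Algebra.norm L x ≠ 0)
  have h2 : ‖(Module.finrank L L' : ℚ_[ℓ])‖ = 1 := Padic.norm_natCast_eq_one_iff.2
    ((Fact.out : ℓ.Prime).coprime_iff_not_dvd.2 hd)
  rw [← Algebra.norm_norm (S := L), ← Module.finrank_mul_finrank ℚ_[ℓ] L L', Nat.cast_mul,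
    ← mul_assoc, norm_mul, h2, mul_one]
  exact h1

end Transfer

/-! ### Limits of automorphisms and their action on roots of unity -/

section ClusterPoint

variable {K Ω : Type*} [Field K] [Field Ω] [Algebra K Ω]

/-- The Galois group is compact and stabilizers of elements are open, so a cluster point agrees
infinitely often with the sequence on any given element. -/
theorem exists_frequently_eq [IsGalois K Ω] (σ : ℕ → Gal(Ω/K)) :
    ∃ τ : Gal(Ω/K), ∀ x : Ω, ∃ᶠ j in Filter.atTop, τ x = σ j x := by
  obtain ⟨τ, hτ⟩ := exists_clusterPt_of_compactSpace (Filter.map σ Filter.atTop)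
  refine ⟨τ, fun x => ?_⟩
  have hopen : IsOpen (MulAction.stabilizer Gal(Ω/K) x : Set Gal(Ω/K)) :=
    stabilizer_isOpen_of_isIntegral x
  have hnhds : (fun ρ => τ⁻¹ * ρ) ⁻¹' (MulAction.stabilizer Gal(Ω/K) x : Set Gal(Ω/K)) ∈ nhds τ :=
    (hopen.preimage (continuous_const_mul τ⁻¹)).mem_nhds (by simp)
  have := hτ.frequently (p := fun ρ => τ x = ρ x) ?_
  · exact Filter.frequently_map.1 this
  · filter_upwards [hnhds] with ρ hρ
    have h1 : τ⁻¹ (ρ x) = x := hρ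
    rw [← h1]
    exact AlgEquiv.apply_symm_apply τ (ρ x) |>.trans (by rw [h1])

theorem prime_pow_stable {q : ℕ} (hq : q.Prime) {n j : ℕ} (hj : n ≤ j) (a : ℕ) (ha : a.Coprime q) :
    a ^ (q ^ j * (q - 1)) ≡ 1 [MOD q ^ n] := by
  have h1 : a.Coprime (q ^ (j + 1)) := Nat.Coprime.pow_right _ ha
  have h2 := Nat.ModEq.pow_totient h1
  rw [Nat.totient_prime_pow_succ hq] at h2
  exact h2.of_dvd (pow_dvd_pow _ (by omega))

theorem aut_pow_apply_root [IsAlgClosed Ω] [CharZero Ω] {q : ℕ} (hq : q.Prime) (σ : Gal(Ω/K)) {n j : ℕ}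
    (hj : n ≤ j) {ζ : Ω} (hζ : ζ ^ q ^ n = 1) : (σ ^ (q ^ j * (q - 1))) ζ = ζ := by
  have hne : NeZero (q ^ n) := ⟨pow_ne_zero _ hq.ne_zero⟩
  have hne' : NeZero ((q ^ n : ℕ) : Ω) := NeZero.charZero
  obtain ⟨η, hη⟩ := HasEnoughRootsOfUnity.exists_primitiveRoot Ω (q ^ n)
  have hση : IsPrimitiveRoot (σ η) (q ^ n) := hη.map_of_injective σ.injective
  rcases n with _ | n
  · rw [pow_zero, pow_one] at hζ; rw [hζ, map_one]
  obtain ⟨a, -, ha, hση'⟩ := hη.isPrimitiveRoot_iff.1 hση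
  have hpow : ∀ k : ℕ, (σ ^ k) η = η ^ a ^ k := by
    intro k
    induction k with
    | zero => simp
    | succ k ih => rw [pow_succ', AlgEquiv.mul_apply, ih, map_pow, ← hση', ← pow_mul, ← pow_succ']
  obtain ⟨i, -, rfl⟩ := hη.eq_pow_of_pow_eq_one hζ
  have ha' : a.Coprime q := (Nat.coprime_pow_right_iff (Nat.succ_pos n) _ _).1 ha
  rw [map_pow, hpow]
  congr 1
  have := prime_pow_stable hq hj a ha'
  rw [hη.eq_orderOf] at this
  rw [← pow_mod_orderOf, this, pow_mod_orderOf, pow_one]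

end ClusterPoint

/-! ### Automorphisms acting on the cyclotomic `ℤ_q`-extension -/

section CyclotomicTower

variable {K Ω : Type*} [Field K] [Field Ω] [Algebra K Ω]

theorem algEquiv_eq_of_adjoin {S : Set Ω} {σ τ : Gal(Ω/K)} (h : ∀ s ∈ S, σ s = τ s) {x : Ω}
    (hx : x ∈ IntermediateField.adjoin K S) : σ x = τ x := by
  induction hx using IntermediateField.adjoin_induction with
  | mem x hx => exact h x hx
  | algebraMap x => rw [AlgEquiv.commutes, AlgEquiv.commutes]
  | add x y _ _ hx hy => rw [map_add, map_add, hx, hy]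
  | inv x _ hx => rw [map_inv₀, map_inv₀, hx]
  | mul x y _ _ hx hy => rw [map_mul, map_mul, hx, hy]

theorem normal_adjoinRootsOfUnity [Normal K Ω] (q : ℕ) : Normal K (adjoinRootsOfUnity K Ω q) := by
  rw [IntermediateField.normal_iff_forall_map_le']
  intro σ
  rw [adjoinRootsOfUnity, IntermediateField.adjoin_map]
  refine IntermediateField.adjoin.mono _ _ _ ?_
  rintro _ ⟨ζ, ⟨n, hn⟩, rfl⟩
  refine ⟨n, ?_⟩
  rw [← map_pow, hn, map_one]

theorem cyclotomicZqExtension_le (q : ℕ) :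
    cyclotomicZqExtension K Ω q ≤ adjoinRootsOfUnity K Ω q := IntermediateField.lift_le _

/-- An automorphism which has finite order on the `q`-power roots of unity fixes the cyclotomic
`ℤ_q`-extension. -/
theorem apply_eq_of_mem_cyclotomicZqExtension [Normal K Ω] {q : ℕ} {x : Ω}
    (hx : x ∈ cyclotomicZqExtension K Ω q) (τ : Gal(Ω/K)) {k : ℕ} (hk : 0 < k)
    (hτ : ∀ (ζ : Ω) (n : ℕ), ζ ^ q ^ n = 1 → (τ ^ k) ζ = ζ) : τ x = x := by
  have := normal_adjoinRootsOfUnity (K := K) (Ω := Ω) q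
  obtain ⟨y, rfl⟩ : ∃ y : adjoinRootsOfUnity K Ω q, (y : Ω) = x :=
    ⟨⟨x, cyclotomicZqExtension_le q hx⟩, rfl⟩
  rw [cyclotomicZqExtension, IntermediateField.mem_lift] at hx
  have h1 : IsOfFinOrder (AlgEquiv.restrictNormalHom (adjoinRootsOfUnity K Ω q) τ) := by
    refine isOfFinOrder_iff_pow_eq_one.2 ⟨k, hk, ?_⟩
    rw [← map_pow]
    ext z
    rw [AlgEquiv.restrictNormalHom_apply]
    refine algEquiv_eq_of_adjoin (σ := τ ^ k) (τ := 1) ?_ z.2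
    rintro ζ ⟨n, hn⟩
    exact hτ ζ n hn
  have h2 := hx ⟨_, Subgroup.subset_closure h1⟩
  have h3 := congrArg (Subtype.val) h2
  exact (AlgEquiv.restrictNormalHom_apply (adjoinRootsOfUnity K Ω q) τ y).symm.trans h3

theorem exists_mem_adjoin_of_mem_adjoinRootsOfUnity {q : ℕ} {x : Ω}
    (hx : x ∈ adjoinRootsOfUnity K Ω q) :
    ∃ n : ℕ, x ∈ IntermediateField.adjoin K {ζ : Ω | ζ ^ q ^ n = 1} := by
  obtain ⟨T, hT, hxT⟩ := IntermediateField.exists_finset_of_mem_adjoin hx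
  choose! f hf using hT
  refine ⟨T.sup f, IntermediateField.adjoin.mono _ _ _ ?_ hxT⟩
  intro ζ hζ
  obtain ⟨c, hc⟩ := pow_dvd_pow q (Finset.le_sup (f := f) hζ)
  rw [Set.mem_ofPred_eq, hc, pow_mul, hf hζ, one_pow]

/-- Each element of the cyclotomic `ℤ_q`-extension is fixed by a common `q`-power of the
automorphisms. -/
theorem exists_pow_apply_eq [IsGalois K Ω] [IsAlgClosed Ω] [CharZero Ω] {q : ℕ} (hq : q.Prime)
    {x : Ω} (hx : x ∈ cyclotomicZqExtension K Ω q) :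
    ∃ n : ℕ, ∀ σ : Gal(Ω/K), (σ ^ q ^ n) x = x := by
  obtain ⟨n, hn⟩ := exists_mem_adjoin_of_mem_adjoinRootsOfUnity (cyclotomicZqExtension_le q hx)
  refine ⟨n, fun σ => ?_⟩
  -- If `σ` raises `q`-power roots of unity to a power `a`, then `τ` acts by the limit of `a ^ q ^
  -- j`, a Teichmüller representative. So `τ ^ (q - 1)` is trivial on these roots and `τ` fixes `x`,
  -- while on the roots of order dividing `q ^ n` it already agrees with `σ ^ q ^ n`.
  obtain ⟨τ, hτ⟩ := exists_frequently_eq fun j => σ ^ q ^ j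
  have hstable : ∀ (n : ℕ) (ζ : Ω), ζ ^ q ^ n = 1 → τ ζ = (σ ^ q ^ n) ζ := by
    intro n ζ hζ
    have h1 : ∀ j, n ≤ j → (σ ^ q ^ j) ζ = (σ ^ q ^ n) ζ := by
      intro j hj
      induction j, hj using Nat.le_induction with
      | base => rfl
      | succ j hj ih =>
        have h2 : q ^ (j + 1) = q ^ j + q ^ j * (q - 1) := by
          obtain ⟨r, rfl⟩ := Nat.exists_eq_add_of_lt hq.one_lt
          rw [show 1 + r + 1 - 1 = r + 1 by omega]; ring
        rw [h2, pow_add, AlgEquiv.mul_apply, aut_pow_apply_root hq σ hj hζ, ih]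
    obtain ⟨j, hj1, hj2⟩ := ((hτ ζ).and_eventually (Filter.eventually_ge_atTop n)).exists
    rw [hj1, h1 j hj2]
  have hτx : τ x = x := by
    refine apply_eq_of_mem_cyclotomicZqExtension hx τ (Nat.sub_pos_of_lt hq.one_lt) ?_
    intro ζ n hζ
    have h3 : ∀ k : ℕ, ∀ ζ : Ω, ζ ^ q ^ n = 1 → (τ ^ k) ζ = (σ ^ (q ^ n * k)) ζ := by
      intro k
      induction k with
      | zero => simp
      | succ k ih =>
        intro ζ hζ
        rw [pow_succ, AlgEquiv.mul_apply, hstable n ζ hζ, ih _ (by rw [← map_pow, hζ, map_one]),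
          mul_add, mul_one, pow_add, AlgEquiv.mul_apply]
    rw [h3 _ ζ hζ, aut_pow_apply_root hq σ le_rfl hζ]
  rw [← algEquiv_eq_of_adjoin (σ := τ) (fun ζ hζ => hstable n ζ hζ) hn, hτx]

/-- A compatible system of primitive `ℓ`-power roots of unity. -/
theorem exists_primitive_root_system (Ω : Type*) [Field Ω] [IsAlgClosed Ω] [CharZero Ω] {ℓ : ℕ}
    (hℓ : ℓ.Prime) :
    ∃ ζ : ℕ → Ω, (∀ m, IsPrimitiveRoot (ζ m) (ℓ ^ (m + 1))) ∧ ∀ m, ζ (m + 1) ^ ℓ = ζ m := by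
  have hne : NeZero ℓ := ⟨hℓ.ne_zero⟩
  have hne' : NeZero (ℓ : Ω) := NeZero.charZero
  have hfact : Fact ℓ.Prime := ⟨hℓ⟩
  obtain ⟨η, hη⟩ := HasEnoughRootsOfUnity.exists_primitiveRoot Ω ℓ
  choose f hf using fun x : Ω => IsAlgClosed.exists_pow_nat_eq x hℓ.pos
  set ζ : ℕ → Ω := fun m => Nat.rec η (fun _ x => f x) m with hζ
  have hstep : ∀ m, ζ (m + 1) ^ ℓ = ζ m := fun m => hf _
  have hpow : ∀ m, ζ m ^ ℓ ^ m = η := by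
    intro m
    induction m with
    | zero => simp [hζ]
    | succ m ih => rw [pow_succ', pow_mul, hstep, ih]
  refine ⟨ζ, fun m => ?_, hstep⟩
  rw [IsPrimitiveRoot.iff_orderOf]
  refine orderOf_eq_prime_pow ?_ ?_
  · rw [hpow]; exact hη.ne_one hℓ.one_lt
  · rw [pow_succ, pow_mul, hpow, hη.pow_eq_one]

theorem adjoin_roots_eq {ζ : Ω} {N : ℕ} [NeZero N] (hζ : IsPrimitiveRoot ζ N) :
    IntermediateField.adjoin K {η : Ω | η ^ N = 1} = IntermediateField.adjoin K {ζ} := by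
  apply le_antisymm
  · rw [IntermediateField.adjoin_le_iff]
    intro η hη
    obtain ⟨i, -, rfl⟩ := hζ.eq_pow_of_pow_eq_one hη
    exact pow_mem (IntermediateField.mem_adjoin_simple_self K ζ) i
  · rw [IntermediateField.adjoin_simple_le_iff]
    exact IntermediateField.subset_adjoin _ _ hζ.pow_eq_one

end CyclotomicTower

end LogClass

namespace LogClass

/-! ### The bounded tower containing the cyclotomic `ℤ_ℓ`-extension -/

section LocalTower

open Polynomial

variable {ℓ : ℕ} [Fact ℓ.Prime] {Ω : Type*} [Field Ω] [Algebra ℚ_[ℓ] Ω]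

theorem mem_adjoin_of_mem_cyclotomicZqExtension {ζ : ℕ → Ω}
    (hζ : ∀ m, IsPrimitiveRoot (ζ m) (ℓ ^ (m + 1))) {x : Ω}
    (hx : x ∈ cyclotomicZqExtension ℚ_[ℓ] Ω ℓ) :
    ∃ m₀, ∀ m, m₀ ≤ m → x ∈ IntermediateField.adjoin ℚ_[ℓ] {ζ m} := by
  obtain ⟨n, hn⟩ := exists_mem_adjoin_of_mem_adjoinRootsOfUnity (cyclotomicZqExtension_le ℓ hx)
  refine ⟨n, fun m hm => ?_⟩
  have : NeZero (ℓ ^ (m + 1)) := ⟨pow_ne_zero _ (Fact.out : ℓ.Prime).ne_zero⟩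
  rw [← adjoin_roots_eq (hζ m)]
  refine IntermediateField.adjoin.mono _ _ _ ?_ hn
  intro η hη
  obtain ⟨c, hc⟩ := pow_dvd_pow ℓ (hm.trans (Nat.le_succ m))
  rw [Set.mem_ofPred_eq] at hη ⊢
  rw [hc, pow_mul, hη, one_pow]

variable [IsAlgClosed Ω]

theorem isGalois_of_isAlgClosed [Algebra.IsAlgebraic ℚ_[ℓ] Ω] : IsGalois ℚ_[ℓ] Ω := by
  have : IsAlgClosure ℚ_[ℓ] Ω := ⟨inferInstance, inferInstance⟩
  have : Normal ℚ_[ℓ] Ω := IsAlgClosure.normal ℚ_[ℓ] Ω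
  exact ⟨⟩

/-- At each finite level inversion is realized because the shifted cyclotomic polynomial is
Eisenstein, hence irreducible, over `ℚ_ℓ`. A cluster point realizes all levels at once. -/
theorem exists_inversion [Algebra.IsAlgebraic ℚ_[ℓ] Ω] :
    ∃ c : Gal(Ω/ℚ_[ℓ]), ∀ (η : Ω) (n : ℕ), η ^ ℓ ^ n = 1 → c η = η⁻¹ := by
  have hchar : CharZero Ω := charZero_of_injective_algebraMap (algebraMap ℚ_[ℓ] Ω).injective
  have hgal : IsGalois ℚ_[ℓ] Ω := isGalois_of_isAlgClosed
  obtain ⟨ζ, hζ, -⟩ := exists_primitive_root_system Ω (Fact.out : ℓ.Prime)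
  have hconj : ∀ m, ∃ σ : Gal(Ω/ℚ_[ℓ]), σ (ζ m) = (ζ m)⁻¹ := by
    intro m
    have hroot : ∀ η : Ω, IsPrimitiveRoot η (ℓ ^ (m + 1)) →
        aeval (η - 1) ((((cyclotomic (ℓ ^ (m + 1)) ℤ).comp (X + 1)).map
          (Int.castRingHom ℤ_[ℓ])).map (algebraMap ℤ_[ℓ] ℚ_[ℓ])) = 0 := by
      intro η hη
      have hne : NeZero (ℓ ^ (m + 1)) := ⟨pow_ne_zero _ (Fact.out : ℓ.Prime).ne_zero⟩
      have h0 : NeZero ((ℓ ^ (m + 1) : ℕ) : Ω) := NeZero.charZero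
      have hP := (isPrimeEisenstein_cyclotomic (ℓ := ℓ) m).monic.map (algebraMap ℤ_[ℓ] ℚ_[ℓ])
      refine (mem_aroots.1 (?_ : η - 1 ∈ Polynomial.aroots _ Ω)).2
      rw [cyclotomic_aroots, Multiset.mem_map]
      exact ⟨η, (mem_primitiveRoots (NeZero.pos _)).2 hη, rfl⟩
    have hirr := (isPrimeEisenstein_cyclotomic (ℓ := ℓ) m).irreducible_map
    have hmon := (isPrimeEisenstein_cyclotomic (ℓ := ℓ) m).monic.map (algebraMap ℤ_[ℓ] ℚ_[ℓ])
    have hmin := minpoly.eq_of_irreducible_of_monic hirr (hroot _ (hζ m).inv) hmon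
    obtain ⟨σ, hσ⟩ := minpoly.exists_algEquiv_of_root (K := ℚ_[ℓ]) (x := ζ m - 1)
      (y := (ζ m)⁻¹ - 1) (Algebra.IsAlgebraic.isAlgebraic _)
      (by rw [← hmin]; exact hroot _ (hζ m))
    refine ⟨σ, ?_⟩
    rw [map_sub, map_one] at hσ
    exact sub_left_injective hσ
  choose σ hσ using hconj
  obtain ⟨τ, hτ⟩ := exists_frequently_eq σ
  refine ⟨τ, fun η n hη => ?_⟩
  obtain ⟨m, hm1, hm2⟩ := ((hτ η).and_eventually (Filter.eventually_ge_atTop n)).exists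
  have hne : NeZero (ℓ ^ (m + 1)) := ⟨pow_ne_zero _ (Fact.out : ℓ.Prime).ne_zero⟩
  obtain ⟨c, hc⟩ := pow_dvd_pow ℓ (hm2.trans (Nat.le_succ m))
  obtain ⟨i, -, rfl⟩ := (hζ m).eq_pow_of_pow_eq_one (ξ := η) (by rw [hc, pow_mul, hη, one_pow])
  rw [hm1, map_pow, hσ, inv_pow]

/-- Every element of `K(ζ)` is `a + b ζ` with `a`, `b` in `K(ζ + ζ⁻¹)`, and being fixed by `ζ ↦ ζ⁻¹`
forces `b = 0`. -/
theorem mem_adjoin_add_inv {K Ω : Type*} [Field K] [Field Ω] [Algebra K Ω] {ζ : Ω} (hζ0 : ζ ≠ 0)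
    (hζ : ζ ≠ ζ⁻¹) {c : Gal(Ω/K)} (hc : c ζ = ζ⁻¹) {x : Ω} (hint : IsIntegral K ζ)
    (hx : x ∈ IntermediateField.adjoin K {ζ}) (hcx : c x = x) :
    x ∈ IntermediateField.adjoin K {ζ + ζ⁻¹} := by
  set T := IntermediateField.adjoin K {ζ + ζ⁻¹} with hT
  have ht : ζ + ζ⁻¹ ∈ T := IntermediateField.mem_adjoin_simple_self _ _
  have hsq : ζ ^ 2 = (ζ + ζ⁻¹) * ζ - 1 := by field_simp; ring
  have hrep : ∃ a ∈ T, ∃ b ∈ T, x = a + b * ζ := by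
    clear hcx
    rw [← IntermediateField.mem_toSubalgebra,
      IntermediateField.adjoin_simple_toSubalgebra_of_isAlgebraic hint.isAlgebraic] at hx
    induction hx using Algebra.adjoin_induction with
    | mem y hy =>
      rw [Set.mem_singleton_iff] at hy
      exact ⟨0, zero_mem _, 1, one_mem _, by rw [hy]; ring⟩
    | algebraMap r => exact ⟨algebraMap K Ω r, T.algebraMap_mem r, 0, zero_mem _, by ring⟩
    | add y z _ _ hy hz =>
      obtain ⟨a, ha, b, hb, rfl⟩ := hy
      obtain ⟨a', ha', b', hb', rfl⟩ := hz
      exact ⟨a + a', add_mem ha ha', b + b', add_mem hb hb', by ring⟩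
    | mul y z _ _ hy hz =>
      obtain ⟨a, ha, b, hb, rfl⟩ := hy
      obtain ⟨a', ha', b', hb', rfl⟩ := hz
      refine ⟨a * a' - b * b', sub_mem (mul_mem ha ha') (mul_mem hb hb'),
        a * b' + b * a' + b * b' * (ζ + ζ⁻¹), add_mem (add_mem (mul_mem ha hb') (mul_mem hb ha'))
          (mul_mem (mul_mem hb hb') ht), ?_⟩
      linear_combination b * b' * hsq
  obtain ⟨a, ha, b, hb, rfl⟩ := hrep
  have hfix : ∀ y ∈ T, c y = y := by
    intro y hy
    refine algEquiv_eq_of_adjoin (σ := c) (τ := 1) ?_ hy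
    rintro _ rfl
    rw [map_add, map_inv₀, hc, inv_inv, add_comm, AlgEquiv.one_apply]
  rw [map_add, map_mul, hfix a ha, hfix b hb, hc, add_right_inj] at hcx
  have hb0 : b = 0 := by
    by_contra hb0
    exact hζ (mul_left_cancel₀ hb0 hcx).symm
  rw [hb0, zero_mul, add_zero]
  exact ha

theorem exists_bounded_tower [Algebra.IsAlgebraic ℚ_[ℓ] Ω] :
    ∃ L : ℕ → IntermediateField ℚ_[ℓ] Ω, Monotone L ∧ (∀ m, FiniteDimensional ℚ_[ℓ] (L m)) ∧
      (∀ m, LogNormBounded ℓ (L m)) ∧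
      ∀ x ∈ cyclotomicZqExtension ℚ_[ℓ] Ω ℓ, ∃ m, x ∈ L m := by
  have hchar : CharZero Ω := charZero_of_injective_algebraMap (algebraMap ℚ_[ℓ] Ω).injective
  have hgal : IsGalois ℚ_[ℓ] Ω := isGalois_of_isAlgClosed
  obtain ⟨ζ, hζ, hstep⟩ := exists_primitive_root_system Ω (Fact.out : ℓ.Prime)
  -- For `ℓ = 2` the full cyclotomic fields are not bounded: `2 + i` has norm `5`, and `Log 5` is
  -- not divisible by `4 · 2`. Inversion has finite order, so the `ℤ_2`-extension lies in the
  -- subfields generated by `ζ + ζ⁻¹`, which are bounded.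
  by_cases hℓ : ℓ = 2
  · subst hℓ
    set t : ℕ → Ω := fun m => ζ m + (ζ m)⁻¹ with ht
    have hζ0 : ∀ m, ζ m ≠ 0 := fun m => (hζ m).ne_zero (pow_ne_zero _ two_ne_zero)
    have htstep : ∀ m, t (m + 1) ^ 2 - 2 = t m := by
      intro m
      have := hζ0 (m + 1)
      rw [ht]
      simp only [← hstep m]
      field_simp
      ring
    have htroot : ∀ m, (doublingPoly Ω m).eval (t (m + 1)) = 0 := by
      intro m
      induction m with
      | zero =>
        have h1 : ζ 0 = -1 := (IsPrimitiveRoot.eq_neg_one_of_two_right (by simpa using hζ 0))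
        have h2 := htstep 0
        simp only [ht, h1] at h2
        norm_num at h2
        simpa [doublingPoly, ht] using h2
      | succ m ih => simpa [doublingPoly, htstep] using ih
    -- The shift is due to `t 0 = -2` and `t 1 = 0`: the first nontrivial member is generated by `t
    -- 2`, a root of `X ^ 2 - 2`.
    refine ⟨fun m => IntermediateField.adjoin ℚ_[2] {t (m + 2)}, monotone_nat_of_le_succ ?_, ?_, ?_,
      ?_⟩
    · intro m
      rw [IntermediateField.adjoin_simple_le_iff, ← htstep (m + 2)]
      exact sub_mem (pow_mem (IntermediateField.mem_adjoin_simple_self _ _) 2) (ofNat_mem _ 2)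
    · exact fun m => IntermediateField.adjoin.finiteDimensional (Algebra.IsIntegral.isIntegral _)
    · exact fun m => logNormBounded_doublingPoly m (htroot (m + 1))
    · intro x hx
      obtain ⟨m₀, hm⟩ := mem_adjoin_of_mem_cyclotomicZqExtension hζ hx
      obtain ⟨c, hc⟩ := exists_inversion (ℓ := 2) (Ω := Ω)
      have hcζ : ∀ m, c (ζ m) = (ζ m)⁻¹ := fun m => hc _ (m + 1) (hζ m).pow_eq_one
      have hcx : c x = x := by
        refine apply_eq_of_mem_cyclotomicZqExtension hx c two_pos fun η n hη => ?_
        rw [pow_two, AlgEquiv.mul_apply, hc η n hη, map_inv₀, hc η n hη, inv_inv]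
      refine ⟨m₀, mem_adjoin_add_inv (hζ0 _) ?_ (hcζ _) (Algebra.IsIntegral.isIntegral _)
        (hm (m₀ + 2) (by omega)) hcx⟩
      intro h
      have h1 : ζ (m₀ + 2) ^ 2 = 1 := by
        rw [pow_two]; nth_rewrite 2 [h]; exact mul_inv_cancel₀ (hζ0 _)
      have h2 := (hζ (m₀ + 2)).dvd_of_pow_eq_one _ h1
      have h3 : 2 ^ 2 ∣ 2 ^ (m₀ + 2 + 1) := pow_dvd_pow 2 (by omega)
      exact absurd (Nat.le_of_dvd two_pos (h3.trans h2)) (by norm_num)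
  · refine ⟨fun m => IntermediateField.adjoin ℚ_[ℓ] {ζ m}, monotone_nat_of_le_succ ?_, ?_, ?_, ?_⟩
    · intro m
      rw [IntermediateField.adjoin_simple_le_iff, ← hstep m]
      exact pow_mem (IntermediateField.mem_adjoin_simple_self _ _) ℓ
    · exact fun m => IntermediateField.adjoin.finiteDimensional (Algebra.IsIntegral.isIntegral _)
    · exact fun m => logNormBounded_cyclotomic hℓ m (hζ m)
    · intro x hx
      obtain ⟨m, hm⟩ := mem_adjoin_of_mem_cyclotomicZqExtension hζ hx
      exact ⟨m, hm m le_rfl⟩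

end LocalTower

end LogClass

namespace LogClass

/-! ### Divisibility of the logarithm of a local norm -/

section LocalBound

open Polynomial IntermediateField

theorem algEquiv_pow_apply_eq {K Ω : Type*} [Field K] [Field Ω] [Algebra K Ω] {σ : Gal(Ω/K)} {x : Ω}
    (h : σ x = x) (k : ℕ) : (σ ^ k) x = x := by
  induction k with
  | zero => simp
  | succ k ih => rw [pow_succ, AlgEquiv.mul_apply, h, ih]

theorem restrictScalars_pow_apply {K L Ω : Type*} [Field K] [Field L] [Field Ω] [Algebra K L]
    [Algebra K Ω] [Algebra L Ω] [IsScalarTower K L Ω] (σ : Gal(Ω/L)) (k : ℕ) (x : Ω) :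
    ((σ.restrictScalars K : Gal(Ω/K)) ^ k) x = (σ ^ k) x := by
  induction k generalizing x with
  | zero => simp
  | succ k ih =>
    rw [pow_succ, pow_succ, AlgEquiv.mul_apply, AlgEquiv.mul_apply, ih, AlgEquiv.restrictScalars_apply]

/-- The elements fixed, for some `m` and some `d` prime to `ℓ`, by the `d`-th powers of all
automorphisms over `L m`. -/
def primeToFixed {K Ω : Type*} [Field K] [Field Ω] [Algebra K Ω] {L : ℕ → IntermediateField K Ω}
    (hL : Monotone L) {ℓ : ℕ} (hℓ : ℓ.Prime) : IntermediateField K Ω where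
  carrier := {x | ∃ m d : ℕ, ¬ ℓ ∣ d ∧ ∀ σ : Gal(Ω/K), (∀ y ∈ L m, σ y = y) → (σ ^ d) x = x}
  algebraMap_mem' r := ⟨0, 1, hℓ.not_dvd_one, fun σ _ => AlgEquiv.commutes _ r⟩
  add_mem' := by
    rintro x y ⟨m, d, hd, hx⟩ ⟨m', d', hd', hy⟩
    refine ⟨max m m', d * d', fun h => (hℓ.dvd_mul.1 h).elim hd hd', fun σ hσ => ?_⟩
    have hx' := hx σ fun z hz => hσ z (hL (le_max_left m m') hz)
    have hy' := hy σ fun z hz => hσ z (hL (le_max_right m m') hz)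
    have h1 : ∀ k : ℕ, ((σ ^ d) ^ k) x = x := fun k => algEquiv_pow_apply_eq hx' k
    have h2 : ∀ k : ℕ, ((σ ^ d') ^ k) y = y := fun k => algEquiv_pow_apply_eq hy' k
    rw [map_add, pow_mul, h1, ← pow_mul, mul_comm, pow_mul, h2]
  mul_mem' := by
    rintro x y ⟨m, d, hd, hx⟩ ⟨m', d', hd', hy⟩
    refine ⟨max m m', d * d', fun h => (hℓ.dvd_mul.1 h).elim hd hd', fun σ hσ => ?_⟩
    have hx' := hx σ fun z hz => hσ z (hL (le_max_left m m') hz)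
    have hy' := hy σ fun z hz => hσ z (hL (le_max_right m m') hz)
    have h1 : ∀ k : ℕ, ((σ ^ d) ^ k) x = x := fun k => algEquiv_pow_apply_eq hx' k
    have h2 : ∀ k : ℕ, ((σ ^ d') ^ k) y = y := fun k => algEquiv_pow_apply_eq hy' k
    rw [map_mul, pow_mul, h1, ← pow_mul, mul_comm d, pow_mul, h2]
  inv_mem' := by
    rintro x ⟨m, d, hd, hx⟩
    exact ⟨m, d, hd, fun σ hσ => by rw [map_inv₀, hx σ hσ]⟩

variable {ℓ : ℕ} [Fact ℓ.Prime] {Ω : Type*} [Field Ω] [Algebra ℚ_[ℓ] Ω] [IsAlgClosed Ω]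
  [Algebra.IsAlgebraic ℚ_[ℓ] Ω]

/-- Over `L`, an element fixed by the `d`-th powers of all automorphisms, with `d` prime to `ℓ`,
lies in an extension of degree prime to `ℓ`. -/
theorem exists_finrank_not_dvd {L Ω : Type*} [Field L] [Field Ω] [Algebra L Ω] [IsAlgClosed Ω]
    [Algebra.IsAlgebraic L Ω] [CharZero L] {ℓ : ℕ} (hℓ : ℓ.Prime) {x : Ω} {d : ℕ} (hd : ¬ ℓ ∣ d)
    (h : ∀ σ : Gal(Ω/L), (σ ^ d) x = x) :
    ∃ N : IntermediateField L Ω, FiniteDimensional L N ∧ x ∈ N ∧ ¬ ℓ ∣ Module.finrank L N := by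
  have hint : IsIntegral L x := Algebra.IsIntegral.isIntegral x
  have hclosure : IsAlgClosure L Ω := ⟨inferInstance, inferInstance⟩
  have hnormal : Normal L Ω := IsAlgClosure.normal L Ω
  set p := minpoly L x with hp
  set N := IntermediateField.adjoin L (p.rootSet Ω) with hN
  have hsplit : p.IsSplittingField L N :=
    IntermediateField.adjoin_rootSet_isSplittingField (IsAlgClosed.splits _)
  have hgal : IsGalois L N := IsGalois.of_separable_splitting_field (minpoly.irreducible hint).separable
  have hfd : FiniteDimensional L N := IsSplittingField.finiteDimensional N p
  refine ⟨N, hfd, IntermediateField.subset_adjoin _ _ ?_, fun hdvd => ?_⟩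
  · rw [mem_rootSet]
    exact ⟨minpoly.ne_zero hint, minpoly.aeval L x⟩
  · rw [← IsGalois.card_aut_eq_finrank L N] at hdvd
    have : Fact ℓ.Prime := ⟨hℓ⟩
    -- If `ℓ` divided the degree, Cauchy would give an element of order `ℓ`. Its `d`-th power is
    -- trivial, since the hypothesis applied to conjugates of `σ` makes `σ ^ d` fix every conjugate
    -- of `x`; this forces `ℓ ∣ d`.
    obtain ⟨τ, hτ⟩ := exists_prime_orderOf_dvd_card' ℓ hdvd
    obtain ⟨σ, rfl⟩ := AlgEquiv.restrictNormalHom_surjective (F := L) (K₁ := N) Ω τ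
    refine hd (hτ ▸ orderOf_dvd_of_pow_eq_one ?_)
    rw [← map_pow]
    ext z
    rw [AlgEquiv.restrictNormalHom_apply]
    refine algEquiv_eq_of_adjoin (σ := σ ^ d) (τ := 1) (fun y hy => ?_) z.2
    obtain ⟨ρ, rfl⟩ := minpoly.exists_algEquiv_of_root' (K := L) (x := y) (y := x)
      hint.isAlgebraic ((mem_rootSet.1 hy).2)
    have h1 := h (ρ⁻¹ * σ * ρ)
    have h2 : (ρ⁻¹ * σ * ρ) ^ d = ρ⁻¹ * σ ^ d * ρ := by
      have := conj_pow (i := d) (a := ρ⁻¹) (b := σ)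
      rwa [inv_inv] at this
    rw [h2, AlgEquiv.mul_apply, AlgEquiv.mul_apply] at h1
    have h3 := congrArg ρ h1
    rwa [← AlgEquiv.mul_apply, mul_inv_cancel, AlgEquiv.one_apply] at h3

/-- The `ℤ_ℓ`-part is absorbed by the tower with `d = 1`; for `q ≠ ℓ` an element of the `ℤ_q`-part
is fixed by all `q ^ n`-th powers, and `q ^ n` is prime to `ℓ`. -/
theorem cyclotomicZHatExtension_le_primeToFixed {L : ℕ → IntermediateField ℚ_[ℓ] Ω}
    (hL : Monotone L) (hmem : ∀ x ∈ cyclotomicZqExtension ℚ_[ℓ] Ω ℓ, ∃ m, x ∈ L m) :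
    cyclotomicZHatExtension ℚ_[ℓ] Ω ≤ primeToFixed hL (Fact.out : ℓ.Prime) := by
  have hchar : CharZero Ω := charZero_of_injective_algebraMap (algebraMap ℚ_[ℓ] Ω).injective
  have hgal : IsGalois ℚ_[ℓ] Ω := isGalois_of_isAlgClosed
  refine iSup_le fun q x hx => ?_
  by_cases hq : (q : ℕ) = ℓ
  · rw [hq] at hx
    obtain ⟨m, hm⟩ := hmem x hx
    exact ⟨m, 1, (Fact.out : ℓ.Prime).not_dvd_one, fun σ hσ => by rw [pow_one, hσ x hm]⟩
  · obtain ⟨n, hn⟩ := exists_pow_apply_eq q.2 hx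
    refine ⟨0, (q : ℕ) ^ n, fun h => hq ?_, fun σ _ => hn σ⟩
    exact ((Nat.prime_dvd_prime_iff_eq (Fact.out : ℓ.Prime) q.2).1
      ((Fact.out : ℓ.Prime).dvd_of_dvd_pow h)).symm

/-- Finite subextensions of the cyclotomic `ℤ̂`-extension of `ℚ_ℓ` have small norms. -/
theorem logNormBounded_of_le_cyclotomicZHat {M : IntermediateField ℚ_[ℓ] Ω}
    [FiniteDimensional ℚ_[ℓ] M] (hM : M ≤ cyclotomicZHatExtension ℚ_[ℓ] Ω) :
    LogNormBounded ℓ M := by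
  obtain ⟨L, hL, hfd, hbdd, hmem⟩ := exists_bounded_tower (ℓ := ℓ) (Ω := Ω)
  obtain ⟨α, hα⟩ := Field.exists_primitive_element ℚ_[ℓ] M
  obtain ⟨m, d, hd, hfix⟩ := cyclotomicZHatExtension_le_primeToFixed hL hmem (hM α.2)
  have hfdm := hfd m
  have halg : Algebra.IsAlgebraic (L m) Ω := Algebra.IsAlgebraic.tower_top (K := ℚ_[ℓ]) (L m)
  obtain ⟨N, hN, hαN, hdvd⟩ := exists_finrank_not_dvd (L := L m) (Fact.out : ℓ.Prime) hd
    (x := (α : Ω)) (fun σ => by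
      rw [← restrictScalars_pow_apply (K := ℚ_[ℓ])]
      exact hfix (σ.restrictScalars ℚ_[ℓ]) fun y hy => σ.commutes ⟨y, hy⟩)
  have hMN : M ≤ N.restrictScalars ℚ_[ℓ] := by
    have h1 : M = IntermediateField.adjoin ℚ_[ℓ] {(α : Ω)} := by
      have := congrArg (IntermediateField.lift) hα
      rw [IntermediateField.lift_adjoin_simple, IntermediateField.lift_top] at this
      exact this.symm
    rw [h1, IntermediateField.adjoin_simple_le_iff]
    exact hαN
  have hbN : LogNormBounded ℓ N := (hbdd m).tower hdvd
  let _ : Algebra M N := (IntermediateField.inclusion hMN).toRingHom.toAlgebra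
  have : IsScalarTower ℚ_[ℓ] M N := IsScalarTower.of_algebraMap_eq fun r => rfl
  have : FiniteDimensional ℚ_[ℓ] N := FiniteDimensional.trans ℚ_[ℓ] (L m) N
  have : FiniteDimensional M N := FiniteDimensional.right ℚ_[ℓ] M N
  exact hbN.of_tower

/-- The logarithm of the norm of an element of a finite extension `E` of `ℚ_ℓ` is divisible by
`deg ℓ` times the degree of the intersection of `E` with the cyclotomic `ℤ̂`-extension. -/
theorem norm_log_norm_le {E : Type*} [Field E] [Algebra ℚ_[ℓ] E] [FiniteDimensional ℚ_[ℓ] E]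
    [Algebra E Ω] [IsScalarTower ℚ_[ℓ] E Ω] {x : E} (hx : x ≠ 0) :
    ‖iwasawaLog ℓ (Algebra.norm ℚ_[ℓ] x)‖ ≤ ‖degSelf ℓ * (Module.finrank ℚ_[ℓ]
      ↥((IsScalarTower.toAlgHom ℚ_[ℓ] E Ω).fieldRange ⊓ cyclotomicZHatExtension ℚ_[ℓ] Ω) :
        ℚ_[ℓ])‖ := by
  set φ := IsScalarTower.toAlgHom ℚ_[ℓ] E Ω with hφ
  set M : IntermediateField ℚ_[ℓ] Ω := φ.fieldRange ⊓ cyclotomicZHatExtension ℚ_[ℓ] Ω with hM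
  let e : E ≃ₐ[ℚ_[ℓ]] φ.fieldRange := AlgEquiv.ofInjectiveField φ
  have hfdφ : FiniteDimensional ℚ_[ℓ] φ.fieldRange := e.toLinearEquiv.finiteDimensional
  have hfd : FiniteDimensional ℚ_[ℓ] M := FiniteDimensional.of_injective
    (IntermediateField.inclusion (inf_le_left : M ≤ φ.fieldRange)).toLinearMap
    (IntermediateField.inclusion (inf_le_left : M ≤ φ.fieldRange)).injective
  have hb : LogNormBounded ℓ M := logNormBounded_of_le_cyclotomicZHat inf_le_right
  let ψ : M →ₐ[ℚ_[ℓ]] E := (e.symm : φ.fieldRange →ₐ[ℚ_[ℓ]] E).comp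
    (IntermediateField.inclusion inf_le_left)
  let _ : Algebra M E := ψ.toRingHom.toAlgebra
  have : IsScalarTower ℚ_[ℓ] M E := IsScalarTower.of_algebraMap_eq fun r => (ψ.commutes r).symm
  have : FiniteDimensional M E := FiniteDimensional.right ℚ_[ℓ] M E
  rw [← Algebra.norm_norm (S := M)]
  exact hb _ (Algebra.norm_ne_zero_iff.2 hx)

end LocalBound

end LogClass

namespace LogClass

/-! ### Completions above `ℓ` and integrality of logarithmic valuations -/

section

variable {F : Type*} [Field F] [NumberField F] {p : ℕ} [Fact p.Prime]

theorem continuous_padicToCompletion (v : HeightOneSpectrum (𝓞 F)) (hv : (p : 𝓞 F) ∈ v.asIdeal) :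
    Continuous (padicToCompletion p v hv) :=
  (uniformContinuous_uniformly_extend Padic.isUniformInducing_cast_withVal
    Padic.isDenseInducing_cast_withVal.dense (ratToCompletion_uniformContinuous p v hv)).continuous

noncomputable instance algebraPlacesAbove (v : placesAbove F p) :
    Algebra ℚ_[p] (v.1.adicCompletion F) :=
  completionAlgebra p v.1 v.2

theorem continuous_algebraMap_placesAbove (v : placesAbove F p) :
    Continuous (algebraMap ℚ_[p] (v.1.adicCompletion F)) :=
  continuous_padicToCompletion v.1 v.2

instance continuousSMul_placesAbove (v : placesAbove F p) :
    ContinuousSMul ℚ_[p] (v.1.adicCompletion F) :=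
  continuousSMul_of_algebraMap _ _ (continuous_algebraMap_placesAbove v)

theorem algebraMap_ratCast_placesAbove (v : placesAbove F p) (q : ℚ) :
    algebraMap ℚ_[p] (v.1.adicCompletion F) (q : ℚ_[p]) =
      algebraMap F (v.1.adicCompletion F) (q : F) := by
  have h : (algebraMap ℚ_[p] (v.1.adicCompletion F)).comp (algebraMap ℚ ℚ_[p]) =
      (algebraMap F (v.1.adicCompletion F)).comp (algebraMap ℚ F) := Subsingleton.elim _ _
  have h1 := RingHom.congr_fun h q
  rw [RingHom.comp_apply, RingHom.comp_apply, eq_ratCast, eq_ratCast] at h1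
  exact h1

theorem ratCast_smul_placesAbove (v : placesAbove F p) (q : ℚ) (x : F) :
    (q : ℚ_[p]) • algebraMap F (v.1.adicCompletion F) x =
      algebraMap F (v.1.adicCompletion F) (q • x) := by
  rw [Algebra.smul_def, algebraMap_ratCast_placesAbove, ← map_mul, Algebra.smul_def]
  simp

theorem range_algebraMap_subset_span (v : placesAbove F p) :
    Set.range (algebraMap F (v.1.adicCompletion F)) ⊆
      Submodule.span ℚ_[p] (Set.range fun i =>
        algebraMap F (v.1.adicCompletion F) (Module.finBasis ℚ F i)) := by
  rintro _ ⟨x, rfl⟩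
  rw [← (Module.finBasis ℚ F).sum_repr x, map_sum]
  refine Submodule.sum_mem _ fun i _ => ?_
  rw [← ratCast_smul_placesAbove]
  exact Submodule.smul_mem _ _ (Submodule.subset_span ⟨i, rfl⟩)

instance finiteDimensional_placesAbove (v : placesAbove F p) :
    FiniteDimensional ℚ_[p] (v.1.adicCompletion F) := by
  set S : Submodule ℚ_[p] (v.1.adicCompletion F) := Submodule.span ℚ_[p] (Set.range fun i =>
        algebraMap F (v.1.adicCompletion F) (Module.finBasis ℚ F i)) with hS
  have hfin : FiniteDimensional ℚ_[p] S := FiniteDimensional.span_of_finite _ (Set.finite_range _)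
  -- A finite-dimensional subspace is closed, and this one contains the dense subfield `F`.
  have hcl : IsClosed (S : Set (v.1.adicCompletion F)) := S.closed_of_finiteDimensional
  have htop : S = ⊤ := by
    rw [← SetLike.coe_set_eq, Submodule.top_coe, Set.eq_univ_iff_forall]
    intro x
    exact closure_minimal (range_algebraMap_subset_span v) hcl
      ((v.1.denseRange_algebraMap F) x)
  rw [htop] at hfin
  exact Module.finite_def.2 ((Module.Finite.iff_fg (N := (⊤ : Submodule _ _))).1 hfin)

theorem valued_algebraMap_le_one (v : placesAbove F p) {a : ℚ_[p]} (ha : ‖a‖ ≤ 1) :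
    Valued.v (algebraMap ℚ_[p] (v.1.adicCompletion F) a) ≤ 1 := by
  have hcont : Continuous fun a : ℤ_[p] => algebraMap ℚ_[p] (v.1.adicCompletion F) (a : ℚ_[p]) :=
    (continuous_algebraMap_placesAbove v).comp continuous_subtype_val
  have h0 : IsClosed ((Valued.v : Valuation (v.1.adicCompletion F) _).integer :
      Set (v.1.adicCompletion F)) := Valued.isClosed_integer (v.1.adicCompletion F)
  have hcl := h0.preimage hcont
  have hsub : Set.range (Int.cast : ℤ → ℤ_[p]) ⊆
      (fun a : ℤ_[p] => algebraMap ℚ_[p] (v.1.adicCompletion F) (a : ℚ_[p])) ⁻¹'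
        ((Valued.v : Valuation (v.1.adicCompletion F) _).integer : Set (v.1.adicCompletion F)) := by
    rintro _ ⟨n, rfl⟩
    have h1 := v.1.valuation_le_one (K := F) (n : 𝓞 F)
    have h3 := v.1.valuedAdicCompletion_eq_valuation (K := F) (n : 𝓞 F)
    have h2 : ((n : 𝓞 F) : v.1.adicCompletion F) =
        algebraMap ℚ_[p] (v.1.adicCompletion F) ((n : ℤ_[p]) : ℚ_[p]) := by
      rw [PadicInt.coe_intCast, map_intCast]
      exact map_intCast (algebraMap (𝓞 F) (v.1.adicCompletion F)) n
    rw [Set.mem_preimage, SetLike.mem_coe, Valuation.mem_integer_iff, ← h2]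
    exact h3.trans_le h1
  have hmem := closure_minimal hsub hcl (PadicInt.denseRange_intCast (⟨a, ha⟩ : ℤ_[p]))
  exact (Valuation.mem_integer_iff _ _).1 hmem

theorem logInertiaDeg_ne_zero (v : HeightOneSpectrum (𝓞 F)) (hv : (p : 𝓞 F) ∈ v.asIdeal) :
    logInertiaDeg p v hv ≠ 0 := by
  let _ := completionAlgebra p v hv
  have hfd' : FiniteDimensional ℚ_[p] (v.adicCompletion F) :=
    finiteDimensional_placesAbove (p := p) ⟨v, hv⟩
  have h1 : FiniteDimensional ℚ_[p] (IsScalarTower.toAlgHom ℚ_[p] (v.adicCompletion F)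
      (AlgebraicClosure (v.adicCompletion F))).fieldRange :=
    (AlgEquiv.ofInjectiveField _).toLinearEquiv.finiteDimensional
  have h2 : FiniteDimensional ℚ_[p] ↥((IsScalarTower.toAlgHom ℚ_[p] (v.adicCompletion F)
      (AlgebraicClosure (v.adicCompletion F))).fieldRange ⊓
      cyclotomicZHatExtension ℚ_[p] (AlgebraicClosure (v.adicCompletion F))) :=
    FiniteDimensional.of_injective (IntermediateField.inclusion inf_le_left).toLinearMap
      fun _ _ h => (IntermediateField.inclusion (inf_le_left : _ ⊓ _ ≤ (IsScalarTower.toAlgHom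
        ℚ_[p] (v.adicCompletion F) (AlgebraicClosure (v.adicCompletion F))).fieldRange)).injective h
  exact Module.finrank_pos.ne'

/-- Away from `p` this rests on `Log` not vanishing at an integer greater than `1` and prime to `p`,
whose powers with positive exponent are never `1`. -/
theorem placeDeg_ne_zero (v : HeightOneSpectrum (𝓞 F)) : placeDeg p v ≠ 0 := by
  rw [placeDeg]
  split_ifs with h h2
  · exact mul_ne_zero (by exact_mod_cast logInertiaDeg_ne_zero v h) (by norm_num)
  · exact mul_ne_zero (by exact_mod_cast logInertiaDeg_ne_zero v h)
      (by exact_mod_cast (Fact.out : p.Prime).ne_zero)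
  · refine mul_ne_zero (by exact_mod_cast logInertiaDeg_ne_zero v _)
      (iwasawaLog_natCast_ne_zero (Fact.out : (residueChar v).Prime).one_lt fun hd => h ?_)
    have := (Nat.prime_dvd_prime_iff_eq (Fact.out : p.Prime)
      (Fact.out : (residueChar v).Prime)).1 hd
    rw [this]
    exact residueChar_mem v

theorem norm_iwasawaLog_localNorm_le (v : HeightOneSpectrum (𝓞 F)) (hv : (p : 𝓞 F) ∈ v.asIdeal)
    {x : v.adicCompletion F} (hx : x ≠ 0) :
    ‖iwasawaLog p (localNorm p v hv x)‖ ≤ ‖placeDeg p v‖ := by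
  let _ := completionAlgebra p v hv
  have hfd' : FiniteDimensional ℚ_[p] (v.adicCompletion F) :=
    finiteDimensional_placesAbove (p := p) ⟨v, hv⟩
  have halg : Algebra.IsAlgebraic ℚ_[p] (AlgebraicClosure (v.adicCompletion F)) :=
    Algebra.IsAlgebraic.trans ℚ_[p] (v.adicCompletion F) _
  have := norm_log_norm_le (ℓ := p) (Ω := AlgebraicClosure (v.adicCompletion F)) hx
  have hdeg : placeDeg p v = degSelf p * (logInertiaDeg p v hv : ℚ_[p]) := by
    rw [placeDeg, dif_pos hv, degSelf, mul_comm]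
  rw [hdeg]
  exact this

theorem norm_logVal_le_one {v : HeightOneSpectrum (𝓞 F)} (hv : (p : 𝓞 F) ∈ v.asIdeal)
    (x : Additive (v.adicCompletion F)ˣ) : ‖logVal p v x‖ ≤ 1 := by
  have h : logVal p v x =
      iwasawaLog p (localNorm p v hv (x.toMul : v.adicCompletion F)) * -(placeDeg p v)⁻¹ := by
    rw [logVal, padicAbs, dif_pos hv]
    rfl
  rw [h, norm_mul, norm_neg, norm_inv, ← div_eq_mul_inv,
    div_le_one (norm_pos_iff.2 (placeDeg_ne_zero v))]
  exact norm_iwasawaLog_localNorm_le v hv x.toMul.ne_zero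

end

end LogClass

namespace LogClass

/-! ### Norms of product algebras and under base change -/

section NormOnProducts

theorem norm_pi_eq_prod {n : ℕ} {R : Type*} [CommRing R] {S : Fin n → Type*}
    [∀ j, CommRing (S j)] [∀ j, Algebra R (S j)] {κ : Fin n → Type*} [∀ j, Fintype (κ j)]
    [∀ j, DecidableEq (κ j)] (s : ∀ j, Module.Basis (κ j) R (S j)) (x : ∀ j, S j) :
    Algebra.norm R x = ∏ j, Algebra.norm R (x j) := by
  have hentry : ∀ a b : Σ j, κ j, Algebra.leftMulMatrix (Pi.basis s) x a b =
      (s a.1).repr (x a.1 * (Pi.single b.1 (s b.1 b.2) : ∀ j, S j) a.1) a.2 := by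
    intro a b
    rw [Algebra.leftMulMatrix_eq_repr_mul, Pi.basis_repr, Pi.basis_apply]
    rfl
  have htri : (Algebra.leftMulMatrix (Pi.basis s) x).BlockTriangular Sigma.fst := by
    intro a b hab
    rw [hentry, Pi.single_eq_of_ne hab.ne', mul_zero, map_zero, Finsupp.zero_apply]
  rw [Algebra.norm_eq_matrix_det (Pi.basis s), htri.det_fintype]
  refine Finset.prod_congr rfl fun j _ => ?_
  rw [Algebra.norm_eq_matrix_det (s j)]
  let e : κ j ≃ {a : Σ j, κ j // a.1 = j} :=
    { toFun := fun i => ⟨⟨j, i⟩, rfl⟩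
      invFun := fun a => a.2 ▸ a.1.2
      left_inv := fun i => rfl
      right_inv := by rintro ⟨⟨j', i⟩, rfl⟩; rfl }
  rw [← Matrix.det_submatrix_equiv_self e]
  congr 1
  ext i i'
  rw [Matrix.submatrix_apply, Matrix.toSquareBlock_def, Matrix.of_apply, hentry,
    Algebra.leftMulMatrix_eq_repr_mul]
  change (s j).repr (x j * (Pi.single j (s j i') : ∀ j, S j) j) i = _
  rw [Pi.single_eq_same]

theorem norm_eq_of_basis_map {κ K L E A : Type*} [Fintype κ] [DecidableEq κ] [Field K] [Field L]
    [Field E] [CommRing A] [Algebra K E] [Algebra L A] (f : K →+* L) (Φ : E →+* A)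
    (hΦ : ∀ c x, Φ (algebraMap K E c * x) = f c • Φ x) (ω : Module.Basis κ K E)
    (B : Module.Basis κ L A) (hB : ∀ i, B i = Φ (ω i)) (x : E) :
    Algebra.norm L (Φ x) = f (Algebra.norm K x) := by
  have h : Algebra.leftMulMatrix B (Φ x) = (Algebra.leftMulMatrix ω x).map f := by
    ext i j
    rw [Matrix.map_apply, Algebra.leftMulMatrix_eq_repr_mul, Algebra.leftMulMatrix_eq_repr_mul,
      hB, ← map_mul]
    conv_lhs => rw [← ω.sum_repr (x * ω j), map_sum]
    have : ∀ i, Φ (ω.repr (x * ω j) i • ω i) = f (ω.repr (x * ω j) i) • B i := fun i => by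
      rw [Algebra.smul_def, hΦ, hB]
    simp_rw [this]
    exact congrFun (B.repr_sum_self _) i
  rw [Algebra.norm_eq_matrix_det B, Algebra.norm_eq_matrix_det ω, h, RingHom.map_det]
  rfl

end NormOnProducts

/-! ### The global norm as a product of local norms -/

section Semilocal

variable {F : Type*} [Field F] [NumberField F] {ℓ : ℕ}

theorem valued_algebraMap (v : HeightOneSpectrum (𝓞 F)) (x : F) :
    Valued.v (algebraMap F (v.adicCompletion F) x) = v.valuation F x :=
  v.valuedAdicCompletion_eq_valuation' x

theorem tendsto_zero_of_valued_le {v : HeightOneSpectrum (𝓞 F)} {u : ℕ → v.adicCompletion F}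
    (hu : ∀ n, Valued.v (u n) ≤ WithZero.exp (-1 : ℤ) ^ n) :
    Filter.Tendsto u Filter.atTop (nhds 0) := by
  intro s hs
  rw [Valued.mem_nhds_zero] at hs
  obtain ⟨γ, hγ⟩ := hs
  have h1 : WithZero.exp (-1 : ℤ) < 1 := by
    rw [← WithZero.exp_zero, WithZero.exp_lt_exp]; norm_num
  obtain ⟨n, hn⟩ := exists_pow_lt₀ h1
    (Units.mk0 _ (MonoidWithZeroHom.ValueGroup₀.embedding_unit_ne_zero γ))
  rw [Filter.mem_map, Filter.mem_atTop_sets]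
  refine ⟨n, fun m hm => hγ ?_⟩
  rw [Set.mem_ofPred_eq, Valuation.restrict_lt_iff_lt_embedding]
  exact (hu m).trans_lt ((pow_le_pow_right_of_le_one' h1.le hm).trans_lt hn)

section

variable {n : ℕ} (𝔭 : Fin n ≃ placesAbove F ℓ)

/-- The diagonal embedding of `F` into the product of its completions above `ℓ`. -/
noncomputable def diagEmbedding : F →+* ∀ j, (𝔭 j).1.adicCompletion F :=
  RingHom.pi fun j => algebraMap F ((𝔭 j).1.adicCompletion F)

theorem diagEmbedding_apply (x : F) (j : Fin n) :
    diagEmbedding 𝔭 x j = algebraMap F ((𝔭 j).1.adicCompletion F) x := rfl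

/-- By the Chinese remainder theorem an integer can be close to `1` at one place and close to `0` at
the others. -/
theorem exists_diagEmbedding_tendsto_single (j : Fin n) :
    ∃ y : ℕ → F, Filter.Tendsto (fun m => diagEmbedding 𝔭 (y m)) Filter.atTop
      (nhds (Pi.single j 1)) := by
  have hcrt : ∀ m : ℕ, ∃ y : 𝓞 F, ∀ i, y - (Pi.single j 1 : Fin n → 𝓞 F) i ∈
      (𝔭 i).1.asIdeal ^ m := by
    intro m
    obtain ⟨y, hy⟩ := IsDedekindDomain.exists_forall_sub_mem_ideal (s := Finset.univ)
      (fun i : Fin n => (𝔭 i).1.asIdeal) (fun _ => m) (fun i _ => (𝔭 i).1.prime)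
      (fun i _ k _ hik h => hik (𝔭.injective (Subtype.ext (HeightOneSpectrum.ext h))))
      (fun i => (Pi.single j 1 : Fin n → 𝓞 F) i)
    exact ⟨y, fun i => hy i (Finset.mem_univ i)⟩
  choose y hy using hcrt
  refine ⟨fun m => (y m : F), tendsto_pi_nhds.2 fun i => ?_⟩
  rw [← tendsto_sub_nhds_zero_iff]
  refine tendsto_zero_of_valued_le fun m => ?_
  have h1 : diagEmbedding 𝔭 (y m : F) i - (Pi.single j 1 : ∀ j, (𝔭 j).1.adicCompletion F) i =
      algebraMap F ((𝔭 i).1.adicCompletion F)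
        (algebraMap (𝓞 F) F (y m - (Pi.single j 1 : Fin n → 𝓞 F) i)) := by
    rw [diagEmbedding_apply, map_sub, map_sub]
    congr 1
    by_cases hij : i = j
    · subst hij; simp
    · rw [Pi.single_eq_of_ne hij, Pi.single_eq_of_ne hij, map_zero, map_zero]
  rw [h1, valued_algebraMap, HeightOneSpectrum.valuation_of_algebraMap, ← WithZero.exp_nsmul,
    nsmul_eq_mul, mul_neg, mul_one]
  exact ((𝔭 i).1.intValuation_le_pow_iff_mem _ _).2 (hy m i)

end

variable [Fact ℓ.Prime]

theorem dvd_of_valuation_le {a : 𝓞 F}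
    (h : ∀ v ∈ placesAbove F ℓ, v.valuation F (a : F) ≤ v.valuation F (ℓ : F)) :
    (ℓ : 𝓞 F) ∣ a := by
  have hℓ : (ℓ : F) ≠ 0 := by exact_mod_cast (Fact.out : ℓ.Prime).ne_zero
  obtain ⟨b, hb⟩ := HeightOneSpectrum.mem_integers_of_valuation_le_one (R := 𝓞 F) F
    ((a : F) / ℓ) (by
      intro v
      rw [map_div₀]
      by_cases hv : v ∈ placesAbove F ℓ
      · exact div_le_one_of_le₀ (h v hv) zero_le
      · have h1 : v.valuation F (ℓ : F) = 1 := by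
          have := (v.valuation_eq_one_iff_notMem (K := F)).2 hv
          simpa using this
        rw [h1, div_one]
        exact v.valuation_le_one a)
  refine ⟨b, ?_⟩
  apply FaithfulSMul.algebraMap_injective (𝓞 F) F
  rw [map_mul, hb, map_natCast, mul_div_cancel₀ _ hℓ]

variable {n : ℕ} (𝔭 : Fin n ≃ placesAbove F ℓ)

theorem diagEmbedding_ratCast_mul (q : ℚ) (x : F) :
    diagEmbedding 𝔭 (algebraMap ℚ F q * x) = (algebraMap ℚ ℚ_[ℓ] q) • diagEmbedding 𝔭 x := by
  funext j
  rw [Pi.smul_apply, diagEmbedding_apply, diagEmbedding_apply, ← Algebra.smul_def,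
    ← ratCast_smul_placesAbove (𝔭 j), eq_ratCast]

/-- Scale a relation so that its coefficients are integral and one of them is `1`. Replacing them by
integers modulo `ℓ` gives an element of `𝓞 F` divisible by `ℓ` at all places above `ℓ`, hence
divisible by `ℓ`. In an integral basis all its coordinates are then divisible by `ℓ`, a
contradiction. -/
theorem linearIndependent_diagEmbedding :
    LinearIndependent ℚ_[ℓ] fun i => diagEmbedding 𝔭 (integralBasis F i) := by
  rw [Fintype.linearIndependent_iff]
  intro a ha
  by_contra! hne
  obtain ⟨i₁, hi₁⟩ := hne
  have : Nonempty (Module.Free.ChooseBasisIndex ℤ (𝓞 F)) := ⟨i₁⟩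
  obtain ⟨i₀, hi₀⟩ := Finite.exists_max fun i => ‖a i‖
  have h0 : a i₀ ≠ 0 := norm_pos_iff.1 ((norm_pos_iff.2 hi₁).trans_le (hi₀ i₁))
  have hb : ∀ i, ‖a i / a i₀‖ ≤ 1 := fun i => by
    rw [norm_div]; exact div_le_one_of_le₀ (hi₀ i) (norm_nonneg _)
  set b : Module.Free.ChooseBasisIndex ℤ (𝓞 F) → ℤ_[ℓ] := fun i => ⟨a i / a i₀, hb i⟩ with hbdef
  have hcd : ∀ i, ∃ c : ℕ, ∃ d : ℤ_[ℓ], b i = c + ℓ * d := by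
    intro i
    obtain ⟨c, -, hc⟩ := PadicInt.exists_mem_range (b i)
    rw [PadicInt.maximalIdeal_eq_span_p, Ideal.mem_span_singleton] at hc
    obtain ⟨d, hd⟩ := hc
    exact ⟨c, d, by rw [← hd]; ring⟩
  choose c d hcd using hcd
  have hsum : ∑ i, ((b i : ℤ_[ℓ]) : ℚ_[ℓ]) • diagEmbedding 𝔭 (integralBasis F i) = 0 := by
    have : ∀ i, ((b i : ℤ_[ℓ]) : ℚ_[ℓ]) • diagEmbedding 𝔭 (integralBasis F i) =
        (a i₀)⁻¹ • (a i • diagEmbedding 𝔭 (integralBasis F i)) := fun i => by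
      rw [smul_smul, inv_mul_eq_div]
    simp_rw [this]
    rw [← Finset.smul_sum, ha, smul_zero]
  have hdvd : (ℓ : 𝓞 F) ∣ ∑ i, c i • RingOfIntegers.basis F i := by
    refine dvd_of_valuation_le fun v hv => ?_
    obtain ⟨j, hj⟩ := 𝔭.surjective ⟨v, hv⟩
    obtain rfl : (𝔭 j).1 = v := by rw [hj]
    have hs := congrFun hsum j
    rw [Finset.sum_apply, Pi.zero_apply] at hs
    have hterm : ∀ i, (((b i : ℤ_[ℓ]) : ℚ_[ℓ]) • diagEmbedding 𝔭 (integralBasis F i)) j =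
        algebraMap F ((𝔭 j).1.adicCompletion F) (c i • integralBasis F i) +
        algebraMap F ((𝔭 j).1.adicCompletion F) ℓ *
        (algebraMap ℚ_[ℓ] ((𝔭 j).1.adicCompletion F) (d i) *
          algebraMap F ((𝔭 j).1.adicCompletion F) (integralBasis F i)) := by
      intro i
      rw [Pi.smul_apply, diagEmbedding_apply, Algebra.smul_def, hcd, PadicInt.coe_add,
        PadicInt.coe_mul, PadicInt.coe_natCast, PadicInt.coe_natCast, map_add, map_mul,
        map_natCast, map_natCast, nsmul_eq_mul, map_mul, map_natCast, map_natCast]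
      ring
    simp_rw [hterm] at hs
    rw [Finset.sum_add_distrib, ← Finset.mul_sum, ← map_sum, add_eq_zero_iff_eq_neg] at hs
    have hcast : ((∑ i, c i • RingOfIntegers.basis F i : 𝓞 F) : F) =
        ∑ i, c i • integralBasis F i := by
      change algebraMap (𝓞 F) F _ = _
      rw [map_sum]
      refine Finset.sum_congr rfl fun i _ => ?_
      rw [map_nsmul, integralBasis_apply]
    rw [hcast, ← valued_algebraMap, ← valued_algebraMap, hs, Valuation.map_neg, map_mul]
    refine mul_le_of_le_one_right' (Valuation.map_sum_le _ fun i _ => ?_)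
    rw [map_mul]
    refine mul_le_one' (valued_algebraMap_le_one (𝔭 j) (d i).2) ?_
    rw [integralBasis_apply, valued_algebraMap]
    exact (𝔭 j).1.valuation_le_one _
  obtain ⟨y, hy⟩ := hdvd
  have hrep := congrArg (fun z => (RingOfIntegers.basis F).repr z i₀) hy
  have h1 : (RingOfIntegers.basis F).repr (∑ i, c i • RingOfIntegers.basis F i) i₀ = c i₀ := by
    have := congrFun ((RingOfIntegers.basis F).repr_sum_self fun i => (c i : ℤ)) i₀
    simpa using this
  have h2 : (RingOfIntegers.basis F).repr ((ℓ : 𝓞 F) * y) i₀ =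
      ℓ * (RingOfIntegers.basis F).repr y i₀ := by
    rw [← nsmul_eq_mul, map_nsmul, Finsupp.smul_apply, nsmul_eq_mul]
  simp only [h1, h2] at hrep
  have hb0 : b i₀ = 1 := by
    apply Subtype.ext
    exact div_self h0
  have hunit : (ℓ : ℤ_[ℓ]) ∣ 1 := by
    rw [← hb0, hcd]
    refine dvd_add ?_ (dvd_mul_right _ _)
    refine ⟨((RingOfIntegers.basis F).repr y i₀ : ℤ), ?_⟩
    exact_mod_cast congrArg (Int.cast (R := ℤ_[ℓ])) hrep
  exact PadicInt.prime_p.not_isUnit (isUnit_of_dvd_one hunit)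

/-- The span is closed and contains the diagonal `F`. By approximation it contains the idempotents
times `F`, and by density each factor. -/
theorem span_diagEmbedding_eq_top :
    Submodule.span ℚ_[ℓ] (Set.range fun i => diagEmbedding 𝔭 (integralBasis F i)) = ⊤ := by
  set S := Submodule.span ℚ_[ℓ] (Set.range fun i => diagEmbedding 𝔭 (integralBasis F i)) with hS
  have hfin : FiniteDimensional ℚ_[ℓ] S := FiniteDimensional.span_of_finite _ (Set.finite_range _)
  have hcl : IsClosed (S : Set (∀ j, (𝔭 j).1.adicCompletion F)) := S.closed_of_finiteDimensional
  have hF : ∀ x, diagEmbedding 𝔭 x ∈ S := by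
    intro x
    rw [← (integralBasis F).sum_repr x, map_sum]
    refine Submodule.sum_mem _ fun i _ => ?_
    rw [Algebra.smul_def, diagEmbedding_ratCast_mul]
    exact Submodule.smul_mem _ _ (Submodule.subset_span ⟨i, rfl⟩)
  have hsingle : ∀ j (x : F), Pi.single j (algebraMap F ((𝔭 j).1.adicCompletion F) x) ∈ S := by
    intro j x
    obtain ⟨y, hy⟩ := exists_diagEmbedding_tendsto_single 𝔭 j
    have h1 := hy.mul_const (diagEmbedding 𝔭 x)
    rw [← Pi.single_mul_left, one_mul] at h1
    refine hcl.mem_of_tendsto h1 (Filter.Eventually.of_forall fun m => ?_)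
    rw [← map_mul]
    exact hF _
  have hsingle' : ∀ j (z : (𝔭 j).1.adicCompletion F), Pi.single j z ∈ S := by
    intro j z
    have hc : IsClosed {z : (𝔭 j).1.adicCompletion F | Pi.single j z ∈ S} :=
      hcl.preimage (continuous_single j)
    refine closure_minimal (s := Set.range (algebraMap F ((𝔭 j).1.adicCompletion F))) ?_ hc
      ((𝔭 j).1.denseRange_algebraMap F z)
    rintro _ ⟨x, rfl⟩
    exact hsingle j x
  rw [eq_top_iff]
  intro y _
  rw [← Finset.univ_sum_single y]
  exact Submodule.sum_mem _ fun j _ => hsingle' j _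

theorem norm_eq_prod_localNorm (x : F) :
    ((Algebra.norm ℚ x : ℚ) : ℚ_[ℓ]) =
      ∏ j, localNorm ℓ (𝔭 j).1 (𝔭 j).2 (algebraMap F ((𝔭 j).1.adicCompletion F) x) := by
  classical
  let B : Module.Basis _ ℚ_[ℓ] (∀ j, (𝔭 j).1.adicCompletion F) :=
    Module.Basis.mk (linearIndependent_diagEmbedding 𝔭) (span_diagEmbedding_eq_top 𝔭).ge
  have h := norm_eq_of_basis_map (algebraMap ℚ ℚ_[ℓ]) (diagEmbedding 𝔭)
    (diagEmbedding_ratCast_mul 𝔭) (integralBasis F) B (fun i => Module.Basis.mk_apply _ _ i) x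
  rw [eq_ratCast] at h
  rw [← h, norm_pi_eq_prod fun j => Module.finBasis ℚ_[ℓ] ((𝔭 j).1.adicCompletion F)]
  rfl

end Semilocal

end LogClass

namespace LogClass

/-! ### Logarithmic valuations of `ℓ`-units -/

section EllUnits

variable {F : Type*} [Field F] [NumberField F] {ℓ : ℕ}

theorem exists_pow_mul_isIntegral {n : ℕ} (𝔭 : Fin n ≃ placesAbove F ℓ) {x : F} (hx0 : x ≠ 0)
    (hx : ∀ v ∉ placesAbove F ℓ, HeightOneSpectrum.valuation F v x ≤ 1) :
    ∃ N : ℕ, ∀ k ≥ N, IsIntegral ℤ ((ℓ : F) ^ k * x) := by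
  have hlt : ∀ j, (𝔭 j).1.valuation F (ℓ : F) < 1 := fun j => by
    have := ((𝔭 j).1.valuation_lt_one_iff_mem (K := F) (ℓ : 𝓞 F)).2 (𝔭 j).2
    simpa using this
  have hk : ∀ j, ∃ k : ℕ, (𝔭 j).1.valuation F (ℓ : F) ^ k < ((𝔭 j).1.valuation F x)⁻¹ := fun j => by
    obtain ⟨k, hk⟩ := exists_pow_lt₀ (hlt j)
      (Units.mk0 ((𝔭 j).1.valuation F x)⁻¹ (inv_ne_zero ((Valuation.ne_zero_iff _).2 hx0)))
    exact ⟨k, hk⟩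
  choose k hk using hk
  refine ⟨Finset.univ.sup k, fun m hm => ?_⟩
  obtain ⟨b, hb⟩ := HeightOneSpectrum.mem_integers_of_valuation_le_one (R := 𝓞 F) F
    ((ℓ : F) ^ m * x) (by
      intro v
      rw [map_mul, map_pow]
      by_cases hv : v ∈ placesAbove F ℓ
      · obtain ⟨j, hj⟩ := 𝔭.surjective ⟨v, hv⟩
        obtain rfl : (𝔭 j).1 = v := by rw [hj]
        have h1 : (𝔭 j).1.valuation F (ℓ : F) ^ m < ((𝔭 j).1.valuation F x)⁻¹ :=
          (pow_le_pow_right_of_le_one' (hlt j).le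
            ((Finset.le_sup (Finset.mem_univ j)).trans hm)).trans_lt (hk j)
        have h2 : (𝔭 j).1.valuation F x ≠ 0 := (Valuation.ne_zero_iff _).2 hx0
        calc _ ≤ ((𝔭 j).1.valuation F x)⁻¹ * (𝔭 j).1.valuation F x := mul_le_mul_left h1.le _
          _ = 1 := inv_mul_cancel₀ h2
      · have h1 : v.valuation F (ℓ : F) = 1 := by
          have := (v.valuation_eq_one_iff_notMem (K := F)).2 hv
          simpa using this
        rw [h1, one_pow, one_mul]
        exact hx v hv)
  rw [← hb]
  exact b.2

variable [Fact ℓ.Prime]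

theorem iwasawaLog_intCast_of_dvd_pow {a : ℤ} {m : ℕ} (h : a ∣ (ℓ : ℤ) ^ m) :
    iwasawaLog ℓ (a : ℚ_[ℓ]) = 0 := by
  have hℓ : (ℓ : ℚ_[ℓ]) ≠ 0 := by exact_mod_cast (Fact.out : ℓ.Prime).ne_zero
  have h1 : a.natAbs ∣ ℓ ^ m := by
    have := Int.natAbs_dvd_natAbs.2 h
    rwa [Int.natAbs_pow, Int.natAbs_natCast] at this
  obtain ⟨j, -, hj⟩ := (Nat.dvd_prime_pow Fact.out).1 h1
  have hpow : iwasawaLog ℓ ((ℓ : ℚ_[ℓ]) ^ j) = 0 := by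
    rw [iwasawaLog_pow hℓ, iwasawaLog_self, mul_zero]
  rcases Int.natAbs_eq a with ha | ha
  · rw [ha, hj]; push_cast; exact hpow
  · rw [ha, hj]; push_cast; rw [iwasawaLog_neg (pow_ne_zero _ hℓ), hpow]

/-- For large `k` both `ℓ ^ k x` and `ℓ ^ k x⁻¹` are integral. Their norms are integers whose
product is a power of `ℓ`, so `N x` is `±` a power of `ℓ`. -/
theorem iwasawaLog_norm_ellUnit {n : ℕ} (𝔭 : Fin n ≃ placesAbove F ℓ) {x : Fˣ}
    (hx : x ∈ ellUnits F ℓ) :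
    iwasawaLog ℓ ((Algebra.norm ℚ (x : F) : ℚ) : ℚ_[ℓ]) = 0 := by
  have hℓ : (ℓ : ℚ_[ℓ]) ≠ 0 := by exact_mod_cast (Fact.out : ℓ.Prime).ne_zero
  obtain ⟨N₁, h₁⟩ := exists_pow_mul_isIntegral 𝔭 x.ne_zero fun v hv => (hx v hv).le
  obtain ⟨N₂, h₂⟩ := exists_pow_mul_isIntegral 𝔭 (inv_ne_zero x.ne_zero) fun v hv => by
    rw [map_inv₀, hx v hv, inv_one]
  set k := max N₁ N₂
  obtain ⟨a, ha⟩ := IsIntegrallyClosed.isIntegral_iff.1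
    (Algebra.isIntegral_norm ℚ (h₁ k (le_max_left _ _)))
  obtain ⟨b, hb⟩ := IsIntegrallyClosed.isIntegral_iff.1
    (Algebra.isIntegral_norm ℚ (h₂ k (le_max_right _ _)))
  have hnℓ : Algebra.norm ℚ (ℓ : F) = (ℓ : ℚ) ^ Module.finrank ℚ F := by
    have := Algebra.norm_algebraMap (S := F) (ℓ : ℚ)
    rwa [map_natCast] at this
  set d := Module.finrank ℚ F
  have hN : Algebra.norm ℚ (x : F) ≠ 0 := Algebra.norm_ne_zero_iff.2 x.ne_zero
  rw [eq_intCast, map_mul, map_pow, hnℓ] at ha hb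
  have hNinv : Algebra.norm ℚ (x : F)⁻¹ = (Algebra.norm ℚ (x : F))⁻¹ :=
    eq_inv_of_mul_eq_one_left (by rw [← map_mul, inv_mul_cancel₀ x.ne_zero, map_one])
  rw [hNinv] at hb
  have hdvd : a ∣ (ℓ : ℤ) ^ (d * k + d * k) := by
    refine ⟨b, ?_⟩
    have : (a : ℚ) * b = (ℓ : ℚ) ^ (d * k + d * k) := by
      rw [ha, hb]
      field_simp
      ring
    exact_mod_cast this.symm
  have h0 := iwasawaLog_intCast_of_dvd_pow hdvd
  have ha' : (a : ℚ_[ℓ]) = ((ℓ : ℚ_[ℓ]) ^ d) ^ k * ((Algebra.norm ℚ (x : F) : ℚ) : ℚ_[ℓ]) := by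
    exact_mod_cast congrArg (Rat.cast (K := ℚ_[ℓ])) ha
  rw [ha', ← pow_mul, iwasawaLog_mul ℓ (pow_ne_zero _ hℓ) (by exact_mod_cast hN),
    iwasawaLog_pow hℓ, iwasawaLog_self, mul_zero, zero_add] at h0
  exact h0

theorem iwasawaLog_prod {ι : Type*} (s : Finset ι) {f : ι → ℚ_[ℓ]} (hf : ∀ i ∈ s, f i ≠ 0) :
    iwasawaLog ℓ (∏ i ∈ s, f i) = ∑ i ∈ s, iwasawaLog ℓ (f i) := by
  classical
  induction s using Finset.induction_on with
  | empty => simpa using iwasawaLog_one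
  | insert i s hi ih =>
    rw [Finset.prod_insert hi, Finset.sum_insert hi, iwasawaLog_mul ℓ
      (hf i (Finset.mem_insert_self i s))
      (Finset.prod_ne_zero_iff.2 fun k hk => hf k (Finset.mem_insert_of_mem hk)),
      ih fun k hk => hf k (Finset.mem_insert_of_mem hk)]

theorem logValGlobal_of_mem {v : HeightOneSpectrum (𝓞 F)} (hv : (ℓ : 𝓞 F) ∈ v.asIdeal) (x : Fˣ) :
    logValGlobal F ℓ (Additive.ofMul x) v =
      iwasawaLog ℓ (localNorm ℓ v hv (algebraMap F (v.adicCompletion F) x)) *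
        -(placeDeg ℓ v)⁻¹ := by
  have h : logValGlobal F ℓ (Additive.ofMul x) v = logVal ℓ v (Additive.ofMul
    (Units.map (algebraMap F (v.adicCompletion F)).toMonoidHom x)) := rfl
  rw [h, logVal, padicAbs, dif_pos hv]
  rfl

theorem logValGlobal_of_notMem {v : HeightOneSpectrum (𝓞 F)} (hv : (ℓ : 𝓞 F) ∉ v.asIdeal)
    (x : Fˣ) :
    logValGlobal F ℓ (Additive.ofMul x) v =
      (WithZero.log (v.valuation F (x : F)) : ℤ) •
        (iwasawaLog ℓ (Ideal.absNorm v.asIdeal : ℚ_[ℓ]) * -(placeDeg ℓ v)⁻¹) := by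
  have h : logValGlobal F ℓ (Additive.ofMul x) v = logVal ℓ v (Additive.ofMul
    (Units.map (algebraMap F (v.adicCompletion F)).toMonoidHom x)) := rfl
  have hne : (Ideal.absNorm v.asIdeal : ℚ_[ℓ]) ≠ 0 := by
    simpa [Ideal.absNorm_eq_zero_iff] using v.ne_bot
  rw [h, logVal, padicAbs, dif_neg hv, ← smul_mul_assoc]
  change iwasawaLogHom ℓ (Additive.ofMul (Units.mk0 (Ideal.absNorm v.asIdeal : ℚ_[ℓ]) hne ^
    WithZero.log (Valued.v (algebraMap F (v.adicCompletion F) x)))) * _ = _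
  rw [ofMul_zpow, map_zsmul, valued_algebraMap]
  rfl

theorem iwasawaLog_absNorm_ne_zero {v : HeightOneSpectrum (𝓞 F)} (hv : (ℓ : 𝓞 F) ∉ v.asIdeal) :
    iwasawaLog ℓ (Ideal.absNorm v.asIdeal : ℚ_[ℓ]) ≠ 0 := by
  refine iwasawaLog_natCast_ne_zero (NumberField.HeightOneSpectrum.one_lt_absNorm v) fun hd => hv ?_
  have hfin : Finite (𝓞 F ⧸ v.asIdeal) := v.asIdeal.finiteQuotientOfFreeOfNeBot v.ne_bot
  obtain ⟨y, hy⟩ := exists_prime_addOrderOf_dvd_card' (G := 𝓞 F ⧸ v.asIdeal) ℓ hd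
  have h1 : (ℓ : 𝓞 F ⧸ v.asIdeal) * y = 0 := by
    rw [← nsmul_eq_mul, ← hy, addOrderOf_nsmul_eq_zero]
  have h2 : y ≠ 0 := by
    rintro rfl
    rw [addOrderOf_zero] at hy
    exact (Fact.out : ℓ.Prime).one_lt.ne hy
  have hp := v.isPrime
  rw [← Ideal.Quotient.eq_zero_iff_mem, map_natCast]
  exact (mul_eq_zero.1 h1).resolve_right h2

theorem logValGlobal_ellUnit_of_notMem {v : HeightOneSpectrum (𝓞 F)} (hv : v ∉ placesAbove F ℓ)
    {x : Fˣ} (hx : x ∈ ellUnits F ℓ) : logValGlobal F ℓ (Additive.ofMul x) v = 0 := by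
  rw [logValGlobal_of_notMem hv, hx v hv, WithZero.log_one, zero_smul]

/-- This is the product formula for `ℓ`-units: multiplying by the degrees leaves minus the logarithm
of the global norm. -/
theorem sum_logValGlobal_mul_placeDeg {n : ℕ} (𝔭 : Fin n ≃ placesAbove F ℓ) {x : Fˣ}
    (hx : x ∈ ellUnits F ℓ) :
    ∑ j, logValGlobal F ℓ (Additive.ofMul x) (𝔭 j) * placeDeg ℓ (𝔭 j).1 = 0 := by
  have hterm : ∀ j, logValGlobal F ℓ (Additive.ofMul x) (𝔭 j) * placeDeg ℓ (𝔭 j).1 =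
      -iwasawaLog ℓ (localNorm ℓ (𝔭 j).1 (𝔭 j).2
        (algebraMap F ((𝔭 j).1.adicCompletion F) x)) := by
    intro j
    rw [logValGlobal_of_mem (𝔭 j).2, mul_assoc, neg_mul, inv_mul_cancel₀ (placeDeg_ne_zero _),
      mul_neg_one]
  simp_rw [hterm]
  rw [Finset.sum_neg_distrib, ← iwasawaLog_prod, ← norm_eq_prod_localNorm,
    iwasawaLog_norm_ellUnit 𝔭 hx, neg_zero]
  intro j _
  exact ((Units.map (localNorm ℓ (𝔭 j).1 (𝔭 j).2)).comp
    (Units.map (algebraMap F ((𝔭 j).1.adicCompletion F)).toMonoidHom) x).ne_zero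

theorem norm_logValGlobal_le_one {v : HeightOneSpectrum (𝓞 F)} (hv : v ∈ placesAbove F ℓ) (x : Fˣ) :
    ‖logValGlobal F ℓ (Additive.ofMul x) v‖ ≤ 1 :=
  norm_logVal_le_one hv _

end EllUnits

/-! ### Principal divisors supported above `ℓ` -/

section Relations

variable (F : Type*) [Field F] [NumberField F] (ℓ : ℕ)

/-- The valuations of an element of `Fˣ` at the places away from `ℓ`. -/
noncomputable def valuationsAway : Additive Fˣ →+ ({v // v ∉ placesAbove F ℓ} →₀ ℤ) :=
  AddMonoidHom.mk' (fun x => Finsupp.ofSupportFinite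
    (fun v => WithZero.log (v.1.valuation F (x.toMul : F))) (by
      have h1 := HeightOneSpectrum.Support.finite (𝓞 F) (x.toMul : F)
      have h2 := HeightOneSpectrum.Support.finite (𝓞 F) ((x.toMul : F)⁻¹)
      refine ((h1.union h2).preimage Subtype.val_injective.injOn).subset fun v hv => ?_
      have hne : v.1.valuation F (x.toMul : F) ≠ 0 :=
        (Valuation.ne_zero_iff _).2 x.toMul.ne_zero
      rcases lt_trichotomy (v.1.valuation F (x.toMul : F)) 1 with h | h | h
      · refine Or.inr ?_
        change 1 < v.1.valuation F ((x.toMul : F)⁻¹)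
        rw [map_inv₀]
        exact (one_lt_inv₀ (zero_lt_iff.2 hne)).2 h
      · exact absurd (by simp only [h, WithZero.log_one]) hv
      · exact Or.inl h))
    fun x y => by
      ext v
      change WithZero.log (v.1.valuation F ((x.toMul : F) * (y.toMul : F))) =
        WithZero.log (v.1.valuation F (x.toMul : F)) + WithZero.log (v.1.valuation F (y.toMul : F))
      rw [map_mul, WithZero.log_mul ((Valuation.ne_zero_iff _).2 x.toMul.ne_zero)
        ((Valuation.ne_zero_iff _).2 y.toMul.ne_zero)]

variable {F ℓ}

theorem valuationsAway_apply (x : Fˣ) (v : {v // v ∉ placesAbove F ℓ}) :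
    valuationsAway F ℓ (Additive.ofMul x) v = WithZero.log (v.1.valuation F (x : F)) := rfl

theorem mem_ellUnits_of_valuationsAway_eq_zero {x : Fˣ}
    (h : valuationsAway F ℓ (Additive.ofMul x) = 0) : x ∈ ellUnits F ℓ := by
  intro v hv
  have h1 := DFunLike.congr_fun h ⟨v, hv⟩
  rw [valuationsAway_apply, Finsupp.zero_apply] at h1
  have hne : v.valuation F (x : F) ≠ 0 := (Valuation.ne_zero_iff _).2 x.ne_zero
  rw [← WithZero.exp_log hne, h1, WithZero.exp_zero]

variable [Fact ℓ.Prime]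

theorem logDiv_tmul (a : ℤ_[ℓ]) (x : Additive Fˣ) :
    logDiv F ℓ (a ⊗ₜ x) = a • logValGlobal F ℓ x := by
  rw [logDiv, LinearMap.liftBaseChange_tmul]
  rfl

open Classical in
theorem logDiv_of_notMem (v : {v // v ∉ placesAbove F ℓ}) (β : PrincipalIdeles F ℓ) :
    logDiv F ℓ β v.1 = (TensorProduct.finsuppScalarRight ℤ ℤ ℤ_[ℓ] _
      ((valuationsAway F ℓ).toIntLinearMap.lTensor ℤ_[ℓ] β) v : ℤ_[ℓ]) *
        (iwasawaLog ℓ (Ideal.absNorm v.1.asIdeal : ℚ_[ℓ]) * -(placeDeg ℓ v.1)⁻¹) := by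
  induction β using TensorProduct.induction_on with
  | zero => simp
  | add x y hx hy =>
    rw [map_add, Pi.add_apply, hx, hy, map_add, map_add, Finsupp.add_apply, PadicInt.coe_add,
      add_mul]
  | tmul a x =>
    rw [logDiv_tmul, Pi.smul_apply, LinearMap.lTensor_tmul,
      TensorProduct.finsuppScalarRight_apply_tmul_apply]
    change a • logValGlobal F ℓ (Additive.ofMul x.toMul) v.1 =
      ((valuationsAway F ℓ (Additive.ofMul x.toMul) v • a : ℤ_[ℓ]) : ℚ_[ℓ]) * _
    rw [logValGlobal_of_notMem v.2, valuationsAway_apply, Algebra.smul_def, zsmul_eq_mul,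
      zsmul_eq_mul, PadicInt.coe_mul, PadicInt.coe_intCast, PadicInt.algebraMap_apply]
    ring

theorem logValGlobal_mem_span {r : ℕ} {γ : Fin r → ellUnits F ℓ}
    (hγ : Subgroup.closure (Set.range γ) ⊔ CommGroup.torsion (ellUnits F ℓ) = ⊤) {x : Fˣ}
    (hx : x ∈ ellUnits F ℓ) :
    logValGlobal F ℓ (Additive.ofMul x) ∈ Submodule.span ℤ_[ℓ]
      (Set.range fun j => logValGlobal F ℓ (Additive.ofMul (γ j : Fˣ))) := by
  set S := Submodule.span ℤ_[ℓ] (Set.range fun j => logValGlobal F ℓ (Additive.ofMul (γ j : Fˣ)))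
    with hS
  let T : Subgroup (ellUnits F ℓ) :=
    (AddSubgroup.toSubgroup' (S.toAddSubgroup.comap (logValGlobal F ℓ))).comap
      (ellUnits F ℓ).subtype
  have hT : ∀ y : ellUnits F ℓ, y ∈ T ↔ logValGlobal F ℓ (Additive.ofMul (y : Fˣ)) ∈ S :=
    fun y => Iff.rfl
  have htop : (⊤ : Subgroup (ellUnits F ℓ)) ≤ T := by
    rw [← hγ, sup_le_iff, Subgroup.closure_le]
    constructor
    · rintro _ ⟨j, rfl⟩
      exact (hT _).2 (Submodule.subset_span ⟨j, rfl⟩)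
    · intro y hy
      obtain ⟨n, hn, hyn⟩ := isOfFinOrder_iff_pow_eq_one.1 hy
      have h1 : n • logValGlobal F ℓ (Additive.ofMul (y : Fˣ)) = 0 := by
        rw [← map_nsmul, ← ofMul_pow]
        have : (y : Fˣ) ^ n = 1 := by exact_mod_cast congrArg Subtype.val hyn
        rw [this, ofMul_one, map_zero]
      -- Torsion dies because the values lie in a field of characteristic zero.
      have h2 : logValGlobal F ℓ (Additive.ofMul (y : Fˣ)) = 0 := by
        funext v
        have h3 := congrFun h1 v
        rw [Pi.smul_apply, nsmul_eq_mul, Pi.zero_apply, mul_eq_zero] at h3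
        exact h3.resolve_left (by exact_mod_cast hn.ne')
      rw [hT, h2]
      exact S.zero_mem
  exact (hT ⟨x, hx⟩).1 (htop trivial)

/-- A principal logarithmic divisor without components away from `ℓ` is a combination of the
divisors of generators of the `ℓ`-units. -/
theorem logDiv_mem_span {r : ℕ} {γ : Fin r → ellUnits F ℓ}
    (hγ : Subgroup.closure (Set.range γ) ⊔ CommGroup.torsion (ellUnits F ℓ) = ⊤)
    {β : PrincipalIdeles F ℓ} (hβ : ∀ v ∉ placesAbove F ℓ, logDiv F ℓ β v = 0) :
    logDiv F ℓ β ∈ Submodule.span ℤ_[ℓ]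
      (Set.range fun j => logValGlobal F ℓ (Additive.ofMul (γ j : Fˣ))) := by
  classical
  set φ := (valuationsAway F ℓ).toIntLinearMap with hφ
  have h0 : φ.lTensor ℤ_[ℓ] β = 0 := by
    apply (TensorProduct.finsuppScalarRight ℤ ℤ ℤ_[ℓ] _).injective
    rw [map_zero]
    ext v
    have h := hβ v.1 v.2
    rw [logDiv_of_notMem v, mul_eq_zero] at h
    simpa using h.resolve_right (mul_ne_zero (iwasawaLog_absNorm_ne_zero v.2)
      (neg_ne_zero.2 (inv_ne_zero (placeDeg_ne_zero _))))
  -- Flatness of `ℤ_ℓ` over `ℤ`: the kernel after tensoring comes from the kernel of the valuations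
  -- away from `ℓ`, which is the group of `ℓ`-units.
  obtain ⟨β', rfl⟩ := (Module.Flat.lTensor_exact ℤ_[ℓ] φ.exact_subtype_ker_map β).1 h0
  clear hβ h0
  induction β' using TensorProduct.induction_on with
  | zero => simp
  | add x y hx hy => rw [map_add, map_add]; exact Submodule.add_mem _ hx hy
  | tmul a x =>
    rw [LinearMap.lTensor_tmul, logDiv_tmul]
    exact Submodule.smul_mem _ _ (logValGlobal_mem_span hγ
      (mem_ellUnits_of_valuationsAway_eq_zero (x := (x : Additive Fˣ).toMul) x.2))

end Relations

end LogClass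

namespace LogClass

/-! ### Generators and relations of the class group above `ℓ` -/

section Classes

theorem logDivisorCoeffs_apply {F : Type*} [Field F] {ℓ : ℕ} [Fact ℓ.Prime] (D : LogDivisor F ℓ)
    (v : HeightOneSpectrum (𝓞 F)) :
    logDivisorCoeffs F ℓ D v = (D v : ℚ_[ℓ]) := rfl

variable {F : Type*} [Field F] [NumberField F] {ℓ : ℕ} [Fact ℓ.Prime] {t : ℕ}
  (𝔭 : Fin (t + 1) ≃ placesAbove F ℓ)

/-- The difference is a multiple of the first place and has degree zero, while the degree of that
place is nonzero. -/
theorem logDivisorZero_eq_of_eq_succ {D E : LogDivisorZero F ℓ}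
    (hD : ∀ v ∉ placesAbove F ℓ, D.1 v = 0) (hE : ∀ v ∉ placesAbove F ℓ, E.1 v = 0)
    (h : ∀ i : Fin t, D.1 (𝔭 i.succ) = E.1 (𝔭 i.succ)) : D = E := by
  have hsingle : D.1 - E.1 = Finsupp.single (𝔭 0).1 ((D.1 - E.1) (𝔭 0)) := by
    refine Finsupp.ext fun v => ?_
    by_cases hv : v ∈ placesAbove F ℓ
    · obtain ⟨j, hj⟩ := 𝔭.surjective ⟨v, hv⟩
      obtain rfl : (𝔭 j).1 = v := by rw [hj]
      induction j using Fin.cases with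
      | zero => rw [Finsupp.single_eq_same]
      | succ i =>
        rw [Finsupp.sub_apply, h, sub_self, Finsupp.single_eq_of_ne]
        exact fun he => Fin.succ_ne_zero i (𝔭.injective (Subtype.ext he))
    · rw [Finsupp.sub_apply, hD v hv, hE v hv, sub_self, Finsupp.single_eq_of_ne]
      rintro rfl
      exact hv (𝔭 0).2
  have hdeg : logDivisorDeg F ℓ (D.1 - E.1) = 0 := LinearMap.mem_ker.1 (D - E).2
  rw [hsingle, logDivisorDeg, Finsupp.linearCombination_single, Algebra.smul_def, mul_eq_zero] at hdeg
  have h0 : (D.1 - E.1) (𝔭 0) = 0 := Subtype.ext (hdeg.resolve_right (placeDeg_ne_zero _))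
  rw [h0, Finsupp.single_zero] at hsingle
  exact Subtype.ext (sub_eq_zero.1 hsingle)

variable (hmin : ∀ i, Padic.addValuation (placeDeg ℓ (𝔭 0 : HeightOneSpectrum (𝓞 F))) ≤
  Padic.addValuation (placeDeg ℓ (𝔭 i : HeightOneSpectrum (𝓞 F))))

/-- The divisor of degree zero with prescribed coefficients at the places other than the first. -/
noncomputable def combination (b : Fin t → ℤ_[ℓ]) : LogDivisorZero F ℓ :=
  ∑ i, b i • degZeroDivisor (hmin i.succ)

theorem logClass_combination (b : Fin t → ℤ_[ℓ]) : logClass (combination 𝔭 hmin b) =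
    ∑ i, b i • logClass (degZeroDivisor (hmin i.succ)) := by
  simp [combination]

theorem combination_apply (b : Fin t → ℤ_[ℓ]) (v : HeightOneSpectrum (𝓞 F)) :
    (combination 𝔭 hmin b).1 v = ∑ i, b i * (Finsupp.single (𝔭 i.succ).1 (1 : ℤ_[ℓ]) v -
      degRatio (hmin i.succ) * Finsupp.single (𝔭 0).1 (1 : ℤ_[ℓ]) v) := by
  rw [combination, AddSubmonoidClass.coe_finsetSum, Finsupp.finsetSum_apply]
  rfl

theorem combination_of_notMem (b : Fin t → ℤ_[ℓ]) {v : HeightOneSpectrum (𝓞 F)}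
    (hv : v ∉ placesAbove F ℓ) : (combination 𝔭 hmin b).1 v = 0 := by
  rw [combination_apply]
  have h : ∀ j, v ≠ (𝔭 j).1 := fun j hj => hv (hj ▸ (𝔭 j).2)
  refine Finset.sum_eq_zero fun i _ => ?_
  rw [Finsupp.single_eq_of_ne (h _), Finsupp.single_eq_of_ne (h _)]
  simp

theorem combination_succ (b : Fin t → ℤ_[ℓ]) (k : Fin t) :
    (combination 𝔭 hmin b).1 (𝔭 k.succ) = b k := by
  rw [combination_apply, Finset.sum_eq_single k]
  · rw [Finsupp.single_eq_same, Finsupp.single_eq_of_ne]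
    · simp
    · exact fun he => Fin.succ_ne_zero k (𝔭.injective (Subtype.ext he))
  · intro i _ hik
    rw [Finsupp.single_eq_of_ne, Finsupp.single_eq_of_ne]
    · simp
    · exact fun he => Fin.succ_ne_zero k (𝔭.injective (Subtype.ext he))
    · exact fun he => hik (Fin.succ_injective _ (𝔭.injective (Subtype.ext he.symm)))
  · simp

theorem span_logClass_eq :
    Submodule.span ℤ_[ℓ] (Set.range fun i : Fin t => logClass (degZeroDivisor (hmin i.succ))) =
      logClassGroupAbove F ℓ := by
  classical
  apply le_antisymm
  · rw [Submodule.span_le]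
    rintro _ ⟨i, rfl⟩
    have h : (degZeroDivisor (hmin i.succ)).1 ∈
        Finsupp.supported ℤ_[ℓ] ℤ_[ℓ] (placesAbove F ℓ) := by
      refine (Finsupp.mem_supported' ℤ_[ℓ] _).2 fun v hv => ?_
      have hne : ∀ j, v ≠ (𝔭 j).1 := fun j hj => hv (hj ▸ (𝔭 j).2)
      change Finsupp.single (𝔭 i.succ).1 (1 : ℤ_[ℓ]) v -
        degRatio (hmin i.succ) * Finsupp.single (𝔭 0).1 (1 : ℤ_[ℓ]) v = 0
      rw [Finsupp.single_eq_of_ne (hne _), Finsupp.single_eq_of_ne (hne _), mul_zero, sub_zero]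
    exact ⟨degZeroDivisor (hmin i.succ), h, rfl⟩
  · rintro _ ⟨D, hD, rfl⟩
    have hD' : ∀ v ∉ placesAbove F ℓ, D.1 v = 0 := (Finsupp.mem_supported' ℤ_[ℓ] D.1).1 hD
    have h : D = combination 𝔭 hmin fun i => D.1 (𝔭 i.succ) :=
      logDivisorZero_eq_of_eq_succ 𝔭 hD' (fun v hv => combination_of_notMem 𝔭 hmin _ hv)
        fun i => (combination_succ 𝔭 hmin (fun i => D.1 (𝔭 i.succ)) i).symm
    have h1 := logClass_combination 𝔭 hmin fun i => D.1 (𝔭 i.succ)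
    rw [← h] at h1
    rw [h1]
    exact Submodule.sum_mem _ fun i _ => Submodule.smul_mem _ _ (Submodule.subset_span ⟨i, rfl⟩)

theorem logClass_eq_zero_iff (D : LogDivisorZero F ℓ) :
    logClass D = 0 ↔ ∃ β : PrincipalIdeles F ℓ, logDiv F ℓ β = logDivisorCoeffs F ℓ D.1 :=
  Submodule.Quotient.mk_eq_zero _

/-- The logarithmic valuation of an element of `Fˣ` at a place above `ℓ`, as an integer. -/
noncomputable def logValInt (x : Fˣ) (j : Fin (t + 1)) : ℤ_[ℓ] :=
  ⟨logValGlobal F ℓ (Additive.ofMul x) (𝔭 j), norm_logValGlobal_le_one (𝔭 j).2 x⟩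

/-- The logarithmic divisor of an `ℓ`-unit is integral, supported above `ℓ` and of degree zero. So
it is the combination with the same coefficients outside the first place; the first coefficient then
agrees automatically. -/
theorem logDivisorCoeffs_combination_ellUnit {x : Fˣ} (hx : x ∈ ellUnits F ℓ) :
    logDivisorCoeffs F ℓ (combination 𝔭 hmin fun i => logValInt 𝔭 x i.succ).1 =
      logValGlobal F ℓ (Additive.ofMul x) := by
  classical
  set D : LogDivisor F ℓ := ∑ j, Finsupp.single (𝔭 j).1 (logValInt 𝔭 x j) with hDdef
  have hdeg : D ∈ LogDivisorZero F ℓ := by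
    rw [LinearMap.mem_ker, hDdef, map_sum]
    simp_rw [logDivisorDeg, Finsupp.linearCombination_single, Algebra.smul_def]
    exact sum_logValGlobal_mul_placeDeg 𝔭 hx
  have happly : ∀ k, D (𝔭 k) = logValInt 𝔭 x k := by
    intro k
    rw [hDdef, Finsupp.finsetSum_apply, Finset.sum_eq_single k]
    · rw [Finsupp.single_eq_same]
    · intro j _ hjk
      rw [Finsupp.single_eq_of_ne]
      exact fun he => hjk (𝔭.injective (Subtype.ext he.symm))
    · simp
  have haway : ∀ v ∉ placesAbove F ℓ, D v = 0 := by
    intro v hv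
    rw [hDdef, Finsupp.finsetSum_apply]
    refine Finset.sum_eq_zero fun j _ => ?_
    rw [Finsupp.single_eq_of_ne]
    exact fun he => hv (he ▸ (𝔭 j).2)
  have heq : combination 𝔭 hmin (fun i => logValInt 𝔭 x i.succ) = ⟨D, hdeg⟩ :=
    logDivisorZero_eq_of_eq_succ 𝔭 (fun v hv => combination_of_notMem 𝔭 hmin _ hv) haway
      fun i => by rw [combination_succ, happly]
  rw [heq]
  funext v
  rw [logDivisorCoeffs_apply]
  by_cases hv : v ∈ placesAbove F ℓ
  · obtain ⟨j, hj⟩ := 𝔭.surjective ⟨v, hv⟩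
    obtain rfl : (𝔭 j).1 = v := by rw [hj]
    rw [happly]
    rfl
  · rw [haway v hv, logValGlobal_ellUnit_of_notMem hv hx, PadicInt.coe_zero]

theorem logClass_combination_ellUnit {x : Fˣ} (hx : x ∈ ellUnits F ℓ) :
    logClass (combination 𝔭 hmin fun i => logValInt 𝔭 x i.succ) = 0 := by
  rw [logClass_eq_zero_iff]
  refine ⟨1 ⊗ₜ Additive.ofMul x, ?_⟩
  rw [logDiv_tmul, one_smul, logDivisorCoeffs_combination_ellUnit 𝔭 hmin hx]

theorem mem_span_of_logClass_combination_eq_zero {r : ℕ} {γ : Fin r → ellUnits F ℓ}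
    (hγ : Subgroup.closure (Set.range γ) ⊔ CommGroup.torsion (ellUnits F ℓ) = ⊤)
    {b : Fin t → ℤ_[ℓ]} (hb : logClass (combination 𝔭 hmin b) = 0) :
    b ∈ Submodule.span ℤ_[ℓ]
      (Set.range fun j => fun i : Fin t => logValInt 𝔭 (γ j : Fˣ) i.succ) := by
  obtain ⟨β, hβ⟩ := (logClass_eq_zero_iff _).1 hb
  have haway : ∀ v ∉ placesAbove F ℓ, logDiv F ℓ β v = 0 := fun v hv => by
    rw [hβ, logDivisorCoeffs_apply, combination_of_notMem 𝔭 hmin b hv, PadicInt.coe_zero]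
  obtain ⟨c, hc⟩ := (Submodule.mem_span_range_iff_exists_fun _).1 (logDiv_mem_span hγ haway)
  refine (Submodule.mem_span_range_iff_exists_fun _).2 ⟨c, ?_⟩
  funext k
  apply Subtype.ext
  have h := congrFun hc (𝔭 k.succ)
  rw [hβ, logDivisorCoeffs_apply, combination_succ] at h
  rw [← h, Finset.sum_apply, Finset.sum_apply, PadicInt.coe_sum]
  rfl

end Classes

end LogClass

/-! ### The presentation of the class group above `ℓ` -/

theorem mainTheorem5 (F : Type*) [Field F] [NumberField F] (ℓ : ℕ) [Fact ℓ.Prime]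
    -- the `s = t + 1 > 1` places above `ℓ`
    (t : ℕ) (ht : 0 < t) (𝔭 : Fin (t + 1) ≃ LogClass.placesAbove F ℓ)
    -- the first place has minimal valuation of degree
    (hmin : ∀ i, Padic.addValuation (LogClass.placeDeg ℓ (𝔭 0 : HeightOneSpectrum (𝓞 F))) ≤
      Padic.addValuation (LogClass.placeDeg ℓ (𝔭 i : HeightOneSpectrum (𝓞 F))))
    -- `ℓ`-units that generate the group of `ℓ`-units modulo torsion (in particular, any basis)
    (r : ℕ) (γ : Fin r → LogClass.ellUnits F ℓ)
    (hγ : Subgroup.closure (Set.range γ) ⊔ CommGroup.torsion (LogClass.ellUnits F ℓ) = ⊤) :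
    -- the classes of the divisors `𝔭 (i + 1) - (deg 𝔭 (i + 1) / deg 𝔭 0) 𝔭 0`
    let g : Fin t → LogClass.LogClassGroup F ℓ := fun i =>
      LogClass.logClass (LogClass.degZeroDivisor (hmin i.succ))
    Submodule.span ℤ_[ℓ] (Set.range g) = LogClass.logClassGroupAbove F ℓ ∧
    ∃ A : Matrix (Fin r) (Fin t) ℤ_[ℓ],
      (∀ j i, (A j i : ℚ_[ℓ]) =
        LogClass.logValGlobal F ℓ (Additive.ofMul (γ j : Fˣ)) (𝔭 i.succ)) ∧
      (∀ j, ∑ i, A j i • g i = 0) ∧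
      ∀ b : Fin t → ℤ_[ℓ],
        ∑ i, b i • g i = 0 ↔ b ∈ Submodule.span ℤ_[ℓ] (Set.range fun j => A j) := by
  intro g
  have hrel : ∀ j, ∑ i, LogClass.logValInt 𝔭 (γ j : Fˣ) i.succ • g i = 0 := fun j => by
    rw [← LogClass.logClass_combination_ellUnit 𝔭 hmin (γ j).2, LogClass.logClass_combination]
  refine ⟨LogClass.span_logClass_eq 𝔭 hmin,
    fun j i => LogClass.logValInt 𝔭 (γ j : Fˣ) i.succ, fun _ _ => rfl, hrel, fun b => ⟨?_, ?_⟩⟩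
  · intro hb
    refine LogClass.mem_span_of_logClass_combination_eq_zero 𝔭 hmin hγ ?_
    rw [LogClass.logClass_combination]
    exact hb
  · intro hb
    obtain ⟨c, rfl⟩ := (Submodule.mem_span_range_iff_exists_fun _).1 hb
    simp_rw [Finset.sum_apply, Pi.smul_apply, smul_eq_mul, Finset.sum_smul]
    rw [Finset.sum_comm]
    refine Finset.sum_eq_zero fun j _ => ?_
    simp_rw [mul_smul]
    rw [← Finset.smul_sum, hrel, smul_zero]
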